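/- All graphs are finite and simple. A proper dynamic $k$-coloring of a graph $G$ is a surjective map $c:V(G)\to\{1,\dots,k\}$ such that $c(u)\neq c(v)$ for adjacent $u,v$, and $|c(N_G(v))|\ge \min\{d(v),2\}$ for every vertex $v$; the dynamic chromatic number $\chi_d(G)$ is the smallest $k$ for which such a coloring exists. For $i\ge 2$, an $A_i$ of $G$ is a path in $G$ with $i$ vertices (not necessarily induced) whose two end-vertices have degree $3$ in $G$ and whose $i-2$ internal vertices have degree $2$ in $G$. Let $\mathscr{C}$ be the class of graphs $G$ with maximum degree $\Delta(G)\le 3$ that are claw-free (contain no induced $K_{1,3}$) and contain no $A_i$ with $i=3j+1$ for any integer $j\ge 1$. **Theorem.** The problem of deciding, for a given graph $G\in\mathscr{C}$, whether $G$ is dynamically $3$-colorable, i.e. whether $\chi_d(G)\le 3$, is solvable in polynomial time. That is, there are a Turing machine and a polynomial $q$ such that, for every $G\in\mathscr{C}$, the machine started on the adjacency matrix of $G$ halts with the correct answer after at most $q(\ell)$ steps, where $\ell$ is the length of the input. -/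

import Mathlib

/-- The claw `K_{1,3}` is not an induced subgraph of `G`. -/
def IsClawFree {V : Type} (G : SimpleGraph V) : Prop :=
  ¬ (completeBipartiteGraph (Fin 1) (Fin 3)).IsIndContained G

open Classical in
/-- The path `p` of `G` is an `A_i`: it has `i` vertices, its two end-vertices have degree `3` in
`G`, and all its internal vertices have degree `2` in `G`. (Here `p` is a path in `G`, not
necessarily an induced one.) -/
def IsA {V : Type} [Fintype V] (G : SimpleGraph V) (i : ℕ) {u v : V} (p : G.Walk u v) : Prop :=
  p.IsPath ∧ p.support.length = i ∧ G.degree u = 3 ∧ G.degree v = 3 ∧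
    ∀ w ∈ p.support, w ≠ u → w ≠ v → G.degree w = 2

/-- `G` contains no `A_i`. -/
def IsAFree {V : Type} [Fintype V] (G : SimpleGraph V) (i : ℕ) : Prop :=
  ∀ (u v : V) (p : G.Walk u v), ¬ IsA G i p

open Classical in
/-- The class of finite graphs of maximum degree at most `3` that are claw-free and `A_i`-free for
every `i = 3j + 1` with `j` a positive integer. -/
def InClassC {V : Type} [Fintype V] (G : SimpleGraph V) : Prop :=
  G.maxDegree ≤ 3 ∧ IsClawFree G ∧ ∀ j : ℕ, 1 ≤ j → IsAFree G (3 * j + 1)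

open Classical in
/-- `c` is a proper dynamic `k`-coloring of `G`: a surjective map onto the `k` colors such that
adjacent vertices get different colors and `|c(N(v))| ≥ min {d(v), 2}` for every vertex `v`. -/
def IsDynamicColoring {V : Type} [Fintype V] (G : SimpleGraph V) {k : ℕ} (c : V → Fin k) : Prop :=
  Function.Surjective c ∧ (∀ u v : V, G.Adj u v → c u ≠ c v) ∧
    ∀ v : V, min (G.degree v) 2 ≤ (c '' G.neighborSet v).ncard

/-- The dynamic chromatic number: the least `k` for which `G` has a proper dynamic `k`-coloring.
Such `k` exist (give all vertices different colors), and `k = 0` occurs only for the graph without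
vertices. -/
noncomputable def dynamicChromaticNumber {V : Type} [Fintype V] (G : SimpleGraph V) : ℕ :=
  sInf {k : ℕ | ∃ c : V → Fin k, IsDynamicColoring G c}

/-- An input graph: a simple graph whose vertices are labelled `0, …, n - 1`. -/
abbrev LabelledGraph : Type := Σ n : ℕ, SimpleGraph (Fin n)

open Classical in
/-- The adjacency matrix, written row by row as a word over the three-letter alphabet
`Option Bool`: `some true` and `some false` are the entries `1` and `0`, and `none` marks the end
of a row. -/
noncomputable def encodeGraph (G : LabelledGraph) : List (Option Bool) :=
  (List.finRange G.1).flatMap fun i =>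
    (List.finRange G.1).map (fun j => some (decide (G.2.Adj i j))) ++ [none]

/-- The decision problem given by the question `Q`, with inputs restricted to the graphs that
satisfy `P`, is solvable in polynomial time: some Turing machine, on the adjacency matrix of any
graph with property `P`, halts after a number of steps bounded by a polynomial in the length of
the input, with the correct answer to `Q` as its output. -/
def PolynomiallySolvableOn (P Q : LabelledGraph → Prop) : Prop :=
  ∃ answer : {G : LabelledGraph // P G} → Bool, (∀ G, answer G = true ↔ Q G.1) ∧
    Nonempty (Turing.TM2ComputableInPolyTime
      (fun G : {G : LabelledGraph // P G} => encodeGraph G.1) Computability.encodeBool answer)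

/-! Measure walks through vertices of degree two by their number of edges. In a claw-free graph of
maximum degree at most 3 every vertex of degree 3 lies in a triangle, so the dynamic condition
matters only at vertices of degree two: such a vertex and its two neighbours must carry all three
colours. With colours in `ZMod 3`, this says that the colour changes by a constant `1` or `-1` along
each walk through vertices of degree two. A closed walk, or one joining the two ends of a diamond
(which are always coloured alike), must therefore have length divisible by 3. This condition is
`NoBad`, and its necessity is `IsDyn.noBad`.

In the class at hand it is also sufficient. An `A_i` with `i = 3j + 1` has `3j` edges; as these are
excluded, a path through vertices of degree two between distinct vertices of degree 3 can be
coloured exactly when its ends have different colours, one of the two signs then being right. It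
remains to colour properly the link graph, in which the vertices of degree 3 are joined whenever
such a path connects them. There every vertex of degree 3 lies in a triangle, and `NoBad` excludes
`K₄` (`Tame.linkGraph_triCubic`), so a case of Brooks' theorem gives a 3-colouring
(`TriCubic.exists_coloring`). Paths are then oriented so that colours grow by one: links as the end
colours dictate, pendant paths away from their end of degree 3, all else arbitrarily. Counting steps
from a root colours the remaining vertices (`extendColoring_of_pos`).

`NoBad` can be tested in polynomial time: a walk is determined by its first directed edge, and only
its current edge and its length modulo 3 matter, so `3n²` steps from each edge suffice
(`DWalk.exists_lt`). The test is written with unary registers over the adjacency matrix, and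
structured stack programs compile to Turing machines with exact step counts (`compile_correct`,
`polynomiallySolvable_of_impl`, `decideBad_spec`). -/

section

/-! ### Structured stack programs and their compilation to Turing machines -/

open Turing Function

/-- Structured programs acting on a finite memory `σ` and on stacks `κ` over the alphabet `α`. -/
inductive StackProg (κ α σ : Type) : Type
  | push (k : κ) (f : σ → α)
  | pop (k : κ) (f : σ → Option α → σ)
  | load (f : σ → σ)
  | seq (p q : StackProg κ α σ)
  | ite (b : σ → Bool) (p q : StackProg κ α σ)
  | loop (b : σ → Bool) (p : StackProg κ α σ)

namespace StackProg

variable {κ α σ : Type}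

/-- A store: the memory and the contents of the stacks. -/
abbrev Store (κ α σ : Type) : Type := σ × (κ → List α)

/-- Big-step semantics with running time. -/
inductive Exec [DecidableEq κ] : StackProg κ α σ → Store κ α σ → Store κ α σ → ℕ → Prop
  | push (k f v S) : Exec (push k f) (v, S) (v, update S k (f v :: S k)) 1
  | pop (k f v S) : Exec (pop k f) (v, S) (f v (S k).head?, update S k (S k).tail) 1
  | load (f v S) : Exec (load f) (v, S) (f v, S) 1
  | seq {p q s s' s'' t t'} (h : Exec p s s' t) (h' : Exec q s' s'' t') :
      Exec (seq p q) s s'' (t + t')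
  | ite_true {b p q s s' t} (hb : b s.1 = true) (h : Exec p s s' t) : Exec (ite b p q) s s' (1 + t)
  | ite_false {b p q s s' t} (hb : b s.1 = false) (h : Exec q s s' t) :
      Exec (ite b p q) s s' (1 + t)
  | loop_false {b p s} (hb : b s.1 = false) : Exec (loop b p) s s 1
  | loop_true {b p s s' s'' t t'} (hb : b s.1 = true) (h : Exec p s s' t)
      (h' : Exec (loop b p) s' s'' t') : Exec (loop b p) s s'' (1 + t + t')

/-- The program points of a program. -/
def Point : StackProg κ α σ → Type
  | push _ _ => Unit
  | pop _ _ => Unit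
  | load _ => Unit
  | seq p q => p.Point ⊕ q.Point
  | ite _ p q => Option (p.Point ⊕ q.Point)
  | loop _ p => Option p.Point

/-- There are finitely many program points. -/
@[reducible]
noncomputable def fintypePoint : (p : StackProg κ α σ) → Fintype p.Point
  | push _ _ => inferInstanceAs (Fintype Unit)
  | pop _ _ => inferInstanceAs (Fintype Unit)
  | load _ => inferInstanceAs (Fintype Unit)
  | seq p q =>
    letI := p.fintypePoint
    letI := q.fintypePoint
    inferInstanceAs (Fintype (p.Point ⊕ q.Point))
  | ite _ p q =>
    letI := p.fintypePoint
    letI := q.fintypePoint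
    inferInstanceAs (Fintype (Option (p.Point ⊕ q.Point)))
  | loop _ p =>
    letI := p.fintypePoint
    inferInstanceAs (Fintype (Option p.Point))

/-- The program point at which the execution starts. -/
def entry : (p : StackProg κ α σ) → p.Point
  | push _ _ => ()
  | pop _ _ => ()
  | load _ => ()
  | seq p _ => Sum.inl p.entry
  | ite _ _ _ => none
  | loop _ _ => none

/-- The stack alphabets of the compiled machine; `none` is the output stack. -/
abbrev Alphabet (κ α β : Type) : Option κ → Type
  | none => β
  | some _ => α

/-- Compilation of a program whose points are embedded in a set of labels. -/
def compile {β Λ : Type} : (p : StackProg κ α σ) → (p.Point → Λ) → Λ → p.Point →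
    TM2.Stmt (Alphabet κ α β) Λ σ
  | push k f, _, l, _ => .push (some k) f (.goto fun _ => l)
  | pop k f, _, l, _ => .pop (some k) f (.goto fun _ => l)
  | load f, _, l, _ => .load f (.goto fun _ => l)
  | seq p q, e, _, .inl x => p.compile (fun y => e (.inl y)) (e (.inr q.entry)) x
  | seq _ q, e, l, .inr x => q.compile (fun y => e (.inr y)) l x
  | ite b p q, e, _, none =>
    .branch b (.goto fun _ => e (some (.inl p.entry))) (.goto fun _ => e (some (.inr q.entry)))
  | ite _ p _, e, l, some (.inl x) => p.compile (fun y => e (some (.inl y))) l x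
  | ite _ _ q, e, l, some (.inr x) => q.compile (fun y => e (some (.inr y))) l x
  | loop b p, e, l, none => .branch b (.goto fun _ => e (some p.entry)) (.goto fun _ => l)
  | loop _ p, e, _, some x => p.compile (fun y => e (some y)) (e none) x

/-- The stacks of the compiled machine, with empty output. -/
def outStacks {β : Type} (S : κ → List α) : ∀ k, List (Alphabet κ α β k)
  | none => []
  | some k => S k

theorem update_outStacks [DecidableEq κ] {β : Type} (S : κ → List α) (k : κ) (l : List α) :
    update (outStacks (β := β) S) (some k) l = outStacks (update S k l) := by
  funext x
  cases x with
  | none => simp [outStacks]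
  | some x =>
    by_cases h : x = k
    · subst h; simp [outStacks]
    · have : some x ≠ some k := by simpa using h
      rw [update_of_ne this]
      simp [outStacks, update_of_ne h]

/-- Induction on the execution. The running time is exact: a primitive and each test of `ite` or
`loop` cost one machine step, sequencing costs none. Generality in the embedding `e` and the exit
label `l` makes the induction hypothesis apply to subprograms inside a larger machine. -/
theorem compile_correct [DecidableEq κ] {β Λ : Type} {M : Λ → TM2.Stmt (Alphabet κ α β) Λ σ}
    {p : StackProg κ α σ} {s s' : Store κ α σ} {t : ℕ} (h : Exec p s s' t) :
    ∀ (e : p.Point → Λ) (l : Λ), (∀ x, M (e x) = p.compile e l x) →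
      (flip bind (TM2.step M))^[t] (some ⟨some (e p.entry), s.1, outStacks s.2⟩) =
        some ⟨some l, s'.1, outStacks s'.2⟩ := by
  induction h with
  | push k f v S =>
    intro e l hM
    change some (TM2.stepAux (M (e (entry _))) _ _) = _
    rw [hM]
    simp [compile, ← update_outStacks, outStacks]
  | pop k f v S =>
    intro e l hM
    change some (TM2.stepAux (M (e (entry _))) _ _) = _
    rw [hM]
    simp [compile, ← update_outStacks, outStacks]
  | load f v S =>
    intro e l hM
    change some (TM2.stepAux (M (e (entry _))) _ _) = _
    rw [hM]
    simp [compile]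
  | @seq p q s s' s'' t t' _ _ ih ih' =>
    intro e l hM
    rw [add_comm, iterate_add_apply]
    have h1 := ih (fun y => e (.inl y)) (e (.inr q.entry)) (fun x => hM (.inl x))
    have h2 := ih' (fun y => e (.inr y)) l (fun x => hM (.inr x))
    exact (congrArg _ h1).trans h2
  | @ite_true b p q s s' t hb _ ih =>
    intro e l hM
    rw [add_comm, iterate_add_apply]
    have h1 := ih (fun y => e (some (.inl y))) l (fun x => hM (some (.inl x)))
    refine (congrArg _ ?_).trans h1
    change some (TM2.stepAux (M (e (entry _))) _ _) = _
    rw [hM]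
    simp [entry, compile, hb]
  | @ite_false b p q s s' t hb _ ih =>
    intro e l hM
    rw [add_comm, iterate_add_apply]
    have h1 := ih (fun y => e (some (.inr y))) l (fun x => hM (some (.inr x)))
    refine (congrArg _ ?_).trans h1
    change some (TM2.stepAux (M (e (entry _))) _ _) = _
    rw [hM]
    simp [entry, compile, hb]
  | loop_false hb =>
    intro e l hM
    change some (TM2.stepAux (M (e (entry _))) _ _) = _
    rw [hM]
    simp [entry, compile, hb]
  | @loop_true b p s s' s'' t t' hb _ _ ih ih' =>
    intro e l hM
    rw [add_comm, iterate_add_apply, add_comm 1 t, iterate_add_apply]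
    have h1 := ih (fun y => e (some y)) (e none) (fun x => hM (some x))
    refine (congrArg _ ((congrArg _ ?_).trans h1)).trans (ih' e l hM)
    change some (TM2.stepAux (M (e (entry _))) _ _) = _
    rw [hM]
    simp [entry, compile, hb]

/-- The machine that runs a program and then outputs one symbol computed from the memory. -/
noncomputable def machine [DecidableEq κ] [Fintype κ] [Fintype α] [Fintype σ] (p : StackProg κ α σ)
    (k₀ : κ) (v₀ : σ) {β : Type} (out : σ → β) : FinTM2 :=
  letI := p.fintypePoint
  { K := Option κ
    k₀ := some k₀
    k₁ := none
    Γ := Alphabet κ α β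
    Λ := Option p.Point
    main := some p.entry
    σ := σ
    initialState := v₀
    Γk₀Fin := inferInstanceAs (Fintype α)
    m := fun x => match x with
      | none => .push none out (.load (fun _ => v₀) .halt)
      | some x => p.compile some none x }

/-- A halted machine must have its initial memory and nothing but the output on its stacks. Hence
the program has to empty its stacks, and the final block, which accounts for the additional step,
resets the memory after writing. -/
theorem machine_outputs [DecidableEq κ] [Fintype κ] [Fintype α] [Fintype σ] (p : StackProg κ α σ)
    (k₀ : κ) (v₀ : σ) {β : Type} (out : σ → β) (l : List α) {v : σ} {t T : ℕ}
    (h : Exec p (v₀, update (fun _ => []) k₀ l) (v, fun _ => []) t) (hT : t + 1 ≤ T) :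
    Nonempty (TM2OutputsInTime (p.machine k₀ v₀ out) l (some [out v]) T) := by
  refine ⟨⟨⟨t + 1, ?_⟩, hT⟩⟩
  have h1 := compile_correct (β := β) (M := (p.machine k₀ v₀ out).m) h some none (fun x => rfl)
  rw [add_comm, iterate_add_apply]
  have h0 : initList (p.machine k₀ v₀ out) l = ⟨some (some p.entry), v₀,
      outStacks (update (fun _ => []) k₀ l)⟩ := by
    simp only [initList]
    congr 1
    funext k
    cases k with
    | none => rfl
    | some k =>
      by_cases hk : k = k₀
      · subst hk
        simp [outStacks, machine]
        rfl
      · have : some k ≠ some k₀ := by simpa using hk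
        simp [outStacks, machine, this, update_of_ne hk]
  rw [h0]
  refine (congrArg _ h1).trans ?_
  change some _ = some _
  congr 1
  simp only [haltList]
  change TM2.stepAux (Γ := Alphabet κ α β) (.push none out (.load (fun _ => v₀) .halt)) _ _ = _
  simp only [TM2.stepAux]
  congr 1
  funext k
  cases k with
  | none =>
    simp [machine, outStacks]
    rfl
  | some k => simp [outStacks, machine]

/-- Big-step semantics with a bound for the running time. -/
def Runs [DecidableEq κ] (p : StackProg κ α σ) (s s' : Store κ α σ) (T : ℕ) : Prop :=
  ∃ t ≤ T, Exec p s s' t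

variable [DecidableEq κ] {p q : StackProg κ α σ} {s s' s'' : Store κ α σ} {T T' : ℕ}

theorem Runs.mono (h : Runs p s s' T) (hT : T ≤ T') : Runs p s s' T' :=
  let ⟨t, ht, h⟩ := h
  ⟨t, ht.trans hT, h⟩

theorem Runs.seq (h : Runs p s s' T) (h' : Runs q s' s'' T') : Runs (p.seq q) s s'' (T + T') :=
  let ⟨t, ht, h⟩ := h
  let ⟨t', ht', h'⟩ := h'
  ⟨t + t', add_le_add ht ht', h.seq h'⟩

theorem Runs.ite {b : σ → Bool} (h : b s.1 = true → Runs p s s' T)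
    (h' : b s.1 = false → Runs q s s' T) : Runs (StackProg.ite b p q) s s' (T + 1) := by
  cases hb : b s.1 with
  | true =>
    obtain ⟨t, ht, h⟩ := h hb
    exact ⟨1 + t, by omega, .ite_true hb h⟩
  | false =>
    obtain ⟨t, ht, h⟩ := h' hb
    exact ⟨1 + t, by omega, .ite_false hb h⟩

theorem Runs.loop_false {b : σ → Bool} (hb : b s.1 = false) : Runs (loop b p) s s 1 :=
  ⟨1, le_rfl, .loop_false hb⟩

theorem Runs.loop_true {b : σ → Bool} (hb : b s.1 = true) (h : Runs p s s' T)
    (h' : Runs (loop b p) s' s'' T') : Runs (loop b p) s s'' (1 + T + T') :=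
  let ⟨t, ht, h⟩ := h
  let ⟨t', ht', h'⟩ := h'
  ⟨1 + t + t', by omega, h.loop_true hb h'⟩

theorem Runs.push (k : κ) (f : σ → α) (v : σ) (S : κ → List α) :
    Runs (push k f) (v, S) (v, update S k (f v :: S k)) 1 :=
  ⟨1, le_rfl, .push ..⟩

theorem Runs.pop (k : κ) (f : σ → Option α → σ) (v : σ) (S : κ → List α) :
    Runs (pop k f) (v, S) (f v (S k).head?, update S k (S k).tail) 1 :=
  ⟨1, le_rfl, .pop ..⟩

theorem Runs.load (f : σ → σ) (v : σ) (S : κ → List α) :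
    Runs (load f) (v, S) (f v, S) 1 :=
  ⟨1, le_rfl, .load ..⟩

end StackProg

end

/-! ### The graph machine: unary registers and access to the adjacency matrix -/

section

open Turing Function StackProg

/-- The stacks of the graph machine: the input, a stack that holds the part of the input which has
been read, two auxiliary stacks and ten registers. -/
inductive Stk : Type
  | inp | aux | t1 | t2
  | reg (r : Fin 10)

noncomputable instance : DecidableEq Stk := Classical.decEq _

noncomputable instance : Fintype Stk :=
  Fintype.ofSurjective (fun x : Fin 4 ⊕ Fin 10 => match x with
    | .inl 0 => Stk.inp
    | .inl 1 => .aux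
    | .inl 2 => .t1
    | .inl 3 => .t2
    | .inr r => .reg r) fun z => by
      rcases z with _ | _ | _ | _ | r
      exacts [⟨.inl 0, rfl⟩, ⟨.inl 1, rfl⟩, ⟨.inl 2, rfl⟩, ⟨.inl 3, rfl⟩, ⟨.inr r, rfl⟩]

/-- The finite data computed by the graph machine. -/
structure Flags : Type where
  /-- result of the last test -/
  test : Bool
  /-- conjunction of several tests -/
  acc : Bool
  /-- the two ends of the current walk are forced to have the same colour -/
  same : Bool
  /-- an obstruction was found -/
  bad : Bool
  /-- length of the current walk modulo three -/
  len : ZMod 3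
  /-- number of neighbours seen, at most three -/
  cnt : Fin 4

noncomputable instance : Fintype Flags :=
  Fintype.ofInjective (β := Bool × Bool × Bool × Bool × ZMod 3 × Fin 4)
    (fun f => (f.test, f.acc, f.same, f.bad, f.len, f.cnt)) fun f g h => by
      cases f
      cases g
      simpa using h

/-- Flags and two cells for the symbols read. -/
abbrev Memory : Type := Flags × Option (Option Bool) × Option (Option Bool)

/-- Programs of the graph machine. -/
abbrev GProg : Type := StackProg Stk (Option Bool) Memory

namespace GProg

/-- Do nothing. -/
abbrev skip : GProg := .load id

/-- Pop into the first cell. -/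
abbrev popFst (k : Stk) : GProg := .pop k fun v a => (v.1, a, v.2.2)

/-- Pop into the second cell. -/
abbrev popSnd (k : Stk) : GProg := .pop k fun v a => (v.1, v.2.1, a)

/-- Push the first cell. -/
abbrev pushFst (k : Stk) : GProg := .push k fun v => v.2.1.getD none

/-- Push the first cell on several stacks. -/
def pushAll : List Stk → GProg
  | [] => skip
  | k :: ks => .seq (pushFst k) (pushAll ks)

/-- Empty a stack and push its elements on several other stacks. -/
def drain (k : Stk) (ks : List Stk) : GProg :=
  .seq (popFst k) (.loop (fun v => v.2.1.isSome) (.seq (pushAll ks) (popFst k)))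

theorem runs_of_eq {p : GProg} {s s' s'' : Store Stk (Option Bool) Memory} {T T' : ℕ}
    (h : Runs p s s' T) (hs : s' = s'') (hT : T ≤ T') : Runs p s s'' T' :=
  hs ▸ h.mono hT

theorem pushAll_runs (f : Flags) (a : Option Bool) (y : Option (Option Bool)) :
    ∀ (ks : List Stk), ks.Nodup → ∀ S : Stk → List (Option Bool),
      Runs (pushAll ks) ((f, some a, y), S)
        ((f, some a, y), fun z => if z ∈ ks then a :: S z else S z) (ks.length + 1) := by
  intro ks
  induction ks with
  | nil =>
    intro _ S
    refine runs_of_eq (Runs.load _ _ _) ?_ (by simp)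
    simp
  | cons k ks ih =>
    intro hk S
    rw [List.nodup_cons] at hk
    refine runs_of_eq ((Runs.push _ _ _ _).seq (ih hk.2 _)) ?_ (by simp; omega)
    congr 1
    funext z
    by_cases hz : z = k
    · subst hz
      simp [hk.1]
    · simp [hz]

/-- The loop reads one symbol ahead: of the word `l` still to be drained, the head is already in the
first cell and only the tail is on the stack, so that an empty cell signals the end. The later loops
follow the same convention. -/
theorem drain_loop_runs (f : Flags) (y : Option (Option Bool)) (k : Stk) (ks : List Stk)
    (hks : ks.Nodup) (hk : k ∉ ks) :
    ∀ (l : List (Option Bool)) (S : Stk → List (Option Bool)), S k = l.tail →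
      Runs (.loop (fun v => v.2.1.isSome) (.seq (pushAll ks) (popFst k)))
        ((f, l.head?, y), S)
        ((f, none, y), fun z => if z = k then [] else if z ∈ ks then l.reverse ++ S z else S z)
        (1 + l.length * (ks.length + 3)) := by
  intro l
  induction l with
  | nil =>
    intro S hS
    refine runs_of_eq (Runs.loop_false (by simp)) ?_ (by simp)
    congr 1
    funext z
    by_cases hz : z = k
    · subst hz
      simpa using hS
    · simp [hz]
  | cons a l ih =>
    intro S hS
    simp only [List.tail_cons] at hS
    have h1 := (pushAll_runs f a y ks hks S).seq (Runs.pop k (fun v a => (v.1, a, v.2.2)) _ _)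
    simp only [hk, if_false, hS] at h1
    refine runs_of_eq (Runs.loop_true (by simp) h1 (ih _ (by simp))) ?_ ?_
    · congr 1
      funext z
      by_cases hz : z = k
      · simp [hz]
      · by_cases hz' : z ∈ ks <;> simp [hz, hz']
    · simp only [List.length_cons]
      ring_nf
      omega

theorem drain_runs (f : Flags) (x y : Option (Option Bool)) (k : Stk) (ks : List Stk)
    (hks : ks.Nodup) (hk : k ∉ ks) (S : Stk → List (Option Bool)) :
    Runs (drain k ks) ((f, x, y), S)
      ((f, none, y), fun z => if z = k then [] else if z ∈ ks then (S k).reverse ++ S z else S z)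
      (2 + (S k).length * (ks.length + 3)) := by
  refine runs_of_eq ((Runs.pop _ _ _ _).seq (drain_loop_runs f y k ks hks hk (S k) _ ?_)) ?_ ?_
  · simp
  · congr 1
    funext z
    by_cases hz : z = k <;> simp [hz]
  · omega

/-- Test whether two registers are equal. -/
def eqTest (i j : Fin 10) : GProg :=
  .seq (popFst (.reg i)) <| .seq (popSnd (.reg j)) <|
  .seq (.loop (fun v => v.2.1.isSome && v.2.2.isSome) <|
    .seq (.push .t1 fun _ => none) <| .seq (popFst (.reg i)) (popSnd (.reg j))) <|
  .seq (.load fun v => ({v.1 with test := v.2.1.isNone && v.2.2.isNone}, v.2)) <|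
  .seq (.ite (fun v => v.2.1.isSome) (.push (.reg i) fun _ => none) skip) <|
  .seq (.ite (fun v => v.2.2.isSome) (.push (.reg j) fun _ => none) skip) <|
  .seq (.load fun v => (v.1, none, none)) (drain .t1 [.reg i, .reg j])

/-- Each round removes one unit from both registers and records it on `t1`. After `min a b` rounds
the two truncated differences are left, still read ahead. -/
theorem eqTest_loop_runs (f : Flags) (i j : Fin 10) (hij : i ≠ j) :
    ∀ (a b : ℕ) (S : Stk → List (Option Bool)), S (.reg i) = (List.replicate a none).tail →
      S (.reg j) = (List.replicate b none).tail →
      Runs (.loop (fun v => v.2.1.isSome && v.2.2.isSome) <|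
        .seq (.push .t1 fun _ => none) <| .seq (popFst (.reg i)) (popSnd (.reg j)))
        ((f, (List.replicate a none).head?, (List.replicate b none).head?), S)
        ((f, (List.replicate (a - min a b) none).head?, (List.replicate (b - min a b) none).head?),
          update (update (update S (.reg i) (List.replicate (a - min a b) none).tail)
            (.reg j) (List.replicate (b - min a b) none).tail)
            .t1 (List.replicate (min a b) none ++ S .t1))
        (1 + a * 4) := by
  intro a
  induction a with
  | zero =>
    intro b S hi hj
    refine runs_of_eq (Runs.loop_false (by simp)) ?_ (by simp)
    simp only [Nat.zero_min, Nat.sub_zero, List.replicate_zero, List.nil_append] at hi hj ⊢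
    rw [← hi, ← hj]
    simp
  | succ a ih =>
    intro b S hi hj
    cases b with
    | zero =>
      refine runs_of_eq (Runs.loop_false (by simp)) ?_ (by omega)
      simp only [Nat.min_zero, Nat.sub_zero, List.replicate_zero, List.nil_append] at hi hj ⊢
      rw [← hi, ← hj]
      simp
    | succ b =>
      have h1 := (Runs.push .t1 (fun _ => none) (f, (List.replicate (a + 1) none).head?,
        (List.replicate (b + 1) none).head?) S).seq <|
        (Runs.pop (.reg i) (fun v a => (v.1, a, v.2.2)) _ _).seq
        (Runs.pop (.reg j) (fun v a => (v.1, v.2.1, a)) _ _)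
      simp only [List.replicate_succ, List.tail_cons] at hi hj
      have hij' : Stk.reg j ≠ Stk.reg i := by simpa using hij.symm
      simp only [ne_eq, reduceCtorEq, not_false_eq_true, update_of_ne, hi, hj, hij'] at h1
      refine runs_of_eq (Runs.loop_true (by simp [List.replicate_succ]) h1
        (ih b _ ?_ ?_)) ?_ ?_
      · rw [update_of_ne hij'.symm, update_self]
      · rw [update_self]
      · have e1 : a + 1 - min (a + 1) (b + 1) = a - min a b := by omega
        have e2 : b + 1 - min (a + 1) (b + 1) = b - min a b := by omega
        have e3 : min (a + 1) (b + 1) = min a b + 1 := by omega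
        rw [e1, e2, e3]
        congr 1
        funext z
        by_cases h1 : z = .t1
        · subst h1
          simp [List.replicate_succ']
        · by_cases h2 : z = .reg j
          · simp [h2]
          · by_cases h3 : z = .reg i <;> simp [h1, h2, h3, hij]
      · omega

theorem pushBackFst_runs (f : Flags) (i : Fin 10) (x : ℕ) (y : Option (Option Bool))
    (S : Stk → List (Option Bool)) (hi : S (.reg i) = (List.replicate x none).tail) :
    Runs (.ite (fun v => v.2.1.isSome) (.push (.reg i) fun _ => none) skip)
      ((f, (List.replicate x none).head?, y), S)
      ((f, (List.replicate x none).head?, y), update S (.reg i) (List.replicate x none)) 2 := by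
  cases x with
  | zero =>
    refine Runs.ite (by simp) fun _ => runs_of_eq (Runs.load _ _ _) ?_ le_rfl
    simp only [List.replicate_zero, List.tail_nil] at hi
    simp [← hi]
  | succ x =>
    refine Runs.ite (fun _ => runs_of_eq (Runs.push _ _ _ _) ?_ le_rfl)
      (by simp [List.replicate_succ])
    rw [hi]
    simp [List.replicate_succ]

theorem pushBackSnd_runs (f : Flags) (i : Fin 10) (x : Option (Option Bool)) (y : ℕ)
    (S : Stk → List (Option Bool)) (hi : S (.reg i) = (List.replicate y none).tail) :
    Runs (.ite (fun v => v.2.2.isSome) (.push (.reg i) fun _ => none) skip)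
      ((f, x, (List.replicate y none).head?), S)
      ((f, x, (List.replicate y none).head?), update S (.reg i) (List.replicate y none)) 2 := by
  cases y with
  | zero =>
    refine Runs.ite (by simp) fun _ => runs_of_eq (Runs.load _ _ _) ?_ le_rfl
    simp only [List.replicate_zero, List.tail_nil] at hi
    simp [← hi]
  | succ y =>
    refine Runs.ite (fun _ => runs_of_eq (Runs.push _ _ _ _) ?_ le_rfl)
      (by simp [List.replicate_succ])
    rw [hi]
    simp [List.replicate_succ]

/-- The numbers agree exactly when both differences left by the loop are zero. Pushing back the
symbols read ahead and draining `t1` onto both registers restores them. -/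
theorem eqTest_runs (f : Flags) (i j : Fin 10) (hij : i ≠ j) (a b : ℕ)
    (S : Stk → List (Option Bool)) (hi : S (.reg i) = List.replicate a none)
    (hj : S (.reg j) = List.replicate b none) (ht : S .t1 = []) :
    Runs (eqTest i j) ((f, none, none), S) (({f with test := decide (a = b)}, none, none), S)
      (20 + a * 9) := by
  have hij' : Stk.reg j ≠ Stk.reg i := by simpa using hij.symm
  have h0 := Runs.pop (.reg i) (fun (v : Memory) a => (v.1, a, v.2.2)) (f, none, none) S
  have h1 := Runs.pop (.reg j) (fun (v : Memory) a => (v.1, v.2.1, a))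
    (f, (S (.reg i)).head?, none) (update S (.reg i) (S (.reg i)).tail)
  rw [update_of_ne hij', hi, hj] at h1
  rw [hi] at h0
  have h2 := eqTest_loop_runs f i j hij a b
    (S := update (update S (.reg i) (List.replicate a none).tail)
      (.reg j) (List.replicate b none).tail)
    (by rw [update_of_ne hij'.symm, update_self]) (by rw [update_self])
  refine runs_of_eq (h0.seq <| h1.seq <| h2.seq <| (Runs.load _ _ _).seq <|
    (pushBackFst_runs _ i (a - min a b) _ _ ?_).seq <|
    (pushBackSnd_runs _ j _ (b - min a b) _ ?_).seq <|
    (Runs.load _ _ _).seq <| drain_runs _ _ _ _ _ ?_ ?_ _) ?_ ?_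
  · simp [hij]
  · simp [hij.symm]
  · simp [hij]
  · simp
  · congr 1
    · congr 2
      rcases le_or_gt a b with h | h
      · rcases h.eq_or_lt with h | h
        · simp [h]
        · have : ¬ a = b := by omega
          obtain ⟨c, hc⟩ : ∃ c, b - a = c + 1 := ⟨b - a - 1, by omega⟩
          simp [this, h.le, hc, List.replicate_succ]
      · have : ¬ a = b := by omega
        obtain ⟨c, hc⟩ : ∃ c, a - b = c + 1 := ⟨a - b - 1, by omega⟩
        simp [this, h.le, hc, List.replicate_succ]
    · funext z
      by_cases h1 : z = .t1
      · simp [h1, ht]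
      · by_cases h2 : z = .reg j
        · simp [h2, hj, ht]
        · by_cases h3 : z = .reg i
          · simp [h3, hi, ht, hij]
          · simp [h1, h2, h3]
  · simp [ht]
    omega

/-- The part of a word after its first row. -/
def rowRest : List (Option Bool) → List (Option Bool)
  | [] => []
  | none :: l => l
  | some _ :: l => rowRest l

/-- The first row of a word. -/
def rowPart : List (Option Bool) → List (Option Bool)
  | [] => []
  | none :: _ => [none]
  | some b :: l => some b :: rowPart l

theorem rowPart_append_rowRest : ∀ l, rowPart l ++ rowRest l = l
  | [] => rfl
  | none :: _ => rfl
  | some b :: l => by simp [rowPart, rowRest, rowPart_append_rowRest l]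

theorem length_rowRest_le (l : List (Option Bool)) : (rowRest l).length ≤ l.length := by
  conv_rhs => rw [← rowPart_append_rowRest l, List.length_append]
  omega

/-- Move the input head. -/
noncomputable abbrev setInp (S : Stk → List (Option Bool)) (l a : List (Option Bool)) :
    Stk → List (Option Bool) :=
  update (update S .inp l) .aux a

/-- Move the input head over one row. -/
def skipRow : GProg :=
  .seq (popFst .inp) <|
  .seq (.loop (fun v => (v.2.1.getD none).isSome) (.seq (pushFst .aux) (popFst .inp))) <|
  .seq (.ite (fun v => v.2.1.isSome) (pushFst .aux) skip) (.load fun v => (v.1, none, v.2.2))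

/-- The loop stops at the row terminator or at the end of the word. That symbol is still in the cell
`x` and not yet on `aux`, hence `x.toList` in the equation and the exclusion of matrix entries for
`x`. -/
theorem skipRow_loop_runs (f : Flags) (y : Option (Option Bool)) :
    ∀ (l : List (Option Bool)) (S : Stk → List (Option Bool)), S .inp = l.tail →
      ∃ x a, Runs (.loop (fun v => (v.2.1.getD none).isSome) (.seq (pushFst .aux) (popFst .inp)))
        ((f, l.head?, y), S) ((f, x, y), setInp S (rowRest l) a) (1 + 3 * l.length) ∧
        x.toList ++ a = (rowPart l).reverse ++ S .aux ∧ x ≠ some (some true) ∧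
          x ≠ some (some false) := by
  intro l
  induction l with
  | nil =>
    intro S hS
    refine ⟨none, S .aux, runs_of_eq (Runs.loop_false (by simp)) ?_ (by simp), by simp [rowPart],
      by simp, by simp⟩
    simp only [List.tail_nil] at hS
    simp [setInp, rowRest, ← hS]
  | cons c l ih =>
    intro S hS
    simp only [List.tail_cons] at hS
    cases c with
    | none =>
      refine ⟨some none, S .aux, runs_of_eq (Runs.loop_false (by simp)) ?_ (by simp),
        by simp [rowPart], by simp, by simp⟩
      simp [setInp, rowRest, ← hS]
    | some b =>
      have h1 := (Runs.push .aux (fun (v : Memory) => v.2.1.getD none) (f, some (some b), y) S).seq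
        (Runs.pop .inp (fun (v : Memory) a => (v.1, a, v.2.2)) _ _)
      simp only [ne_eq, reduceCtorEq, not_false_eq_true, update_of_ne, hS] at h1
      obtain ⟨x, a, h2, h3, h4⟩ := ih (update (update S .aux (some b :: S .aux)) .inp l.tail)
        (by simp)
      refine ⟨x, a, runs_of_eq (Runs.loop_true (by simp) h1 h2) ?_ ?_, ?_, h4⟩
      · congr 1
        funext z
        by_cases h1 : z = .aux
        · simp [h1]
        · by_cases h2 : z = .inp <;> simp [h1, h2, rowRest]
      · simp only [List.length_cons]
        omega
      · simpa [rowPart] using h3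

theorem skipRow_runs (f : Flags) (y : Option (Option Bool)) (x : Option (Option Bool))
    (S : Stk → List (Option Bool)) :
    Runs skipRow ((f, x, y), S)
      ((f, none, y), setInp S (rowRest (S .inp)) ((rowPart (S .inp)).reverse ++ S .aux))
      (5 + 3 * (S .inp).length) := by
  obtain ⟨x', a, h1, h2, h3, h4⟩ := skipRow_loop_runs f y (S .inp)
    (update S .inp (S .inp).tail) (by simp)
  have h0 : Runs (.ite (fun v => v.2.1.isSome) (pushFst .aux) skip)
      ((f, x', y), setInp (update S .inp (S .inp).tail) (rowRest (S .inp)) a)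
      ((f, x', y), setInp S (rowRest (S .inp)) ((rowPart (S .inp)).reverse ++ S .aux)) 2 := by
    simp only [ne_eq, reduceCtorEq, not_false_eq_true, update_of_ne] at h2
    rw [← h2]
    refine Runs.ite (fun h => ?_) (fun h => ?_)
    · refine runs_of_eq (Runs.push _ _ _ _) ?_ le_rfl
      rcases x' with _ | _ | _ | _ <;> simp at h h3 h4 ⊢
    · refine runs_of_eq (Runs.load _ _ _) ?_ le_rfl
      rcases x' with _ | _ | _ | _ <;> simp [setInp] at h h3 h4 ⊢
  refine runs_of_eq ((Runs.pop _ _ _ _).seq <| h1.seq <| h0.seq (Runs.load _ _ _)) rfl (by omega)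

/-- Move the input head over one symbol. -/
def skipOne : GProg :=
  .seq (popFst .inp) <|
  .seq (.ite (fun v => v.2.1.isSome) (pushFst .aux) skip) (.load fun v => (v.1, none, v.2.2))

theorem skipOne_runs (f : Flags) (y : Option (Option Bool)) (x : Option (Option Bool))
    (S : Stk → List (Option Bool)) :
    Runs skipOne ((f, x, y), S)
      ((f, none, y), setInp S (S .inp).tail ((S .inp).head?.toList ++ S .aux)) 4 := by
  have h0 : Runs (.ite (fun v => v.2.1.isSome) (pushFst .aux) skip)
      ((f, (S .inp).head?, y), update S .inp (S .inp).tail)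
      ((f, (S .inp).head?, y), setInp S (S .inp).tail ((S .inp).head?.toList ++ S .aux)) 2 := by
    cases h : S .inp with
    | nil =>
      refine Runs.ite (by simp) (fun _ => runs_of_eq (Runs.load _ _ _) ?_ le_rfl)
      simp
    | cons a l =>
      refine Runs.ite (fun _ => runs_of_eq (Runs.push _ _ _ _) ?_ le_rfl) (by simp)
      simp
  exact runs_of_eq ((Runs.pop _ _ _ _).seq <| h0.seq (Runs.load _ _ _)) rfl (by omega)

/-- Execute a program as many times as the value of a register, which is moved to another stack. -/
def forReg (i : Fin 10) (t : Stk) (p : GProg) : GProg :=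
  .seq (popFst (.reg i)) <|
  .loop (fun v => v.2.1.isSome) (.seq (.push t fun _ => none) (.seq p (popFst (.reg i))))

/-- The invariant is that the reversal of `aux` followed by the unread input is always the same
word, so moving the head loses nothing. As `g` never lengthens the unread input, the bound `m`
persists and `T` bounds every round. -/
theorem forReg_loop_runs {p : GProg} {g : List (Option Bool) → List (Option Bool)} {m T : ℕ}
    {i : Fin 10} {t : Stk} (f : Flags) (y : Option (Option Bool)) (hti : t ≠ .reg i)
    (hta : t ≠ .aux) (htn : t ≠ .inp) (hg : ∀ l, (g l).length ≤ l.length)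
    (hp : ∀ x S, (S .inp).length ≤ m → ∃ a, a.reverse ++ g (S .inp) = (S .aux).reverse ++ S .inp ∧
      Runs p ((f, x, y), S) ((f, none, y), setInp S (g (S .inp)) a) T) :
    ∀ (c : ℕ) (S : Stk → List (Option Bool)), (S .inp).length ≤ m →
      S (.reg i) = (List.replicate c none).tail → ∃ a,
        a.reverse ++ g^[c] (S .inp) = (S .aux).reverse ++ S .inp ∧
        Runs (.loop (fun v => v.2.1.isSome) (.seq (.push t fun _ => none)
          (.seq p (popFst (.reg i)))))
        ((f, (List.replicate c none).head?, y), S)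
        ((f, none, y), update (update (setInp S (g^[c] (S .inp)) a) (.reg i) [])
          t (List.replicate c none ++ S t)) (1 + c * (T + 3)) := by
  intro c
  induction c with
  | zero =>
    intro S hm hS
    refine ⟨S .aux, by simp, runs_of_eq (Runs.loop_false (by simp)) ?_ (by simp)⟩
    simp only [List.replicate_zero, List.tail_nil] at hS
    congr 1
    funext z
    by_cases h1 : z = t
    · simp [h1]
    · by_cases h2 : z = .reg i
      · rw [update_of_ne h1, h2, update_self, hS]
      · by_cases h3 : z = .aux
        · subst h3
          simp [h1]
        · by_cases h4 : z = .inp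
          · subst h4
            simp [h1]
          · simp [h1, h2, h3, h4]
  | succ c ih =>
    intro S hm hS
    simp only [List.replicate_succ, List.tail_cons] at hS
    have hti' := hti.symm
    have hta' := hta.symm
    have htn' := htn.symm
    obtain ⟨a, ha, h1⟩ := hp (some none) (update S t (none :: S t)) (by simpa [htn'] using hm)
    have h2 := (Runs.push t (fun _ => none) (f, some none, y) S).seq <| h1.seq
      (Runs.pop (.reg i) (fun (v : Memory) a => (v.1, a, v.2.2)) _ _)
    simp only [ne_eq, reduceCtorEq, not_false_eq_true, update_of_ne, hS, hti', hta', htn'] at h2 ha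
    obtain ⟨a', ha', h3⟩ := ih (update (setInp (update S t (none :: S t)) (g (S .inp)) a) (.reg i)
      (List.replicate c none).tail) (by simpa using (hg _).trans hm) (by simp)
    refine ⟨a', ?_, runs_of_eq (Runs.loop_true (by simp [List.replicate_succ]) h2 h3) ?_ ?_⟩
    · simp only [ne_eq, reduceCtorEq, not_false_eq_true, update_of_ne, update_self] at ha'
      rw [iterate_succ_apply, ha', ha]
    · congr 1
      funext z
      by_cases h1 : z = t
      · simp [h1, hti, hta, htn, List.replicate_succ']
      · by_cases h2 : z = .reg i
        · rw [h2]; simp [hti']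
        · by_cases h3 : z = .aux
          · simp [h3, hta']
          · by_cases h4 : z = .inp <;> simp [h1, h2, h3, h4, htn']
    · ring_nf
      omega

theorem forReg_runs {p : GProg} {g : List (Option Bool) → List (Option Bool)} {m T : ℕ}
    {i : Fin 10} {t : Stk} (f : Flags) (x y : Option (Option Bool)) (hti : t ≠ .reg i)
    (hta : t ≠ .aux) (htn : t ≠ .inp) (hg : ∀ l, (g l).length ≤ l.length)
    (hp : ∀ x S, (S .inp).length ≤ m → ∃ a, a.reverse ++ g (S .inp) = (S .aux).reverse ++ S .inp ∧
      Runs p ((f, x, y), S) ((f, none, y), setInp S (g (S .inp)) a) T)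
    (c : ℕ) (S : Stk → List (Option Bool)) (hm : (S .inp).length ≤ m)
    (hS : S (.reg i) = List.replicate c none) :
    ∃ a, a.reverse ++ g^[c] (S .inp) = (S .aux).reverse ++ S .inp ∧
      Runs (forReg i t p) ((f, x, y), S)
        ((f, none, y), update (update (setInp S (g^[c] (S .inp)) a) (.reg i) [])
          t (List.replicate c none ++ S t)) (2 + c * (T + 3)) := by
  obtain ⟨a, ha, h⟩ := forReg_loop_runs f y hti hta htn hg hp c
    (update S (.reg i) (S (.reg i)).tail) (by simpa using hm) (by simp [hS])
  refine ⟨a, by simpa using ha, ?_⟩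
  rw [← hS] at h
  refine runs_of_eq ((Runs.pop _ _ _ _).seq h) ?_ (by omega)
  congr 1
  funext z
  by_cases h1 : z = t
  · simp [h1, hti, hS]
  · by_cases h2 : z = .reg i
    · rw [h2]; simp [hti.symm]
    · by_cases h3 : z = .aux
      · simp [h3, hta.symm]
      · by_cases h4 : z = .inp <;> simp [h1, h2, h3, h4, htn.symm]

/-- The entry of the matrix encoded by a word. -/
def lookup (l : List (Option Bool)) (a b : ℕ) : Bool :=
  decide ((List.tail^[b] (rowRest^[a] l)).head? = some (some true))

/-- Look up the entry of the input matrix given by two registers. -/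
def adjTest (i j : Fin 10) : GProg :=
  .seq (forReg i .t1 skipRow) <| .seq (forReg j .t2 skipOne) <|
  .seq (popFst .inp) <|
  .seq (.load fun v => ({v.1 with test := decide (v.2.1 = some (some true))}, v.2)) <|
  .seq (.ite (fun v => v.2.1.isSome) (pushFst .inp) skip) <|
  .seq (drain .aux [.inp]) <| .seq (drain .t1 [.reg i]) (drain .t2 [.reg j])

/-- By the invariant of `forReg_runs`, draining `aux` onto `inp` restores the input wherever the
head stood; `t1` and `t2` give back the two registers in the same way. -/
theorem adjTest_runs (f : Flags) (i j : Fin 10) (hij : i ≠ j) (a b : ℕ)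
    (S : Stk → List (Option Bool)) (hi : S (.reg i) = List.replicate a none)
    (hj : S (.reg j) = List.replicate b none) (ht : S .t1 = []) (ht' : S .t2 = [])
    (hx : S .aux = []) :
    Runs (adjTest i j) ((f, none, none), S)
      (({f with test := lookup (S .inp) a b}, none, none), S)
      (20 + a * (15 + 3 * (S .inp).length) + b * 12 + 4 * (S .inp).length) := by
  obtain ⟨c, hc, h1⟩ := forReg_runs (i := i) (t := .t1) (p := skipRow) (m := (S .inp).length) f
    none none (by simp) (by simp) (by simp) length_rowRest_le (fun x S' hm =>
      ⟨_, by
        rw [List.reverse_append, List.reverse_reverse, List.append_assoc, rowPart_append_rowRest],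
        (skipRow_runs f none x S').mono (T' := 5 + 3 * (S .inp).length) (by omega)⟩) a S le_rfl hi
  have hj' : (Stk.reg j) ≠ .reg i := by simpa using hij.symm
  obtain ⟨d, hd, h2⟩ := forReg_runs (i := j) (t := .t2) (p := skipOne) (m := (S .inp).length)
    (g := List.tail) (T := 4) f none none (by simp) (by simp) (by simp) (by simp) (fun x S' hm =>
      ⟨_, by
        rw [List.reverse_append, List.append_assoc]
        cases S' .inp <;> simp,
        skipOne_runs f none x S'⟩) b
    (update (update (setInp S (rowRest^[a] (S .inp)) c) (.reg i) [])
      .t1 (List.replicate a none ++ S .t1))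
    (by
      have := congrArg List.length hc
      simp only [hx, List.length_append, List.length_reverse, List.length_nil] at this
      simp
      omega) (by simp [hj', hj])
  simp only [ne_eq, reduceCtorEq, not_false_eq_true, update_of_ne, update_self] at h2 hd
  rw [hc, hx, List.reverse_nil, List.nil_append] at hd
  set R := List.tail^[b] (rowRest^[a] (S .inp)) with hR
  have h3 : ∀ (f : Flags) (S' : Stk → List (Option Bool)), S' .inp = R.tail →
      Runs (.ite (fun v => v.2.1.isSome) (pushFst .inp) skip)
      ((f, R.head?, none), S') ((f, R.head?, none), update S' .inp R) 2 := by
    intro f S' hS'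
    cases h : R with
    | nil =>
      refine Runs.ite (by simp) (fun _ => runs_of_eq (Runs.load _ _ _) ?_ le_rfl)
      simp only [h, List.tail_nil] at hS'
      simp [← hS']
    | cons a l =>
      refine Runs.ite (fun _ => runs_of_eq (Runs.push _ _ _ _) ?_ le_rfl) (by simp)
      simp only [h, List.tail_cons] at hS'
      simp [hS']
  have h4 := Runs.pop .inp (fun (v : Memory) a => (v.1, a, v.2.2)) (f, none, none)
    (update (update (setInp (update (update (setInp S (rowRest^[a] (S .inp)) c) (.reg i) [])
      .t1 (List.replicate a none ++ S .t1)) R d) (.reg j) []) .t2 (List.replicate b none ++ S .t2))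
  simp only [ne_eq, reduceCtorEq, not_false_eq_true, update_of_ne, update_self] at h4
  have hdl : d.length ≤ (S .inp).length := by
    have := congrArg List.length hd
    simp only [List.length_append, List.length_reverse] at this
    omega
  refine runs_of_eq (h1.seq <| h2.seq <| h4.seq <| (Runs.load _ _ _).seq <|
    (h3 _ _ (by simp)).seq <| (drain_runs _ _ _ _ _ (by simp) (by simp) _).seq <|
    (drain_runs _ _ _ _ _ (by simp) (by simp) _).seq <|
    (drain_runs _ _ _ _ _ (by simp) (by simp) _)) ?_ ?_
  · congr 1
    funext z
    rcases z with _ | _ | _ | _ | r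
    · simp [hd]
    · simp [hx]
    · simp [ht]
    · simp [ht']
    · by_cases h1 : r = i
      · simp [h1, hi, ht, hij]
      · by_cases h2 : r = j
        · simp [h2, hj, ht', hij.symm]
        · simp [h1, h2]
  · simp [ht, ht']
    ring_nf
    omega

end GProg

end

/-! ### Register transformations computable in polynomial time -/

section

open Turing Function StackProg

/-- The data on which register programs act. -/
structure RegState : Type where
  /-- the flags -/
  fl : Flags
  /-- the registers; register `0` holds the number of vertices -/
  reg : Fin 10 → ℕ

namespace RegState

open GProg

/-- The store of the graph machine for the input `l` and the given registers. -/
def store (l : List (Option Bool)) (h : RegState) : Store Stk (Option Bool) Memory :=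
  ((h.fl, none, none), fun k => match k with
    | .inp => l
    | .reg r => List.replicate (h.reg r) none
    | _ => [])

/-- All registers are bounded by register `0`, and that by the length of the input. -/
def Good (l : List (Option Bool)) (h : RegState) : Prop :=
  h.reg 0 ≤ l.length ∧ ∀ r, h.reg r ≤ h.reg 0

/-- Transformations of registers, depending on the input word. -/
abbrev Transf : Type := List (Option Bool) → RegState → RegState

/-- Execute two transformations in order. -/
def andThen (f g : Transf) : Transf := fun l h => g l (f l h)

/-- Execute a transformation if a flag condition holds. -/
def when (b : Flags → Bool) (f : Transf) : Transf := fun l h => if b h.fl then f l h else h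

/-- Change the flags. -/
def setFlags (φ : Flags → Flags) : Transf := fun _ h => ⟨φ h.fl, h.reg⟩

/-- Copy register `j` to register `i`. -/
def copyReg (i j : Fin 10) : Transf := fun _ h => ⟨h.fl, update h.reg i (h.reg j)⟩

/-- Test whether two registers are equal. -/
def eqReg (i j : Fin 10) : Transf :=
  fun _ h => ⟨{h.fl with test := decide (h.reg i = h.reg j)}, h.reg⟩

/-- Test whether the vertices in two registers are adjacent. -/
def adjReg (i j : Fin 10) : Transf :=
  fun l h => ⟨{h.fl with test := lookup l (h.reg i) (h.reg j)}, h.reg⟩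

/-- Increase register `i`. -/
def incReg (i : Fin 10) : Transf := fun _ h => ⟨h.fl, update h.reg i (h.reg i + 1)⟩

/-- Let register `i` run through all vertices. -/
def forAll (i : Fin 10) (f : Transf) : Transf := fun l h =>
  (fun h => eqReg i 0 l (incReg i l (f l h)))^[h.reg 0]
    (eqReg i 0 l ⟨h.fl, update h.reg i 0⟩)

/-- The transformation is computed by a program in polynomial time. -/
structure Impl (f : Transf) : Prop where
  good : ∀ l h, Good l h → Good l (f l h)
  reg_zero : ∀ l h, Good l h → (f l h).reg 0 = h.reg 0
  exists_prog : ∃ (p : GProg) (B : Polynomial ℕ), ∀ l h, Good l h →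
    Runs p (h.store l) ((f l h).store l) (B.eval l.length)

theorem Impl.andThen {f g : Transf} (hf : Impl f) (hg : Impl g) : Impl (andThen f g) where
  good l h hh := hg.good _ _ (hf.good _ _ hh)
  reg_zero l h hh := (hg.reg_zero _ _ (hf.good _ _ hh)).trans (hf.reg_zero _ _ hh)
  exists_prog := by
    obtain ⟨p, B, hp⟩ := hf.exists_prog
    obtain ⟨q, C, hq⟩ := hg.exists_prog
    refine ⟨.seq p q, B + C, fun l h hh => ?_⟩
    rw [Polynomial.eval_add]
    exact (hp l h hh).seq (hq l _ (hf.good l h hh))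

theorem Impl.when {f : Transf} (hf : Impl f) (b : Flags → Bool) : Impl (when b f) where
  good l h hh := by
    unfold RegState.when
    split_ifs
    exacts [hf.good _ _ hh, hh]
  reg_zero l h hh := by
    unfold RegState.when
    split_ifs
    exacts [hf.reg_zero _ _ hh, rfl]
  exists_prog := by
    obtain ⟨p, B, hp⟩ := hf.exists_prog
    refine ⟨.ite (fun v => b v.1) p skip, B + 2, fun l h hh => ?_⟩
    simp only [Polynomial.eval_add, Polynomial.eval_ofNat]
    refine (Runs.ite (T := B.eval l.length + 1) (fun hb => ?_) (fun hb => ?_)).mono (by omega)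
    · have hb' : b h.fl = true := hb
      unfold RegState.when
      rw [if_pos hb']
      exact (hp l h hh).mono (by omega)
    · have hb' : b h.fl = false := hb
      unfold RegState.when
      rw [hb', if_neg (by simp)]
      exact (Runs.load _ _ _).mono (by omega)

theorem impl_setFlags (φ : Flags → Flags) : Impl (setFlags φ) where
  good _ _ hh := hh
  reg_zero _ _ _ := rfl
  exists_prog := ⟨.load fun v => (φ v.1, v.2), 1, fun l h _ =>
    runs_of_eq (Runs.load _ _ _) rfl (by simp)⟩

theorem impl_eqReg {i j : Fin 10} (hij : i ≠ j) : Impl (eqReg i j) where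
  good _ _ hh := hh
  reg_zero _ _ _ := rfl
  exists_prog := ⟨eqTest i j, 20 + Polynomial.X * 9, fun l h hh => by
    have h1 := (hh.2 i).trans hh.1
    refine runs_of_eq (eqTest_runs h.fl i j hij (h.reg i) (h.reg j) _ rfl rfl rfl) rfl ?_
    simp only [Polynomial.eval_add, Polynomial.eval_mul, Polynomial.eval_ofNat, Polynomial.eval_X]
    omega⟩

theorem impl_adjReg {i j : Fin 10} (hij : i ≠ j) : Impl (adjReg i j) where
  good _ _ hh := hh
  reg_zero _ _ _ := rfl
  exists_prog := ⟨adjTest i j, 20 + Polynomial.X * (15 + 3 * Polynomial.X) + Polynomial.X * 12 +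
      4 * Polynomial.X, fun l h hh => by
    have h1 := (hh.2 i).trans hh.1
    have h2 := (hh.2 j).trans hh.1
    refine runs_of_eq (adjTest_runs h.fl i j hij (h.reg i) (h.reg j) _ rfl rfl rfl rfl rfl) rfl ?_
    simp only [Polynomial.eval_add, Polynomial.eval_mul, Polynomial.eval_ofNat, Polynomial.eval_X]
    gcongr⟩

theorem drain_reg_runs (l : List (Option Bool)) (h : RegState) (i : Fin 10) :
    Runs (drain (.reg i) []) (h.store l)
      (RegState.store l ⟨h.fl, update h.reg i 0⟩) (2 + h.reg i * 3) := by
  refine runs_of_eq (drain_runs _ _ _ _ _ (by simp) (by simp) _) ?_ (by simp)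
  unfold store
  congr 1
  funext z
  rcases z with _ | _ | _ | _ | r
  · simp
  · simp
  · simp
  · simp
  · by_cases hr : r = i
    · subst hr; simp
    · simp [hr]

theorem impl_copyReg {i j : Fin 10} (hij : i ≠ j) (hi : i ≠ 0) : Impl (copyReg i j) where
  good l h hh := by
    refine ⟨by simpa [copyReg, hi.symm] using hh.1, fun r => ?_⟩
    by_cases hr : r = i
    · subst hr
      simpa [copyReg, hi.symm] using hh.2 j
    · simpa [copyReg, hi.symm, hr] using hh.2 r
  reg_zero l h hh := by simp [copyReg, hi.symm]
  exists_prog := ⟨.seq (drain (.reg i) []) (.seq (drain (.reg j) [.t1]) (drain .t1 [.reg i, .reg j])),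
    6 + Polynomial.X * 12, fun l h hh => by
    have h1 := (hh.2 i).trans hh.1
    have h2 := (hh.2 j).trans hh.1
    refine runs_of_eq ((drain_reg_runs l h i).seq <|
      (drain_runs _ _ _ _ _ (by simp) (by simp) _).seq
      (drain_runs _ _ _ _ _ (by simp [hij]) (by simp) _)) ?_ ?_
    · unfold store copyReg
      congr 1
      funext z
      rcases z with _ | _ | _ | _ | r
      · simp
      · simp
      · simp
      · simp
      · by_cases hr : r = i
        · subst hr
          simp [hij, hij.symm]
        · by_cases hr' : r = j
          · subst hr'
            simp [hr]
          · simp [hr, hr']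
    · simp [hij.symm]
      omega⟩

/-- The flag `test` is the loop guard, recomputed after each increment, and therefore has to be
correct at the start. Register `i` plus the number `r` of remaining rounds equals register `0`, so
the increments do not violate `Good`. -/
theorem forAll_loop {f : Transf} (hf : Impl f) {i : Fin 10} (hi : i ≠ 0)
    (hk : ∀ l h, (f l h).reg i = h.reg i) {p : GProg} {B : Polynomial ℕ}
    (hp : ∀ l h, Good l h → Runs p (h.store l) ((f l h).store l) (B.eval l.length))
    (l : List (Option Bool)) :
    ∀ (r : ℕ) (h : RegState), Good l h → h.fl.test = decide (h.reg i = h.reg 0) →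
      h.reg i + r = h.reg 0 →
      Good l ((fun h => eqReg i 0 l (incReg i l (f l h)))^[r] h) ∧
      ((fun h => eqReg i 0 l (incReg i l (f l h)))^[r] h).reg 0 = h.reg 0 ∧
      Runs (.loop (fun v => !v.1.test)
        (.seq p (.seq (.push (.reg i) fun _ => none) (eqTest i 0)))) (h.store l)
        (((fun h => eqReg i 0 l (incReg i l (f l h)))^[r] h).store l)
        (1 + r * (B.eval l.length + (22 + l.length * 9))) := by
  intro r
  induction r with
  | zero =>
    intro h hh ht hr
    refine ⟨hh, rfl, runs_of_eq (Runs.loop_false ?_) rfl (by simp)⟩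
    change (!h.fl.test) = false
    simp [ht, ← hr]
  | succ r ih =>
    intro h hh ht hr
    have hg := hf.good l h hh
    have h0 := hf.reg_zero l h hh
    set h1 := incReg i l (f l h) with hh1
    have e0 : h1.reg 0 = h.reg 0 := by simp [hh1, incReg, hi.symm, h0]
    have ei : h1.reg i = h.reg i + 1 := by simp [hh1, incReg, hk]
    have hg1 : Good l h1 := by
      refine ⟨e0 ▸ hh.1, fun s => ?_⟩
      rw [e0]
      by_cases hs : s = i
      · subst hs
        omega
      · simpa [hh1, incReg, hs, h0] using hg.2 s
    have hg2 : Good l (eqReg i 0 l h1) := (impl_eqReg hi).good _ _ hg1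
    obtain ⟨g1, g2, g3⟩ := ih (eqReg i 0 l h1) hg2 rfl (by
      change h1.reg i + r = h1.reg 0
      omega)
    rw [iterate_succ_apply]
    refine ⟨g1, g2.trans e0, ?_⟩
    have e1 : Runs (.push (.reg i) fun _ => none) ((f l h).store l) (h1.store l) 1 := by
      refine runs_of_eq (Runs.push _ _ _ _) ?_ le_rfl
      rw [hh1]
      unfold store incReg
      congr 1
      funext z
      rcases z with _ | _ | _ | _ | s
      · simp
      · simp
      · simp
      · simp
      · by_cases hs : s = i
        · subst hs
          simp [List.replicate_succ]
        · simp [hs]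
    have e2 : Runs (eqTest i 0) (h1.store l) ((eqReg i 0 l h1).store l) (20 + l.length * 9) := by
      have := (hg1.2 i).trans hg1.1
      refine runs_of_eq (eqTest_runs h1.fl i 0 hi (h1.reg i) (h1.reg 0) _ rfl rfl rfl) rfl ?_
      omega
    refine runs_of_eq (Runs.loop_true ?_ ((hp l h hh).seq (e1.seq e2)) g3) rfl ?_
    · change (!h.fl.test) = true
      have : h.reg i ≠ h.reg 0 := by omega
      simp [ht, this]
    · ring_nf
      omega

theorem Impl.forAll {f : Transf} (hf : Impl f) {i : Fin 10} (hi : i ≠ 0)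
    (hk : ∀ l h, (f l h).reg i = h.reg i) : Impl (forAll i f) := by
  obtain ⟨p, B, hp⟩ := hf.exists_prog
  have hg : ∀ l h, Good l h → Good l ⟨h.fl, update h.reg i 0⟩ := by
    intro l h hh
    refine ⟨by simpa [hi.symm] using hh.1, fun s => ?_⟩
    by_cases hs : s = i
    · subst hs
      simp
    · simpa [hi.symm, hs] using hh.2 s
  have key := fun l h (hh : Good l h) => forAll_loop hf hi hk hp l (h.reg 0)
    (eqReg i 0 l ⟨h.fl, update h.reg i 0⟩) ((impl_eqReg hi).good _ _ (hg l h hh)) rfl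
    (by simp [eqReg, hi.symm])
  refine ⟨fun l h hh => (key l h hh).1, fun l h hh => (key l h hh).2.1.trans ?_,
    .seq (drain (.reg i) []) (.seq (eqTest i 0) (.loop (fun v => !v.1.test)
        (.seq p (.seq (.push (.reg i) fun _ => none) (eqTest i 0))))),
    23 + 12 * Polynomial.X + Polynomial.X * (B + (22 + Polynomial.X * 9)), fun l h hh => ?_⟩
  · simp [eqReg, hi.symm]
  · have h1 := (hh.2 i).trans hh.1
    have h2 := hh.1
    have e2 : Runs (eqTest i 0) (RegState.store l ⟨h.fl, update h.reg i 0⟩)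
        ((eqReg i 0 l ⟨h.fl, update h.reg i 0⟩).store l) 20 :=
      runs_of_eq (eqTest_runs h.fl i 0 hi 0 (h.reg 0) _ (by simp) (by simp [hi.symm]) rfl)
        (by simp [store, eqReg, hi.symm]) le_rfl
    refine runs_of_eq ((drain_reg_runs l h i).seq (e2.seq (key l h hh).2.2)) rfl ?_
    simp only [Polynomial.eval_add, Polynomial.eval_mul, Polynomial.eval_ofNat, Polynomial.eval_X]
    have : h.reg 0 * (B.eval l.length + (22 + l.length * 9)) ≤
      l.length * (B.eval l.length + (22 + l.length * 9)) := by gcongr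
    omega

/-- Clear several registers. -/
def clearRegs : List (Fin 10) → GProg
  | [] => skip
  | i :: is => .seq (drain (.reg i) []) (clearRegs is)

theorem clearRegs_runs (l : List (Option Bool)) : ∀ (is : List (Fin 10)) (h : RegState), Good l h →
    ∃ h' : RegState, h'.fl = h.fl ∧ (∀ r ∈ is, h'.reg r = 0) ∧ (∀ r, h.reg r = 0 → h'.reg r = 0) ∧
      Runs (clearRegs is) (h.store l) (h'.store l) (is.length * (2 + l.length * 3) + 1) := by
  -- Clearing register `0` may destroy `Good`, which bounds the others by it; the induction uses the
  -- bound by the input length instead.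
  suffices H : ∀ (is : List (Fin 10)) (h : RegState), (∀ r, h.reg r ≤ l.length) →
      ∃ h' : RegState, h'.fl = h.fl ∧ (∀ r ∈ is, h'.reg r = 0) ∧
        (∀ r, h.reg r = 0 → h'.reg r = 0) ∧
        Runs (clearRegs is) (h.store l) (h'.store l) (is.length * (2 + l.length * 3) + 1) from
    fun is h hh => H is h fun r => (hh.2 r).trans hh.1
  intro is
  induction is with
  | nil => exact fun h _ => ⟨h, rfl, by simp, fun _ => id, (Runs.load _ _ _).mono (by simp)⟩
  | cons i is ih =>
    intro h hh
    obtain ⟨h', h1, h2, h3, h4⟩ := ih ⟨h.fl, update h.reg i 0⟩ fun r => by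
      by_cases hr : r = i
      · subst hr; simp
      · simpa [hr] using hh r
    refine ⟨h', h1, ?_, ?_, runs_of_eq ((drain_reg_runs l h i).seq h4) rfl ?_⟩
    · intro r hr
      rcases List.mem_cons.1 hr with rfl | hr
      · exact h3 _ (by simp)
      · exact h2 _ hr
    · intro r hr
      refine h3 r ?_
      by_cases hr : r = i
      · subst hr; simp
      · simpa [hr]
    · have := hh i
      simp only [List.length_cons]
      ring_nf
      omega

/-- Empty all stacks. -/
def clearAll : GProg := .seq (clearRegs (List.finRange 10)) (drain .inp [])

theorem clearAll_runs (l : List (Option Bool)) (h : RegState) (hh : Good l h) :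
    Runs clearAll (h.store l) ((h.fl, none, none), fun _ => []) (30 + l.length * 33) := by
  obtain ⟨h', h1, h2, -, h4⟩ := clearRegs_runs l (List.finRange 10) h hh
  refine runs_of_eq (h4.seq (drain_runs _ _ _ _ _ (by simp) (by simp) _)) ?_ ?_
  · rw [h1]
    congr 1
    funext z
    rcases z with _ | _ | _ | _ | s
    · simp
    · simp
    · simp
    · simp
    · simp [h2 s (List.mem_finRange s)]
  · simp
    omega

/-- Write the length of the first row, which is on the stack `aux`, to register `0`. -/
def countRow : GProg :=
  .seq skipRow <| .seq (popFst .aux) <|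
  .seq (.ite (fun v => v.2.1.isSome) (pushFst .inp) skip) <| .seq (popFst .aux) <|
  .loop (fun v => v.2.1.isSome) (.seq (pushFst .inp)
    (.seq (.push (.reg 0) fun _ => none) (popFst .aux)))

theorem countRow_loop_runs (f : Flags) (y : Option (Option Bool)) :
    ∀ (a : List (Option Bool)) (S : Stk → List (Option Bool)), S .aux = a.tail →
      Runs (.loop (fun v => v.2.1.isSome) (.seq (pushFst .inp)
        (.seq (.push (.reg 0) fun _ => none) (popFst .aux))))
        ((f, a.head?, y), S)
        ((f, none, y), update (update (update S .aux []) .inp (a.reverse ++ S .inp)) (.reg 0)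
          (List.replicate a.length none ++ S (.reg 0))) (1 + a.length * 4) := by
  intro a
  induction a with
  | nil =>
    intro S hS
    refine runs_of_eq (Runs.loop_false (by simp)) ?_ (by simp)
    simp only [List.tail_nil] at hS
    have h1 : update S .aux [] = S := by rw [← hS, update_eq_self]
    simp [h1]
  | cons c a ih =>
    intro S hS
    simp only [List.tail_cons] at hS
    have h1 := (Runs.push .inp (fun (v : Memory) => v.2.1.getD none) (f, some c, y) S).seq <|
      (Runs.push (.reg 0) (fun _ => none) _ _).seq
      (Runs.pop .aux (fun (v : Memory) a => (v.1, a, v.2.2)) _ _)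
    simp only [ne_eq, reduceCtorEq, not_false_eq_true, update_of_ne, hS] at h1
    refine runs_of_eq (Runs.loop_true (by simp) h1 (ih _ (by simp))) ?_ ?_
    · congr 1
      funext z
      rcases z with _ | _ | _ | _ | s
      · simp
      · simp
      · simp
      · simp
      · by_cases hs : s = 0
        · subst hs
          simp [List.replicate_succ']
        · simp [hs]
    · simp only [List.length_cons]
      omega

theorem countRow_tail_runs (f : Flags) (x y : Option (Option Bool)) (S : Stk → List (Option Bool)) :
    Runs (.seq (popFst .aux) (.loop (fun v => v.2.1.isSome) (.seq (pushFst .inp)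
      (.seq (.push (.reg 0) fun _ => none) (popFst .aux))))) ((f, x, y), S)
      ((f, none, y), update (update (update S .aux []) .inp ((S .aux).reverse ++ S .inp)) (.reg 0)
        (List.replicate (S .aux).length none ++ S (.reg 0))) (2 + (S .aux).length * 4) := by
  refine runs_of_eq ((Runs.pop _ _ _ _).seq
    (countRow_loop_runs f y (S .aux) (update S .aux (S .aux).tail) (by simp))) ?_ (by omega)
  simp

/-- The initial state of the registers for a graph with `n` vertices. -/
def start (n : ℕ) : RegState := ⟨⟨false, false, false, false, 0, 0⟩, update (fun _ => 0) 0 n⟩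

theorem rowPart_map_some (r : List Bool) (l : List (Option Bool)) :
    rowPart (r.map some ++ none :: l) = r.map some ++ [none] := by
  induction r with
  | nil => rfl
  | cons b r ih => simpa [rowPart] using ih

theorem rowRest_map_some (r : List Bool) (l : List (Option Bool)) :
    rowRest (r.map some ++ none :: l) = l := by
  induction r with
  | nil => rfl
  | cons b r ih => simpa [rowRest] using ih

/-- `skipRow` leaves the first row reversed on `aux` with its terminator on top. The terminator is
moved back before the count, so register `0` receives the number of entries of the row, that is, of
vertices. -/
theorem countRow_runs (r : List Bool) (l : List (Option Bool)) :
    Runs countRow (((start 0).fl, none, none), update (fun _ => []) .inp (r.map some ++ none :: l))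
      ((start r.length).store (r.map some ++ none :: l))
      (15 + 7 * (r.map some ++ none :: l).length) := by
  have h1 := skipRow_runs (start 0).fl none none
    (update (fun _ => []) .inp (r.map some ++ none :: l))
  rw [update_self, rowPart_map_some, rowRest_map_some] at h1
  have h2 := Runs.pop .aux (fun (v : Memory) a => (v.1, a, v.2.2)) ((start 0).fl, none, none)
    (setInp (update (fun _ => []) .inp (r.map some ++ none :: l)) l
      ((r.map some ++ [none]).reverse ++ []))
  simp only [update_self, List.append_nil, List.reverse_append, List.reverse_cons,
    List.reverse_nil, List.nil_append, List.cons_append, List.head?_cons, List.tail_cons] at h2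
  have h3 : ∀ S : Stk → List (Option Bool), Runs (.ite (fun v => v.2.1.isSome) (pushFst .inp) skip)
      (((start 0).fl, some none, none), S)
      (((start 0).fl, some none, none), update S .inp (none :: S .inp)) 2 := fun S =>
    Runs.ite (fun _ => Runs.push _ _ _ _) (by simp)
  simp only [List.append_nil, List.reverse_append, List.reverse_cons, ne_eq, reduceCtorEq,
    not_false_eq_true, update_of_ne, List.reverse_nil, List.nil_append, List.cons_append] at h1
  refine runs_of_eq (h1.seq <| h2.seq <| (h3 _).seq <| countRow_tail_runs _ _ _ _) ?_ ?_
  · unfold store start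
    congr 1
    funext z
    rcases z with _ | _ | _ | _ | s
    · simp
    · simp
    · simp
    · simp
    · by_cases hs : s = 0
      · subst hs
        simp
      · simp [hs]
  · simp
    omega

/-- The graph without vertices is encoded by the empty word, which has no row and no terminator. -/
theorem countRow_nil_runs :
    Runs countRow (((start 0).fl, none, none), update (fun _ => []) .inp [])
      ((start 0).store []) 20 := by
  have h1 := skipRow_runs (start 0).fl none none (update (fun _ => []) .inp [])
  have h3 : ∀ S : Stk → List (Option Bool), Runs (.ite (fun v => v.2.1.isSome) (pushFst .inp) skip)
      (((start 0).fl, none, none), S) (((start 0).fl, none, none), S) 2 := fun S =>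
    Runs.ite (by simp) (fun _ => Runs.load _ _ _)
  have h2 := Runs.pop Stk.aux (fun (v : Memory) (a : Option (Option Bool)) => (v.1, a, v.2.2))
    ((start 0).fl, none, none) (fun _ => [])
  have e : update (fun _ => []) .inp [] = (fun _ => [] : Stk → List (Option Bool)) := by
    funext z
    rcases z with _ | _ | _ | _ | s <;> simp
  have e' : update (fun _ => []) .aux [] = (fun _ => [] : Stk → List (Option Bool)) := by
    funext z
    rcases z with _ | _ | _ | _ | s <;> simp
  simp only [update_self, rowRest, rowPart, setInp, e, e', List.reverse_nil, List.append_nil] at h1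
  simp only [List.head?_nil, List.tail_nil, e'] at h2
  rw [e]
  refine runs_of_eq (h1.seq <| h2.seq <| (h3 _).seq <| countRow_tail_runs _ _ _ _) ?_ ?_
  · unfold store start
    congr 1
    funext z
    rcases z with _ | _ | _ | _ | s
    · simp
    · simp
    · simp
    · simp
    · by_cases hs : s = 0
      · subst hs
        simp
      · simp [hs]
  · simp

/-- The first row of the adjacency matrix. -/
theorem encodeGraph_succ {n : ℕ} (G : SimpleGraph (Fin (n + 1))) :
    ∃ (r : List Bool) (l : List (Option Bool)), r.length = n + 1 ∧
      encodeGraph ⟨n + 1, G⟩ = r.map some ++ none :: l := by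
  classical
  refine ⟨(List.finRange (n + 1)).map fun j => decide (G.Adj 0 j), ?_, by simp, ?_⟩
  rotate_left
  rw [encodeGraph, List.finRange_succ, List.flatMap_cons, List.append_assoc, List.map_map]
  rfl

theorem length_encodeGraph (G : LabelledGraph) : (encodeGraph G).length = G.1 * (G.1 + 1) := by
  simp [encodeGraph, List.length_flatMap]

/-- The machine counts the vertices, runs the program of `f`, empties its stacks and outputs the
negation of `bad`. With input length `ℓ`, counting costs at most `20 + 7ℓ`, clearing `30 + 33ℓ` and
the output one step; `70 + 50ℓ` covers all of these. -/
theorem polynomiallySolvable_of_impl {P : LabelledGraph → Prop} {f : Transf} (hf : Impl f)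
    (answer : {G : LabelledGraph // P G} → Bool)
    (h : ∀ G, (f (encodeGraph G.1) (start G.1.1)).fl.bad = !answer G) :
    Nonempty (TM2ComputableInPolyTime (fun G : {G : LabelledGraph // P G} => encodeGraph G.1)
      Computability.encodeBool answer) := by
  obtain ⟨p, B, hp⟩ := hf.exists_prog
  have key : ∀ G : {G : LabelledGraph // P G}, Nonempty (TM2OutputsInTime
      ((countRow.seq (.seq p clearAll)).machine .inp ((start 0).fl, none, none)
        (fun v => !v.1.bad)) (encodeGraph G.1) (some [answer G])
      ((B + (70 + Polynomial.X * 50)).eval (encodeGraph G.1).length)) := by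
    intro G
    have hg : Good (encodeGraph G.1) (start G.1.1) := by
      constructor
      · rw [length_encodeGraph]
        simp only [start, update_self]
        nlinarith
      · intro r
        by_cases hr : r = 0
        · subst hr; rfl
        · simp [start, hr]
    have h1 : Runs countRow (((start 0).fl, none, none), update (fun _ => []) .inp (encodeGraph G.1))
        ((start G.1.1).store (encodeGraph G.1)) (20 + 7 * (encodeGraph G.1).length) := by
      obtain ⟨⟨n, G⟩, hG⟩ := G
      cases n with
      | zero => exact countRow_nil_runs.mono (by omega)
      | succ n =>
        obtain ⟨r, l, hr, he⟩ := encodeGraph_succ G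
        have := countRow_runs r l
        rw [← he, hr] at this
        exact this.mono (by dsimp only; omega)
    obtain ⟨t, ht, hE⟩ := h1.seq ((hp _ _ hg).seq (clearAll_runs _ _ (hf.good _ _ hg)))
    have := machine_outputs _ Stk.inp ((start 0).fl, none, none) (fun v : Memory => !v.1.bad)
      (encodeGraph G.1) (T := (B + (70 + Polynomial.X * 50)).eval (encodeGraph G.1).length) hE (by
        simp only [Polynomial.eval_add, Polynomial.eval_mul, Polynomial.eval_ofNat,
          Polynomial.eval_X]
        omega)
    rw [h G, Bool.not_not] at this
    exact this
  exact ⟨{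
    tm := (countRow.seq (.seq p clearAll)).machine .inp ((start 0).fl, none, none)
      (fun v => !v.1.bad)
    inputAlphabet := Equiv.refl _
    outputAlphabet := Equiv.refl _
    time := B + (70 + Polynomial.X * 50)
    outputsFun := fun G => by
      have := (key G).some
      have e1 : List.map (Equiv.refl (Option Bool)).invFun (encodeGraph G.1) = encodeGraph G.1 :=
        List.map_id _
      exact e1.symm ▸ this }⟩

end RegState

end

/-! ### Walks through vertices of degree two, and the necessary condition modulo three -/

section

open Function

namespace SimpleGraph

variable {V : Type} (G : SimpleGraph V)

/-- The number of neighbours of a vertex. -/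
noncomputable def ndeg (v : V) : ℕ := (G.neighborSet v).ncard

/-- The directed edge `e` continues the directed edge `d` through a vertex of degree two. -/
def DStep (d e : V × V) : Prop :=
  e.1 = d.2 ∧ G.Adj d.1 d.2 ∧ G.Adj e.1 e.2 ∧ e.2 ≠ d.1 ∧ G.ndeg d.2 = 2

/-- The directed edge `e` is reached from `d` in `k` steps through vertices of degree two. -/
def DWalk : ℕ → V × V → V × V → Prop
  | 0, d, e => d = e
  | k + 1, d, e => ∃ d', G.DStep d d' ∧ DWalk k d' e

/-- A proper colouring with three colours such that the neighbours of a vertex of degree two have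
different colours. -/
def IsDyn (c : V → ZMod 3) : Prop :=
  (∀ u v, G.Adj u v → c u ≠ c v) ∧
    ∀ v u w, G.ndeg v = 2 → G.Adj v u → G.Adj v w → u ≠ w → c u ≠ c w

/-- The two vertices are equal or the two ends of a diamond. -/
def Same (u w : V) : Prop :=
  u = w ∨ ∃ a b, G.Adj a b ∧ G.Adj u a ∧ G.Adj u b ∧ G.Adj w a ∧ G.Adj w b

/-- Every walk through vertices of degree two that connects the ends of a diamond, or is closed,
has length divisible by three. -/
def NoBad : Prop :=
  ∀ u x y w k, G.Adj u x → G.DWalk k (u, x) (y, w) → G.Same u w → 3 ∣ k + 1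

variable {G}

theorem eq_or_eq_of_ndeg_two {v a b c : V} (hv : G.ndeg v = 2) (ha : G.Adj v a) (hb : G.Adj v b)
    (hc : G.Adj v c) (hab : a ≠ b) : c = a ∨ c = b := by
  obtain ⟨x, y, hxy, h⟩ := Set.ncard_eq_two.1 hv
  have key : ∀ z, G.Adj v z → z = x ∨ z = y := fun z hz => by
    have : z ∈ G.neighborSet v := hz
    rwa [h] at this
  rcases key a ha with rfl | rfl <;> rcases key b hb with rfl | rfl <;>
    rcases key c hc with rfl | rfl <;> simp_all

theorem exists_other_of_ndeg_two {v : V} (hv : G.ndeg v = 2) (a : V) :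
    ∃ b, G.Adj v b ∧ b ≠ a := by
  obtain ⟨x, y, hxy, h⟩ := Set.ncard_eq_two.1 hv
  have hx : G.Adj v x := by
    have : x ∈ G.neighborSet v := by simp [h]
    exact this
  have hy : G.Adj v y := by
    have : y ∈ G.neighborSet v := by simp [h]
    exact this
  by_cases hxa : x = a
  · exact ⟨y, hy, hxa ▸ hxy.symm⟩
  · exact ⟨x, hx, hxa⟩

theorem DStep.swap {d e : V × V} (h : G.DStep d e) : G.DStep e.swap d.swap := by
  obtain ⟨h1, h2, h3, h4, h5⟩ := h
  exact ⟨h1.symm, h3.symm, h2.symm, h4.symm, by simpa [h1] using h5⟩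

theorem DStep.adj_left {d e : V × V} (h : G.DStep d e) : G.Adj d.1 d.2 := h.2.1

theorem DStep.adj_right {d e : V × V} (h : G.DStep d e) : G.Adj e.1 e.2 := h.2.2.1

theorem DStep.ndeg_eq {d e : V × V} (h : G.DStep d e) : G.ndeg d.2 = 2 := h.2.2.2.2

/-- At a vertex of degree two there is only one neighbour besides the one just left. Together with
`DStep.swap`, walks are deterministic in both directions, on which all uniqueness arguments below
rest. -/
theorem DStep.unique {d e e' : V × V} (h : G.DStep d e) (h' : G.DStep d e') : e = e' := by
  obtain ⟨h1, h2, h3, h4, h5⟩ := h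
  obtain ⟨h1', h2', h3', h4', h5'⟩ := h'
  refine Prod.ext (h1.trans h1'.symm) ?_
  rw [h1] at h3
  rw [h1'] at h3'
  rcases eq_or_eq_of_ndeg_two h5 h3 h2.symm h3' h4 with h | h
  · exact h.symm
  · exact absurd h h4'

theorem DStep.unique_left {d d' e : V × V} (h : G.DStep d e) (h' : G.DStep d' e) : d = d' :=
  Prod.swap_injective (h.swap.unique h'.swap)

theorem DWalk.trans {k l : ℕ} {d e f : V × V} (h : G.DWalk k d e) (h' : G.DWalk l e f) :
    G.DWalk (k + l) d f := by
  induction k generalizing d with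
  | zero =>
    cases h
    simpa using h'
  | succ k ih =>
    obtain ⟨d', h1, h2⟩ := h
    rw [Nat.succ_add]
    exact ⟨d', h1, ih h2⟩

theorem DStep.dWalk {d e : V × V} (h : G.DStep d e) : G.DWalk 1 d e := ⟨e, h, rfl⟩

theorem DWalk.snoc {k : ℕ} {d e f : V × V} (h : G.DWalk k d e) (h' : G.DStep e f) :
    G.DWalk (k + 1) d f := h.trans h'.dWalk

theorem DWalk.swap {k : ℕ} {d e : V × V} (h : G.DWalk k d e) : G.DWalk k e.swap d.swap := by
  induction k generalizing d with
  | zero =>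
    cases h
    rfl
  | succ k ih =>
    obtain ⟨d', h1, h2⟩ := h
    exact (ih h2).snoc h1.swap

theorem DWalk.exists_snoc {k : ℕ} {d e : V × V} (h : G.DWalk (k + 1) d e) :
    ∃ e', G.DWalk k d e' ∧ G.DStep e' e := by
  obtain ⟨e', h1, h2⟩ := h.swap
  exact ⟨e'.swap, h2.swap, h1.swap⟩

theorem DWalk.unique {k : ℕ} {d e e' : V × V} (h : G.DWalk k d e) (h' : G.DWalk k d e') :
    e = e' := by
  induction k generalizing d with
  | zero => exact h.symm.trans h'
  | succ k ih =>
    obtain ⟨d', h1, h2⟩ := h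
    obtain ⟨d'', h1', h2'⟩ := h'
    cases h1.unique h1'
    exact ih h2 h2'

theorem DWalk.adj {k : ℕ} {d e : V × V} (h : G.DWalk k d e) (hd : G.Adj d.1 d.2) :
    G.Adj e.1 e.2 := by
  cases k with
  | zero =>
    cases h
    exact hd
  | succ k =>
    obtain ⟨_, _, h⟩ := h.exists_snoc
    exact h.adj_right

/-- The end of a maximal walk and its length are determined by its start. -/
theorem DWalk.unique_end {k l : ℕ} {d e f : V × V} (h : G.DWalk k d e) (he : G.ndeg e.2 ≠ 2)
    (h' : G.DWalk l d f) (hf : G.ndeg f.2 ≠ 2) : k = l ∧ e = f := by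
  induction k generalizing d l with
  | zero =>
    cases h
    cases l with
    | zero =>
      cases h'
      exact ⟨rfl, rfl⟩
    | succ l =>
      obtain ⟨d', h1, h2⟩ := h'
      exact absurd h1.ndeg_eq he
  | succ k ih =>
    obtain ⟨d', h1, h2⟩ := h
    cases l with
    | zero =>
      cases h'
      exact absurd h1.ndeg_eq hf
    | succ l =>
      obtain ⟨d'', h1', h2'⟩ := h'
      cases h1.unique h1'
      obtain ⟨h3, h4⟩ := ih h2 h2'
      exact ⟨by rw [h3], h4⟩

/-- Read backwards, the last step also leaves `d`, so by determinism it is the reversed first step.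
Removing both leaves a shorter walk from a directed edge to its reverse. In the base cases, `d`
would be a loop or a single step would turn back. -/
theorem not_dWalk_swap {k : ℕ} {d : V × V} (hd : G.Adj d.1 d.2) : ¬ G.DWalk k d d.swap := by
  induction k using Nat.strong_induction_on generalizing d with
  | _ k ih =>
    intro h
    match k, h with
    | 0, h =>
      have := congrArg Prod.fst h
      exact hd.ne this
    | 1, h =>
      obtain ⟨e, h1, h2⟩ := h
      cases h2
      exact h1.2.2.2.1 rfl
    | k + 2, h =>
      obtain ⟨e, h1, h2⟩ := h
      obtain ⟨e', h3, h4⟩ := h2.exists_snoc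
      have h5 := h4.swap
      rw [Prod.swap_swap] at h5
      have h6 : e'.swap = e := h5.unique h1
      have h7 : e' = e.swap := by rw [← h6, Prod.swap_swap]
      rw [h7] at h3
      exact ih k (by omega) h1.adj_right h3

theorem zmod_three_step : ∀ a b c : ZMod 3, a ≠ b → b ≠ c → a ≠ c → c - b = b - a := by decide

/-- A vertex of degree two and its neighbours carry all three colours, and the three elements of
`ZMod 3` form an arithmetic progression in any order. -/
theorem IsDyn.sub_eq_of_dStep {c : V → ZMod 3} (hc : G.IsDyn c) {d e : V × V} (h : G.DStep d e) :
    c e.2 - c e.1 = c d.2 - c d.1 := by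
  obtain ⟨h1, h2, h3, h4, h5⟩ := h
  rw [h1] at h3 ⊢
  exact zmod_three_step _ _ _ (hc.1 _ _ h2) (hc.1 _ _ h3) (hc.2 _ _ _ h5 h2.symm h3 h4.symm)

theorem IsDyn.apply_of_dWalk {c : V → ZMod 3} (hc : G.IsDyn c) {k : ℕ} {d e : V × V}
    (h : G.DWalk k d e) : c e.2 = c d.1 + (k + 1 : ℕ) * (c d.2 - c d.1) := by
  induction k generalizing d with
  | zero =>
    cases h
    push_cast
    ring
  | succ k ih =>
    obtain ⟨d', h1, h2⟩ := h
    rw [ih h2, hc.sub_eq_of_dStep h1, h1.1]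
    push_cast
    ring

theorem zmod_three_same :
    ∀ a b x y : ZMod 3, a ≠ b ∧ x ≠ a ∧ x ≠ b ∧ y ≠ a ∧ y ≠ b → x = y := by
  decide

theorem zmod_three_mul : ∀ m e : ZMod 3, e ≠ 0 → m * e = 0 → m = 0 := by decide

/-- Along a walk the colours form an arithmetic progression with non-zero difference. Both ends of a
diamond get the colour missing on its middle edge, and equal colours at the two ends of the walk
make its length vanish in `ZMod 3`. -/
theorem IsDyn.noBad {c : V → ZMod 3} (hc : G.IsDyn c) : G.NoBad := by
  intro u x y w k hux hw hs
  have h1 := hc.apply_of_dWalk hw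
  have h2 : c u = c w := by
    rcases hs with rfl | ⟨a, b, hab, ha, hb, ha', hb'⟩
    · rfl
    · exact zmod_three_same (c a) (c b) _ _ ⟨hc.1 _ _ hab, hc.1 _ _ ha, hc.1 _ _ hb,
        hc.1 _ _ ha', hc.1 _ _ hb'⟩
  simp only [h2, left_eq_add] at h1
  rw [← h2] at h1
  exact (ZMod.natCast_eq_zero_iff _ 3).1
    (zmod_three_mul _ _ (sub_ne_zero.2 (hc.1 _ _ hux).symm) h1)

/-- In a claw-free graph, a vertex of degree three lies in a triangle. -/
theorem exists_triangle_of_isClawFree (hG : IsClawFree G) {v : V} (hv : G.ndeg v = 3) :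
    ∃ a b, G.Adj v a ∧ G.Adj v b ∧ G.Adj a b := by
  by_contra! hn
  obtain ⟨x, y, z, hxy, hxz, hyz, h⟩ := Set.ncard_eq_three.1 hv
  have hx : G.Adj v x := by
    have : x ∈ G.neighborSet v := by simp [h]
    exact this
  have hy : G.Adj v y := by
    have : y ∈ G.neighborSet v := by simp [h]
    exact this
  have hz : G.Adj v z := by
    have : z ∈ G.neighborSet v := by simp [h]
    exact this
  set f : Fin 1 ⊕ Fin 3 → V := Sum.elim (fun _ => v) ![x, y, z] with hf
  have hinj : Injective f := by
    have h1 := hx.ne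
    have h2 := hy.ne
    have h3 := hz.ne
    rintro (a | a) (b | b) hab
    · rw [Subsingleton.elim a b]
    · fin_cases b <;> simp_all
    · fin_cases a <;> simp_all
    · fin_cases a <;> fin_cases b <;> simp_all
  have hadj : ∀ a b, G.Adj (f a) (f b) ↔ (completeBipartiteGraph (Fin 1) (Fin 3)).Adj a b := by
    have h1 := hn _ _ hx hy
    have h2 := hn _ _ hx hz
    have h3 := hn _ _ hy hz
    have h1' := hn _ _ hy hx
    have h2' := hn _ _ hz hx
    have h3' := hn _ _ hz hy
    rintro (a | a) (b | b)
    · simp [hf]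
    · fin_cases b <;> simp [hf, hx, hy, hz]
    · fin_cases a <;> simp [hf, hx.symm, hy.symm, hz.symm]
    · fin_cases a <;> fin_cases b <;> simp [hf, h1, h2, h3, h1', h2', h3']
  exact hG ⟨⟨⟨f, hinj⟩, hadj _ _⟩⟩

theorem degree_eq_ndeg (v : V) [Fintype (G.neighborSet v)] : G.degree v = G.ndeg v := by
  rw [ndeg, Set.ncard_eq_toFinset_card', ← G.card_neighborSet_eq_degree, Set.toFinset_card]

theorem IsDynamicColoring.isDyn [Fintype V] {k : ℕ} (hk : k ≤ 3) {c : V → Fin k}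
    (hc : IsDynamicColoring G c) : ∃ c : V → ZMod 3, G.IsDyn c := by
  refine ⟨fun v => (Fin.castLE hk (c v) : Fin 3), fun u v h => ?_, fun v u w hv hu hw hne h => ?_⟩
  · intro h'
    exact hc.2.1 u v h (Fin.castLE_injective hk h')
  · have h' : c u = c w := Fin.castLE_injective hk h
    have h1 := hc.2.2 v
    rw [degree_eq_ndeg, hv] at h1
    have h2 : c '' G.neighborSet v ⊆ {c u} := by
      rintro _ ⟨z, hz, rfl⟩
      rcases eq_or_eq_of_ndeg_two hv hu hw hz hne with rfl | rfl
      · rfl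
      · exact h'.symm
    have h3 := Set.ncard_le_ncard h2
    rw [Set.ncard_singleton] at h3
    omega

/-- A vertex of degree three sees two colours because of its triangle, and degree at most one
demands nothing more than properness, so only degree two adds a condition. Surjectivity is obtained
by renumbering the colours that occur. -/
theorem dynamicChromaticNumber_le_iff [Fintype V] (hd : ∀ v, G.ndeg v ≤ 3)
    (ht : ∀ v, G.ndeg v = 3 → ∃ a b, G.Adj v a ∧ G.Adj v b ∧ G.Adj a b) :
    dynamicChromaticNumber G ≤ 3 ↔ ∃ c : V → ZMod 3, G.IsDyn c := by
  classical
  constructor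
  · intro h
    -- The infimum of an empty set would be the default `0`; giving all vertices different colours
    -- shows that the set is non-empty, so that the infimum is attained.
    have hne : {k : ℕ | ∃ c : V → Fin k, IsDynamicColoring G c}.Nonempty := by
      refine ⟨Fintype.card V, Fintype.equivFin V, (Fintype.equivFin V).surjective,
        fun u v h => (Fintype.equivFin V).injective.ne h.ne, fun v => ?_⟩
      rw [Set.ncard_image_of_injective _ (Fintype.equivFin V).injective, degree_eq_ndeg]
      exact min_le_left _ _
    obtain ⟨c, hc⟩ := Nat.sInf_mem hne
    exact IsDynamicColoring.isDyn h hc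
  · rintro ⟨c, hc⟩
    set S := Set.range c with hS
    have hfin : S.Finite := Set.toFinite _
    have e : S ≃ Fin (Nat.card S) := Finite.equivFin _
    have hcard : Nat.card S ≤ 3 := by
      refine (Nat.card_mono (Set.toFinite Set.univ) (Set.subset_univ S)).trans ?_
      simp
    suffices h : IsDynamicColoring G (fun v => e ⟨c v, v, rfl⟩) from
      (Nat.sInf_le (s := {k : ℕ | ∃ c : V → Fin k, IsDynamicColoring G c}) ⟨_, h⟩).trans hcard
    refine ⟨?_, ?_, ?_⟩
    · intro i
      obtain ⟨⟨_, v, rfl⟩, hv⟩ := e.surjective i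
      exact ⟨v, hv⟩
    · intro u v h h'
      have := e.injective h'
      exact hc.1 u v h (congrArg Subtype.val this)
    · intro v
      have him : ∀ a b, G.Adj v a → G.Adj v b → c a ≠ c b →
          2 ≤ ((fun v => e ⟨c v, v, rfl⟩) '' G.neighborSet v).ncard := by
        intro a b ha hb hab
        rw [← Set.ncard_pair (a := e ⟨c a, a, rfl⟩) (b := e ⟨c b, b, rfl⟩)
          (fun h => hab (congrArg Subtype.val (e.injective h)))]
        refine Set.ncard_le_ncard ?_ (Set.toFinite _)
        rintro _ (rfl | rfl)
        exacts [⟨a, ha, rfl⟩, ⟨b, hb, rfl⟩]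
      rw [degree_eq_ndeg]
      have h3 := hd v
      obtain h | h | h | h : G.ndeg v = 0 ∨ G.ndeg v = 1 ∨ G.ndeg v = 2 ∨ G.ndeg v = 3 := by omega
      · simp [h]
      · obtain ⟨a, ha⟩ := Set.ncard_eq_one.1 h
        rw [h, ha]
        simp
      · obtain ⟨a, b, hab, hh⟩ := Set.ncard_eq_two.1 h
        have ha : G.Adj v a := by
          have : a ∈ G.neighborSet v := by simp [hh]
          exact this
        have hb : G.Adj v b := by
          have : b ∈ G.neighborSet v := by simp [hh]
          exact this
        rw [h]
        exact him a b ha hb (hc.2 v a b h ha hb hab)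
      · obtain ⟨a, b, ha, hb, hab⟩ := ht v h
        rw [h]
        exact him a b ha hb (hc.1 a b hab)

end SimpleGraph

end

/-! ### Three-colouring graphs with a triangle at every cubic vertex and no `K₄` -/

section

open Function

namespace SimpleGraph

variable {V : Type}

/-- Remove all edges at the vertices of `X`. -/
def strip (H : SimpleGraph V) (X : Set V) : SimpleGraph V where
  Adj u v := H.Adj u v ∧ u ∉ X ∧ v ∉ X
  symm := ⟨fun _ _ h => ⟨h.1.symm, h.2.2, h.2.1⟩⟩
  loopless := ⟨fun _ h => h.1.ne rfl⟩

/-- Maximum degree at most three, every vertex of degree three is in a triangle, and there is no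
`K₄`. -/
structure TriCubic (H : SimpleGraph V) : Prop where
  ndeg_le : ∀ v, H.ndeg v ≤ 3
  tri : ∀ v, H.ndeg v = 3 → ∃ a b, H.Adj v a ∧ H.Adj v b ∧ H.Adj a b
  noK4 : ∀ p q r s, H.Adj p q → H.Adj p r → H.Adj p s → H.Adj q r → H.Adj q s → H.Adj r s → False

theorem ndeg_mono [Finite V] {H H' : SimpleGraph V} (h : H ≤ H') (v : V) : H.ndeg v ≤ H'.ndeg v :=
  Set.ncard_le_ncard (fun _ hw => h hw) (Set.toFinite _)

theorem ndeg_eq_zero_iff [Finite V] {H : SimpleGraph V} {v : V} :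
    H.ndeg v = 0 ↔ ∀ w, ¬ H.Adj v w := by
  rw [ndeg, Set.ncard_eq_zero (Set.toFinite _), Set.eq_empty_iff_forall_notMem]
  rfl

theorem exists_pair_of_ndeg_le_two [Finite V] {H : SimpleGraph V} {v : V} (h : H.ndeg v ≤ 2) :
    ∃ a b, ∀ w, H.Adj v w → w = a ∨ w = b := by
  obtain h | h | h : H.ndeg v = 0 ∨ H.ndeg v = 1 ∨ H.ndeg v = 2 := by omega
  · exact ⟨v, v, fun w hw => absurd hw (ndeg_eq_zero_iff.1 h w)⟩
  · obtain ⟨a, ha⟩ := Set.ncard_eq_one.1 h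
    refine ⟨a, a, fun w hw => Or.inl ?_⟩
    have : w ∈ H.neighborSet v := hw
    rwa [ha] at this
  · obtain ⟨a, b, -, ha⟩ := Set.ncard_eq_two.1 h
    refine ⟨a, b, fun w hw => ?_⟩
    have : w ∈ H.neighborSet v := hw
    rwa [ha] at this

theorem exists_third_of_ndeg_three {H : SimpleGraph V} {v a b : V} (h : H.ndeg v = 3)
    (ha : H.Adj v a) (hb : H.Adj v b) (hab : a ≠ b) :
    ∃ d, H.Adj v d ∧ d ≠ a ∧ d ≠ b ∧ ∀ w, H.Adj v w → w = a ∨ w = b ∨ w = d := by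
  obtain ⟨x, y, z, hxy, hxz, hyz, hN⟩ := Set.ncard_eq_three.1 h
  have key : ∀ w, H.Adj v w ↔ w = x ∨ w = y ∨ w = z := fun w => by
    change w ∈ H.neighborSet v ↔ _
    rw [hN]
    simp
  simp only [key] at *
  rcases ha with rfl | rfl | rfl <;> rcases hb with rfl | rfl | rfl
  · exact absurd rfl hab
  · exact ⟨z, by simp, hxz.symm, hyz.symm, fun w hw => by tauto⟩
  · exact ⟨y, by simp, hxy.symm, hyz, fun w hw => by tauto⟩
  · exact ⟨z, by simp, hyz.symm, hxz.symm, fun w hw => by tauto⟩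
  · exact absurd rfl hab
  · exact ⟨x, by simp, hxy, hxz, fun w hw => by tauto⟩
  · exact ⟨y, by simp, hyz, hxy.symm, fun w hw => by tauto⟩
  · exact ⟨x, by simp, hxz, hxy, fun w hw => by tauto⟩
  · exact absurd rfl hab

theorem strip_le (H : SimpleGraph V) (X : Set V) : H.strip X ≤ H := fun _ _ h => h.1

/-- A vertex that still has degree three has lost no edge, so none of its neighbours lies in `X` and
its triangle survives. -/
theorem TriCubic.strip [Finite V] {H : SimpleGraph V} (hH : H.TriCubic) (X : Set V) :
    (H.strip X).TriCubic where
  ndeg_le v := (ndeg_mono (strip_le H X) v).trans (hH.ndeg_le v)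
  tri v hv := by
    have h1 := ndeg_mono (strip_le H X) v
    have h2 := hH.ndeg_le v
    have h3 : (H.strip X).neighborSet v = H.neighborSet v :=
      Set.eq_of_subset_of_ncard_le (fun _ hw => hw.1)
        (by change H.ndeg v ≤ (H.strip X).ndeg v; omega) (Set.toFinite _)
    obtain ⟨a, b, ha, hb, hab⟩ := hH.tri v (by omega)
    have ha' : a ∈ (H.strip X).neighborSet v := h3 ▸ ha
    have hb' : b ∈ (H.strip X).neighborSet v := h3 ▸ hb
    exact ⟨a, b, ha', hb', hab, ha'.2.2, hb'.2.2⟩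
  noK4 p q r s h1 h2 h3 h4 h5 h6 := hH.noK4 p q r s h1.1 h2.1 h3.1 h4.1 h5.1 h6.1

/-- The vertices that are not isolated. -/
def active (H : SimpleGraph V) : Set V := {v | ∃ w, H.Adj v w}

/-- To verify that a map is a colouring, check the vertices of `X` and the rest separately. -/
theorem proper_of_strip {H : SimpleGraph V} {X : Set V} {c c' : V → ZMod 3}
    (hc : ∀ u v, (H.strip X).Adj u v → c u ≠ c v) (hX : ∀ v, v ∉ X → c' v = c v)
    (h : ∀ u ∈ X, ∀ v, H.Adj u v → c' u ≠ c' v) : ∀ u v, H.Adj u v → c' u ≠ c' v := by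
  intro u v huv
  by_cases hu : u ∈ X
  · exact h u hu v huv
  · by_cases hv : v ∈ X
    · exact (h v hv u huv.symm).symm
    · rw [hX u hu, hX v hv]
      exact hc u v ⟨huv, hu, hv⟩

theorem active_strip_ncard_lt [Finite V] {H : SimpleGraph V} {X : Set V} {v : V} (hv : v ∈ H.active)
    (hX : v ∈ X) : (H.strip X).active.ncard < H.active.ncard := by
  refine Set.ncard_lt_ncard ⟨fun u ⟨w, hw⟩ => ⟨w, hw.1⟩, fun h => ?_⟩ (Set.toFinite _)
  obtain ⟨w, hw⟩ := h hv
  exact hw.2.1 hX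

theorem zmod_three_avoid : ∀ a b : ZMod 3, ∃ k, k ≠ a ∧ k ≠ b := by decide

/-- A triangle with one forbidden colour at each vertex can be coloured unless the three forbidden
colours coincide. -/
theorem zmod_three_extend : ∀ x y z : ZMod 3, x ≠ y →
    ∃ a b c, (a ≠ b ∧ a ≠ c ∧ b ≠ c) ∧ a ≠ x ∧ b ≠ y ∧ c ≠ z := by decide

theorem exists_coloring_of_low_degree [Finite V] {H : SimpleGraph V} {v : V} (hv : H.ndeg v ≤ 2)
    {c : V → ZMod 3} (hc : ∀ u w, (H.strip {v}).Adj u w → c u ≠ c w) :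
    ∃ c : V → ZMod 3, ∀ u w, H.Adj u w → c u ≠ c w := by
  classical
  obtain ⟨a, b, hab⟩ := exists_pair_of_ndeg_le_two hv
  obtain ⟨k, hka, hkb⟩ := zmod_three_avoid (c a) (c b)
  refine ⟨update c v k, proper_of_strip hc (fun w hw => update_of_ne hw _ _) ?_⟩
  rintro u rfl w huw
  rw [update_self, update_of_ne huw.ne.symm]
  rcases hab w huw with rfl | rfl
  exacts [hka, hkb]

/-- The middle vertices `x`, `y` have no neighbour outside the diamond, and the ends `u`, `w` are
not adjacent, as there is no `K₄`. So the ends can share a colour that avoids both of their outer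
neighbours, and two colours remain for `x` and `y`. -/
theorem exists_coloring_of_diamond {H : SimpleGraph V} (hH : H.TriCubic)
    {x y u w : V} (h3 : ∀ v ∈ H.active, H.ndeg v = 3) (hxy : H.Adj x y) (hux : H.Adj u x)
    (huy : H.Adj u y) (hwx : H.Adj w x) (hwy : H.Adj w y) (huw : u ≠ w)
    {c : V → ZMod 3} (hc : ∀ p q, (H.strip {x, y, u, w}).Adj p q → c p ≠ c q) :
    ∃ c : V → ZMod 3, ∀ u w, H.Adj u w → c u ≠ c w := by
  classical
  have hnuw : ¬ H.Adj u w := fun h => hH.noK4 x y u w hxy hux.symm hwx.symm huy.symm hwy.symm h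
  obtain ⟨x', -, hx1, hx2, hx3⟩ := exists_third_of_ndeg_three (h3 x ⟨y, hxy⟩) hxy hux.symm huy.ne.symm
  obtain ⟨y', -, hy1, hy2, hy3⟩ := exists_third_of_ndeg_three (h3 y ⟨x, hxy.symm⟩) hxy.symm huy.symm
    hux.ne.symm
  have hx' : x' = w := by
    rcases hx3 w hwx.symm with h | h | h
    exacts [absurd h hwy.ne, absurd h.symm huw, h.symm]
  have hy' : y' = w := by
    rcases hy3 w hwy.symm with h | h | h
    exacts [absurd h hwx.ne, absurd h.symm huw, h.symm]
  subst hx'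
  subst hy'
  obtain ⟨u', hu', hu1, hu2, hu3⟩ := exists_third_of_ndeg_three (h3 u ⟨x, hux⟩) hux huy hxy.ne
  obtain ⟨w', hw', hw1, hw2, hw3⟩ := exists_third_of_ndeg_three (h3 y' ⟨x, hwx⟩) hwx hwy hxy.ne
  have hu4 : u' ≠ y' := fun h => hnuw (h ▸ hu')
  have hw4 : w' ≠ u := fun h => hnuw (h ▸ hw').symm
  obtain ⟨k, hk1, hk2⟩ := zmod_three_avoid (c u') (c w')
  have e1 : ∀ k : ZMod 3, k + 1 ≠ k + 2 ∧ k + 1 ≠ k ∧ k + 2 ≠ k := by decide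
  obtain ⟨e1, e2, e3⟩ := e1 k
  set c' : V → ZMod 3 := fun z => if z = x then k + 1 else if z = y then k + 2 else
    if z = u ∨ z = y' then k else c z with hc'
  have cx : c' x = k + 1 := by simp [hc']
  have cy : c' y = k + 2 := by simp [hc', hxy.ne.symm]
  have cu : c' u = k := by simp [hc', hux.ne, huy.ne]
  have cw : c' y' = k := by simp [hc', hwx.ne, hwy.ne]
  have cu' : c' u' = c u' := by simp [hc', hu1, hu2, hu'.ne.symm, hu4]
  have cw' : c' w' = c w' := by simp [hc', hw1, hw2, hw'.ne.symm, hw4]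
  refine ⟨c', proper_of_strip hc (fun z hz => ?_) ?_⟩
  · simp only [Set.mem_insert_iff, Set.mem_singleton_iff, not_or] at hz
    simp [hc', hz]
  · rintro z (rfl | rfl | rfl | rfl) v hv
    · rw [cx]
      rcases hx3 v hv with rfl | rfl | rfl
      · rwa [cy]
      · rwa [cu]
      · rwa [cw]
    · rw [cy]
      rcases hy3 v hv with rfl | rfl | rfl
      · rw [cx]; exact e1.symm
      · rwa [cu]
      · rwa [cw]
    · rw [cu]
      rcases hu3 v hv with rfl | rfl | rfl
      · rw [cx]; exact e2.symm
      · rw [cy]; exact e3.symm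
      · rwa [cu']
    · rw [cw]
      rcases hw3 v hv with rfl | rfl | rfl
      · rw [cx]; exact e2.symm
      · rw [cy]; exact e3.symm
      · rwa [cw']

/-- Replace the triangle `abc` by an edge between two outside neighbours. -/
def reduceTriangle (H : SimpleGraph V) (a b c a' b' : V) : SimpleGraph V :=
  H.strip {a, b, c} ⊔ edge a' b'

theorem reduceTriangle_adj {H : SimpleGraph V} {a b c a' b' u v : V} :
    (H.reduceTriangle a b c a' b').Adj u v ↔ (H.strip {a, b, c}).Adj u v ∨
      (u = a' ∧ v = b' ∨ u = b' ∧ v = a') ∧ u ≠ v := by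
  rw [reduceTriangle, sup_adj, edge_adj]

theorem exists_coloring_extend_triangle {H : SimpleGraph V} {a b c a' b' c' : V}
    (hab : H.Adj a b) (hac : H.Adj a c) (hbc : H.Adj b c)
    (ha' : H.Adj a a') (ha1 : a' ≠ b) (ha2 : a' ≠ c) (ha3 : ∀ w, H.Adj a w → w = b ∨ w = c ∨ w = a')
    (hb' : H.Adj b b') (hb1 : b' ≠ a) (hb2 : b' ≠ c) (hb3 : ∀ w, H.Adj b w → w = a ∨ w = c ∨ w = b')
    (hc' : H.Adj c c') (hc1 : c' ≠ a) (hc2 : c' ≠ b) (hc3 : ∀ w, H.Adj c w → w = a ∨ w = b ∨ w = c')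
    {f : V → ZMod 3} (hf : ∀ u v, (H.strip {a, b, c}).Adj u v → f u ≠ f v) (hf' : f a' ≠ f b') :
    ∃ c : V → ZMod 3, ∀ u w, H.Adj u w → c u ≠ c w := by
  classical
  obtain ⟨α, β, γ, ⟨e1, e2, e3⟩, e4, e5, e6⟩ := zmod_three_extend (f a') (f b') (f c') hf'
  set g : V → ZMod 3 := fun z => if z = a then α else if z = b then β else if z = c then γ
    else f z with hg
  have ga : g a = α := by simp [hg]
  have gb : g b = β := by simp [hg, hab.ne.symm]
  have gc : g c = γ := by simp [hg, hac.ne.symm, hbc.ne.symm]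
  have ga' : g a' = f a' := by simp [hg, ha'.ne.symm, ha1, ha2]
  have gb' : g b' = f b' := by simp [hg, hb'.ne.symm, hb1, hb2]
  have gc' : g c' = f c' := by simp [hg, hc'.ne.symm, hc1, hc2]
  refine ⟨g, proper_of_strip (X := {a, b, c}) (c := f)
    hf (fun z hz => ?_) ?_⟩
  · simp only [Set.mem_insert_iff, Set.mem_singleton_iff, not_or] at hz
    simp [hg, hz]
  · rintro z (rfl | rfl | rfl) v hv
    · rw [ga]
      rcases ha3 v hv with rfl | rfl | rfl
      · rwa [gb]
      · rwa [gc]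
      · rwa [ga']
    · rw [gb]
      rcases hb3 v hv with rfl | rfl | rfl
      · rw [ga]; exact e1.symm
      · rwa [gc]
      · rwa [gb']
    · rw [gc]
      rcases hc3 v hv with rfl | rfl | rfl
      · rw [ga]; exact e2.symm
      · rw [gb]; exact e3.symm
      · rwa [gc']

/-- Replacing the triangle by an edge between `a'` and `b'` forces these to differ in colour, which
is what the extension over the triangle needs. The absence of diamonds makes `a'` and `b'` distinct
and keeps the reduced graph in the class. -/
theorem exists_coloring_of_triangle [Finite V] {H : SimpleGraph V} (hH : H.TriCubic)
    (h3 : ∀ v ∈ H.active, H.ndeg v = 3)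
    (hD : ∀ x y u w, H.Adj x y → H.Adj u x → H.Adj u y → H.Adj w x → H.Adj w y → u = w)
    {a b c : V} (hab : H.Adj a b) (hac : H.Adj a c) (hbc : H.Adj b c)
    (ih : ∀ H' : SimpleGraph V, H'.active.ncard < H.active.ncard → H'.TriCubic →
      ∃ c : V → ZMod 3, ∀ u w, H'.Adj u w → c u ≠ c w) :
    ∃ c : V → ZMod 3, ∀ u w, H.Adj u w → c u ≠ c w := by
  classical
  obtain ⟨a', ha', ha1, ha2, ha3⟩ := exists_third_of_ndeg_three (h3 a ⟨b, hab⟩) hab hac hbc.ne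
  obtain ⟨b', hb', hb1, hb2, hb3⟩ := exists_third_of_ndeg_three (h3 b ⟨a, hab.symm⟩) hab.symm hbc
    hac.ne
  obtain ⟨c', hc', hc1, hc2, hc3⟩ := exists_third_of_ndeg_three (h3 c ⟨a, hac.symm⟩) hac.symm
    hbc.symm hab.ne
  have hab' : a' ≠ b' := fun h => ha2 (hD a b a' c hab ha'.symm (h ▸ hb'.symm) hac.symm hbc.symm)
  -- A triangle through a vertex outside `abc` that meets `abc` would share an edge with it, because
  -- the degrees are three, and would produce a diamond.
  have key : ∀ z p q, z ∉ ({a, b, c} : Set V) → H.Adj z p → H.Adj z q → H.Adj p q →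
      p ∉ ({a, b, c} : Set V) := by
    intro z p q hz hzp hzq hpq hp
    simp only [Set.mem_insert_iff, Set.mem_singleton_iff, not_or] at hz
    obtain ⟨hza, hzb, hzc⟩ := hz
    rcases hp with rfl | rfl | rfl
    · rcases ha3 z hzp.symm with h | h | h
      · exact hzb h
      · exact hzc h
      · rcases ha3 q hpq with rfl | rfl | h'
        · exact hzc (hD p q z c hab hzp hzq hac.symm hbc.symm)
        · exact hzb (hD p q z b hac hzp hzq hab.symm hbc)
        · exact hzq.ne (h.trans h'.symm)
    · rcases hb3 z hzp.symm with h | h | h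
      · exact hza h
      · exact hzc h
      · rcases hb3 q hpq with rfl | rfl | h'
        · exact hzc (hD p q z c hab.symm hzp hzq hbc.symm hac.symm)
        · exact hza (hD p q z a hbc hzp hzq hab hac)
        · exact hzq.ne (h.trans h'.symm)
    · rcases hc3 z hzp.symm with h | h | h
      · exact hza h
      · exact hzb h
      · rcases hc3 q hpq with rfl | rfl | h'
        · exact hzb (hD p q z b hac.symm hzp hzq hbc hab.symm)
        · exact hza (hD p q z a hbc.symm hzp hzq hac hab)
        · exact hzq.ne (h.trans h'.symm)
  have hsub : ∀ u v, (H.reduceTriangle a b c a' b').Adj u v → u ∈ H.active := by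
    intro u v h
    rcases reduceTriangle_adj.1 h with h | ⟨⟨rfl, -⟩ | ⟨rfl, -⟩, -⟩
    exacts [⟨v, h.1⟩, ⟨a, ha'.symm⟩, ⟨b, hb'.symm⟩]
  have hnot : ∀ u v, (H.reduceTriangle a b c a' b').Adj u v → u ∉ ({a, b, c} : Set V) := by
    intro u v h
    rcases reduceTriangle_adj.1 h with h | ⟨⟨rfl, -⟩ | ⟨rfl, -⟩, -⟩
    · exact h.2.1
    · simp [ha'.ne.symm, ha1, ha2]
    · simp [hb'.ne.symm, hb1, hb2]
  -- The new edge at `v` makes up for the lost edge to `x`, so the degree does not grow.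
  have hcount : ∀ (v x y : V), H.Adj v x → x ∈ ({a, b, c} : Set V) →
      (∀ w, (H.reduceTriangle a b c a' b').Adj v w → (H.strip {a, b, c}).Adj v w ∨ w = y) →
      (H.reduceTriangle a b c a' b').ndeg v ≤ 3 := by
    intro v x y hvx hx hw
    have h1 : (H.reduceTriangle a b c a' b').neighborSet v ⊆
        insert y (H.neighborSet v \ {x}) := by
      intro w hvw
      rcases hw w hvw with h | h
      · exact Or.inr ⟨h.1, fun h' => h.2.2 (h' ▸ hx)⟩
      · exact Or.inl h
    have h2 := Set.ncard_le_ncard h1 (Set.toFinite _)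
    have h4 := Set.ncard_insert_le y (H.neighborSet v \ {x})
    have h5 := Set.ncard_sdiff_singleton_add_one (show x ∈ H.neighborSet v from hvx) (Set.toFinite _)
    have h6 := hH.ndeg_le v
    unfold ndeg at h6 ⊢
    omega
  have hlt : (H.reduceTriangle a b c a' b').active.ncard < H.active.ncard := by
    refine Set.ncard_lt_ncard ⟨fun u ⟨w, hw⟩ => hsub u w hw, fun h => ?_⟩ (Set.toFinite _)
    obtain ⟨w, hw⟩ := h ⟨b, hab⟩
    exact hnot a w hw (by simp)
  have htc : (H.reduceTriangle a b c a' b').TriCubic := by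
    refine ⟨fun v => ?_, fun v hv => ?_, ?_⟩
    · by_cases h1 : v = a'
      · subst h1
        refine hcount v a b' ha'.symm (by simp) fun w hw => ?_
        rcases reduceTriangle_adj.1 hw with h | ⟨⟨-, rfl⟩ | ⟨h, -⟩, -⟩
        exacts [Or.inl h, Or.inr rfl, absurd h hab']
      · by_cases h2 : v = b'
        · subst h2
          refine hcount v b a' hb'.symm (by simp) fun w hw => ?_
          rcases reduceTriangle_adj.1 hw with h | ⟨⟨h, -⟩ | ⟨-, rfl⟩, -⟩
          exacts [Or.inl h, absurd h h1, Or.inr rfl]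
        · refine (Set.ncard_le_ncard (fun w hw => ?_) (Set.toFinite _)).trans (hH.ndeg_le v)
          rcases reduceTriangle_adj.1 hw with h | ⟨⟨h, -⟩ | ⟨h, -⟩, -⟩
          exacts [h.1, absurd h h1, absurd h h2]
    · obtain ⟨w, hw⟩ : ∃ w, (H.reduceTriangle a b c a' b').Adj v w := by
        by_contra! hn
        rw [ndeg_eq_zero_iff.2 hn] at hv
        omega
      have hv' := hnot v w hw
      obtain ⟨p, q, hp, hq, hpq⟩ := hH.tri v (h3 v (hsub v w hw))
      have hp' := key v p q hv' hp hq hpq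
      have hq' := key v q p hv' hq hp hpq.symm
      exact ⟨p, q, reduceTriangle_adj.2 (Or.inl ⟨hp, hv', hp'⟩),
        reduceTriangle_adj.2 (Or.inl ⟨hq, hv', hq'⟩), reduceTriangle_adj.2 (Or.inl ⟨hpq, hp', hq'⟩)⟩
    · have hadj : ∀ u v, (H.reduceTriangle a b c a' b').Adj u v → v ≠ a' → v ≠ b' → H.Adj u v := by
        intro u v h h1 h2
        rcases reduceTriangle_adj.1 h with h | ⟨⟨-, h⟩ | ⟨-, h⟩, -⟩
        exacts [h.1, absurd h h2, absurd h h1]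
      -- If an edge `pq` of a `K₄` were new, `r` and `s` would be neither `a'` nor `b'`. The other
      -- five edges would then be old and form a diamond with ends `p` and `q`.
      have hall : ∀ p q r s, (H.reduceTriangle a b c a' b').Adj p q →
          (H.reduceTriangle a b c a' b').Adj p r → (H.reduceTriangle a b c a' b').Adj p s →
          (H.reduceTriangle a b c a' b').Adj q r → (H.reduceTriangle a b c a' b').Adj q s →
          (H.reduceTriangle a b c a' b').Adj r s → H.Adj p q := by
        intro p q r s h1 h2 h3 h4 h5 h6
        rcases reduceTriangle_adj.1 h1 with h | h
        · exact h.1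
        · have hr1 : r ≠ a' ∧ r ≠ b' := by
            have := h2.ne
            have := h4.ne
            rcases h.1 with ⟨rfl, rfl⟩ | ⟨rfl, rfl⟩ <;> constructor <;> exact Ne.symm ‹_›
          have hs1 : s ≠ a' ∧ s ≠ b' := by
            have := h3.ne
            have := h5.ne
            rcases h.1 with ⟨rfl, rfl⟩ | ⟨rfl, rfl⟩ <;> constructor <;> exact Ne.symm ‹_›
          exact absurd (hD r s p q (hadj r s h6 hs1.1 hs1.2) (hadj p r h2 hr1.1 hr1.2)
            (hadj p s h3 hs1.1 hs1.2) (hadj q r h4 hr1.1 hr1.2) (hadj q s h5 hs1.1 hs1.2)) h1.ne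
      intro p q r s h1 h2 h3 h4 h5 h6
      exact hH.noK4 p q r s (hall p q r s h1 h2 h3 h4 h5 h6)
        (hall p r q s h2 h1 h3 h4.symm h6 h5)
        (hall p s q r h3 h1 h2 h5.symm h6.symm h4)
        (hall q r p s h4 h1.symm h5 h2.symm h6 h3)
        (hall q s p r h5 h1.symm h4 h3.symm h6.symm h2)
        (hall r s p q h6 h2.symm h4.symm h3.symm h5.symm h1)
  obtain ⟨f, hf⟩ := ih (H.reduceTriangle a b c a' b') hlt htc
  have hf' : f a' ≠ f b' := hf a' b' (reduceTriangle_adj.2 (Or.inr ⟨Or.inl ⟨rfl, rfl⟩, hab'⟩))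
  exact exists_coloring_extend_triangle hab hac hbc ha' ha1 ha2 ha3 hb' hb1 hb2 hb3 hc' hc1 hc2 hc3
    (fun u v h => hf u v (reduceTriangle_adj.2 (Or.inl h))) hf'

/-- A case of Brooks' theorem. -/
theorem TriCubic.exists_coloring [Finite V] {H : SimpleGraph V} (hH : H.TriCubic) :
    ∃ c : V → ZMod 3, ∀ u w, H.Adj u w → c u ≠ c w := by
  -- The induction is on the number of non-isolated vertices. If all of these have degree three,
  -- either a diamond is removed or a triangle is replaced by an edge; otherwise a vertex of degree
  -- at most two is removed.
  induction hn : H.active.ncard using Nat.strong_induction_on generalizing H with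
  | _ n ih =>
    subst hn
    have ih' : ∀ H' : SimpleGraph V, H'.active.ncard < H.active.ncard → H'.TriCubic →
      ∃ c : V → ZMod 3, ∀ u w, H'.Adj u w → c u ≠ c w := fun H' h h' => ih _ h h' rfl
    by_cases h3 : ∀ v ∈ H.active, H.ndeg v = 3
    · by_cases hD : ∀ x y u w, H.Adj x y → H.Adj u x → H.Adj u y → H.Adj w x → H.Adj w y → u = w
      · by_cases he : H.active.Nonempty
        · obtain ⟨v, hv⟩ := he
          obtain ⟨a, b, ha, hb, hab⟩ := hH.tri v (h3 v hv)
          exact exists_coloring_of_triangle hH h3 hD ha hb hab ih'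
        · exact ⟨fun _ => 0, fun u w h => absurd ⟨u, w, h⟩ he⟩
      · push Not at hD
        obtain ⟨x, y, u, w, h1, h2, h4, h5, h6, h7⟩ := hD
        obtain ⟨c, hc⟩ := ih' (H.strip {x, y, u, w})
          (active_strip_ncard_lt (v := x) ⟨y, h1⟩ (by simp)) (hH.strip _)
        exact exists_coloring_of_diamond hH h3 h1 h2 h4 h5 h6 h7 hc
    · push Not at h3
      obtain ⟨v, hv, hv3⟩ := h3
      obtain ⟨c, hc⟩ := ih' (H.strip {v}) (active_strip_ncard_lt hv (by simp)) (hH.strip _)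
      have := hH.ndeg_le v
      exact exists_coloring_of_low_degree (by omega) hc

end SimpleGraph

end

/-! ### The link graph on the vertices of degree three -/

section

open Function

namespace SimpleGraph

variable {V : Type} {G : SimpleGraph V}

/-- A maximal walk through vertices of degree two is a path. -/
theorem DWalk.exists_path {k : ℕ} {u x y w : V} (h : G.DWalk k (u, x) (y, w)) (hux : G.Adj u x)
    (hw : G.ndeg w ≠ 2)
    (hu : (G.ndeg u ≠ 2 ∧ u ≠ w) ∨ ∃ z, G.DStep (z, u) (u, x)) :
    ∃ p : G.Walk u w, p.IsPath ∧ p.support.length = k + 2 ∧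
      (∀ z ∈ p.support, z = u ∨ z = w ∨ G.ndeg z = 2) ∧
      ∀ z ∈ p.support, z ≠ u → ∃ i z', G.DWalk i (u, x) (z', z) := by
  induction k generalizing u x with
  | zero =>
    cases h
    refine ⟨.cons hux .nil, by simp [hux.ne], by simp, by simp, fun z hz hzu => ⟨0, y, ?_⟩⟩
    simp only [Walk.support_cons, Walk.support_nil, List.mem_cons, List.not_mem_nil, or_false] at hz
    rcases hz with rfl | rfl
    · exact absurd rfl hzu
    · rfl
  | succ k ih =>
    obtain ⟨⟨x', x2⟩, h1, h2⟩ := h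
    obtain rfl : x' = x := h1.1
    obtain ⟨p, hp, hl, hd, hi⟩ := ih h2 h1.adj_right (Or.inr ⟨u, h1⟩)
    -- If `u` is not of degree two, it cannot be interior to the rest, and it differs from `w`.
    -- Otherwise the walk would come back to `u` either from `z`, so that the length up to its end
    -- is not unique, or from its neighbour ahead, so that it reverses itself.
    have hup : u ∉ p.support := by
      intro hmem
      rcases hu with ⟨hu2, huw⟩ | ⟨z, hz⟩
      · rcases hd u hmem with h | h | h
        exacts [hux.ne h, huw h, hu2 h]
      · obtain ⟨i, z', hi⟩ := hi u hmem hux.ne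
        have hz' := hi.adj h1.adj_right
        rcases eq_or_eq_of_ndeg_two hz.ndeg_eq hz.adj_left.symm hux hz'.symm hz.2.2.2.1.symm
          with rfl | rfl
        · have h3 : G.DWalk (i + 1 + 1) (z', u) (z', u) := ⟨_, hz, _, h1, hi⟩
          have h4 : G.DWalk (k + 1 + 1) (z', u) (y, w) := ⟨_, hz, _, h1, h2⟩
          have := ((h3.trans h4).unique_end hw h4 hw).1
          omega
        · exact not_dWalk_swap (d := (u, z')) hux (k := i + 1) ⟨_, h1, hi⟩
    refine ⟨.cons hux p, ?_, by simp [hl], ?_, ?_⟩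
    · rw [Walk.cons_isPath_iff]
      exact ⟨hp, hup⟩
    · intro z hz
      rw [Walk.support_cons, List.mem_cons] at hz
      rcases hz with rfl | hz
      · exact Or.inl rfl
      · rcases hd z hz with rfl | h | h
        exacts [Or.inr (Or.inr h1.ndeg_eq), Or.inr (Or.inl h), Or.inr (Or.inr h)]
    · intro z hz hzu
      rw [Walk.support_cons, List.mem_cons] at hz
      rcases hz with rfl | hz
      · exact absurd rfl hzu
      · by_cases hzx : z = x'
        · subst hzx
          exact ⟨0, u, rfl⟩
        · obtain ⟨i, z', h⟩ := hi z hz hzx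
          exact ⟨i + 1, z', _, h1, h⟩

/-- The properties of the graphs in the class `𝒞` that are used. -/
structure Tame (G : SimpleGraph V) : Prop where
  ndeg_le : ∀ v, G.ndeg v ≤ 3
  tri : ∀ v, G.ndeg v = 3 → ∃ a b, G.Adj v a ∧ G.Adj v b ∧ G.Adj a b
  not_dvd : ∀ u x y w k, u ≠ w → G.ndeg u = 3 → G.ndeg w = 3 → G.Adj u x →
    G.DWalk k (u, x) (y, w) → ¬ 3 ∣ k + 1

theorem InClassC.tame [Fintype V] (h : InClassC G) : G.Tame where
  ndeg_le v := by
    classical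
    rw [← degree_eq_ndeg]
    refine le_trans ?_ h.1
    convert G.degree_le_maxDegree v
  tri v hv := exists_triangle_of_isClawFree h.2.1 hv
  not_dvd u x y w k huw hu hw hux hk hdvd := by
    obtain ⟨p, hp, hl, hd, -⟩ := hk.exists_path hux (by omega) (Or.inl ⟨by omega, huw⟩)
    obtain ⟨j, hj⟩ := hdvd
    -- The walk has `k + 1 = 3 * j` edges, hence `3 * j + 1` vertices.
    refine h.2.2 j (by omega) u w p ⟨hp, by omega, ?_, ?_, fun z hz h1 h2 => ?_⟩
    · rw [degree_eq_ndeg, hu]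
    · rw [degree_eq_ndeg, hw]
    · rw [degree_eq_ndeg]
      rcases hd z hz with h | h | h
      exacts [absurd h h1, absurd h h2, h]

/-- Two vertices of degree three are adjacent if they are connected by a path through vertices of
degree two. -/
def linkGraph (G : SimpleGraph V) : SimpleGraph V where
  Adj u w := u ≠ w ∧ G.ndeg u = 3 ∧ G.ndeg w = 3 ∧
    ∃ x y k, G.Adj u x ∧ G.DWalk k (u, x) (y, w)
  symm := ⟨fun _ _ ⟨h1, h2, h3, x, y, k, h4, h5⟩ =>
    ⟨h1.symm, h3, h2, y, x, k, (h5.adj h4).symm, h5.swap⟩⟩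
  loopless := ⟨fun _ h => h.1 rfl⟩

theorem linkGraph_adj_of_adj {u w : V} (h : G.Adj u w) (hu : G.ndeg u = 3) (hw : G.ndeg w = 3) :
    G.linkGraph.Adj u w :=
  ⟨h.ne, hu, hw, w, u, 0, h, rfl⟩

/-- The first vertices of the paths to the neighbours in the link graph. -/
theorem exists_firstStep (u : V) : ∃ φ : V → V, (∀ w, G.linkGraph.Adj u w →
    G.Adj u (φ w) ∧ ∃ y k, G.DWalk k (u, φ w) (y, w)) ∧
      Set.InjOn φ (G.linkGraph.neighborSet u) := by
  classical
  have h : ∀ w, ∃ x, G.linkGraph.Adj u w → G.Adj u x ∧ ∃ y k, G.DWalk k (u, x) (y, w) := by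
    intro w
    by_cases h : G.linkGraph.Adj u w
    · obtain ⟨-, -, -, x, y, k, h1, h2⟩ := h
      exact ⟨x, fun _ => ⟨h1, y, k, h2⟩⟩
    · exact ⟨u, fun h' => absurd h' h⟩
  choose φ hφ using h
  refine ⟨φ, hφ, fun w hw w' hw' he => ?_⟩
  obtain ⟨-, y, k, h1⟩ := hφ w hw
  obtain ⟨-, y', k', h1'⟩ := hφ w' hw'
  rw [he] at h1
  have h2 : G.ndeg w = 3 := hw.2.2.1
  have h2' : G.ndeg w' = 3 := hw'.2.2.1
  exact congrArg Prod.snd (h1.unique_end (by simp [h2]) h1' (by simp [h2'])).2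

theorem linkGraph_ndeg_le [Finite V] (u : V) : G.linkGraph.ndeg u ≤ G.ndeg u := by
  obtain ⟨φ, h1, h2⟩ := exists_firstStep (G := G) u
  exact Set.ncard_le_ncard_of_injOn φ (fun w hw => (h1 w hw).1) h2 (Set.toFinite _)

/-- Link degree three means that the edges at `u` start walks to three different vertices of degree
three. In a triangle `uab` of `G` with `a` of degree two, the walk through `a` would go on to `b`
and then either return to `u`, which is not a link, or end in `b`, which is already the link given
by the edge `ub`. -/
theorem Tame.exists_triangle_of_linkGraph_ndeg [Finite V] (hG : G.Tame) {u : V}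
    (hu : G.linkGraph.ndeg u = 3) :
    ∃ a b, G.Adj u a ∧ G.Adj u b ∧ G.Adj a b ∧ G.ndeg u = 3 ∧ G.ndeg a = 3 ∧ G.ndeg b = 3 := by
  obtain ⟨φ, h1, h2⟩ := exists_firstStep (G := G) u
  have hle := linkGraph_ndeg_le (G := G) u
  have hle' := hG.ndeg_le u
  have hu3 : G.ndeg u = 3 := by omega
  have himg : φ '' G.linkGraph.neighborSet u = G.neighborSet u := by
    refine Set.eq_of_subset_of_ncard_le ?_ ?_ (Set.toFinite _)
    · rintro _ ⟨w, hw, rfl⟩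
      exact (h1 w hw).1
    · rw [h2.ncard_image]
      change G.ndeg u ≤ G.linkGraph.ndeg u
      omega
  have hsurj : ∀ x, G.Adj u x → ∃ w, G.linkGraph.Adj u w ∧ φ w = x := by
    intro x hx
    have : x ∈ φ '' G.linkGraph.neighborSet u := himg ▸ hx
    exact this
  have key : ∀ a b, G.Adj u a → G.Adj u b → G.Adj a b → G.ndeg a = 3 := by
    intro a b ha hb hab
    obtain ⟨w, hw, rfl⟩ := hsurj a ha
    obtain ⟨w', hw', rfl⟩ := hsurj b hb
    obtain ⟨-, y, k, h3⟩ := h1 w hw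
    obtain ⟨-, y', k', h3'⟩ := h1 w' hw'
    have hw3 : G.ndeg w = 3 := hw.2.2.1
    have hw3' : G.ndeg w' = 3 := hw'.2.2.1
    by_cases ha2 : G.ndeg (φ w) = 2
    · exfalso
      have s1 : G.DStep (u, φ w) (φ w, φ w') := ⟨rfl, ha, hab, hb.ne.symm, ha2⟩
      by_cases hb2 : G.ndeg (φ w') = 2
      · have s2 : G.DStep (φ w, φ w') (φ w', u) := ⟨rfl, hab, hb.symm, ha.ne, hb2⟩
        have s3 : G.DWalk 2 (u, φ w) (φ w', u) := ⟨_, s1, _, s2, rfl⟩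
        have := congrArg Prod.snd (s3.unique_end (by simp [hu3]) h3 (by simp [hw3])).2
        exact hw.ne this
      · have e1 := congrArg Prod.snd (s1.dWalk.unique_end hb2 h3 (by simp [hw3])).2
        have s0 : G.DWalk 0 (u, φ w') (u, φ w') := rfl
        have e2 := congrArg Prod.snd (s0.unique_end hb2 h3' (by simp [hw3'])).2
        have e3 : w = w' := e1.symm.trans e2
        exact hab.ne (by rw [e3])
    · have s0 : G.DWalk 0 (u, φ w) (u, φ w) := rfl
      have e2 : φ w = w := congrArg Prod.snd (s0.unique_end ha2 h3 (by simp [hw3])).2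
      rw [e2, hw3]
  obtain ⟨a, b, ha, hb, hab⟩ := hG.tri u hu3
  exact ⟨a, b, ha, hb, hab, hu3, key a b ha hb hab, key b a hb ha hab.symm⟩

theorem nbr_of_three [Finite V] {H : SimpleGraph V} {v x y z : V} (hv : H.ndeg v ≤ 3)
    (hx : H.Adj v x) (hy : H.Adj v y) (hz : H.Adj v z) (hxy : x ≠ y) (hxz : x ≠ z) (hyz : y ≠ z) :
    H.ndeg v = 3 ∧ ∀ w, H.Adj v w → w = x ∨ w = y ∨ w = z := by
  have h3 : ({x, y, z} : Set V).ncard = 3 := Set.ncard_eq_three.2 ⟨x, y, z, hxy, hxz, hyz, rfl⟩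
  have h : ({x, y, z} : Set V) = H.neighborSet v := by
    refine Set.eq_of_subset_of_ncard_le ?_ (by rw [h3]; exact hv) (Set.toFinite _)
    rintro _ (rfl | rfl | rfl)
    exacts [hx, hy, hz]
  refine ⟨by rw [ndeg, ← h, h3], fun w hw => ?_⟩
  have : w ∈ ({x, y, z} : Set V) := h ▸ hw
  exact this

/-- A `K₄` of links contains a triangle of `G` and a fourth vertex linked to its corners. The
triangle of `G` at that fourth vertex shares an edge with the first one, which gives a diamond with
linked ends. The length of that link is divisible by three by `NoBad`, but not by `Tame`. -/
theorem Tame.linkGraph_triCubic [Finite V] (hG : G.Tame) (hB : G.NoBad) :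
    G.linkGraph.TriCubic := by
  have hle : ∀ v, G.linkGraph.ndeg v ≤ 3 := fun v => (linkGraph_ndeg_le v).trans (hG.ndeg_le v)
  have hdia : ∀ a b u w, G.linkGraph.Adj u w → G.Adj a b → G.Adj u a → G.Adj u b → G.Adj w a →
      G.Adj w b → False := by
    rintro a b u w ⟨h1, h2, h3, x, y, k, h4, h5⟩ hab hua hub hwa hwb
    exact hG.not_dvd u x y w k h1 h2 h3 h4 h5
      (hB u x y w k h4 h5 (Or.inr ⟨a, b, hab, hua, hub, hwa, hwb⟩))
  have htri : ∀ x y z s, G.Adj x y → G.Adj x z → G.Adj y z → G.linkGraph.Adj s x →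
      G.linkGraph.Adj s y → G.linkGraph.Adj s z → False := by
    intro x y z s hxy hxz hyz hx hy hz
    obtain ⟨h3, hn⟩ := nbr_of_three (hle s) hx hy hz hxy.ne hxz.ne hyz.ne
    obtain ⟨a, b, ha, hb, hab, h4, h5, h6⟩ := hG.exists_triangle_of_linkGraph_ndeg h3
    rcases hn a (linkGraph_adj_of_adj ha h4 h5) with rfl | rfl | rfl <;>
      rcases hn b (linkGraph_adj_of_adj hb h4 h6) with rfl | rfl | rfl
    · exact hab.ne rfl
    · exact hdia _ _ _ _ hz hab ha hb hxz.symm hyz.symm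
    · exact hdia _ _ _ _ hy hab ha hb hxy.symm hyz
    · exact hdia _ _ _ _ hz hab ha hb hyz.symm hxz.symm
    · exact hab.ne rfl
    · exact hdia _ _ _ _ hx hab ha hb hxy hxz
    · exact hdia _ _ _ _ hy hab ha hb hyz hxy.symm
    · exact hdia _ _ _ _ hx hab ha hb hxz hxy
    · exact hab.ne rfl
  refine ⟨hle, fun v hv => ?_, fun p q r s h1 h2 h3 h4 h5 h6 => ?_⟩
  · obtain ⟨a, b, ha, hb, hab, h4, h5, h6⟩ := hG.exists_triangle_of_linkGraph_ndeg hv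
    exact ⟨a, b, linkGraph_adj_of_adj ha h4 h5, linkGraph_adj_of_adj hb h4 h6,
      linkGraph_adj_of_adj hab h5 h6⟩
  · obtain ⟨h7, hn⟩ := nbr_of_three (hle p) h1 h2 h3 h4.ne h5.ne h6.ne
    obtain ⟨a, b, ha, hb, hab, e4, e5, e6⟩ := hG.exists_triangle_of_linkGraph_ndeg h7
    rcases hn a (linkGraph_adj_of_adj ha e4 e5) with rfl | rfl | rfl <;>
      rcases hn b (linkGraph_adj_of_adj hb e4 e6) with rfl | rfl | rfl
    · exact hab.ne rfl
    · exact htri _ _ _ s ha hb hab h3.symm h5.symm h6.symm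
    · exact htri _ _ _ r ha hb hab h2.symm h4.symm h6
    · exact htri _ _ _ s ha hb hab h3.symm h6.symm h5.symm
    · exact hab.ne rfl
    · exact htri _ _ _ q ha hb hab h1.symm h4 h5
    · exact htri _ _ _ r ha hb hab h2.symm h6 h4.symm
    · exact htri _ _ _ q ha hb hab h1.symm h5 h4
    · exact hab.ne rfl

end SimpleGraph

end

/-! ### Orienting the walks and extending the colouring -/

section

open Function

namespace SimpleGraph

variable {V : Type} {G : SimpleGraph V}

theorem DWalk.split {k m : ℕ} {d f : V × V} (h : G.DWalk (k + m) d f) :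
    ∃ e, G.DWalk k d e ∧ G.DWalk m e f := by
  induction k generalizing d with
  | zero => exact ⟨d, rfl, by simpa using h⟩
  | succ k ih =>
    rw [Nat.succ_add] at h
    obtain ⟨d', h1, h2⟩ := h
    obtain ⟨e, h3, h4⟩ := ih h2
    exact ⟨e, ⟨d', h1, h3⟩, h4⟩

theorem DWalk.comparable {k l : ℕ} {d e f : V × V} (h : G.DWalk k d e) (h' : G.DWalk l d f) :
    (∃ m, G.DWalk m e f) ∨ ∃ m, G.DWalk m f e := by
  rcases le_total k l with hkl | hkl
  · obtain ⟨m, rfl⟩ := Nat.exists_eq_add_of_le hkl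
    obtain ⟨e', h1, h2⟩ := h'.split
    cases h.unique h1
    exact Or.inl ⟨m, h2⟩
  · obtain ⟨m, rfl⟩ := Nat.exists_eq_add_of_le hkl
    obtain ⟨e', h1, h2⟩ := h.split
    cases h'.unique h1
    exact Or.inr ⟨m, h2⟩

/-- Steps are deterministic forwards and backwards, so a class of directed edges is a single line or
cycle, in which any two elements are comparable. -/
theorem exists_dWalk_of_eqvGen {d e : V × V} (h : Relation.EqvGen G.DStep d e) :
    (∃ m, G.DWalk m d e) ∨ ∃ m, G.DWalk m e d := by
  induction h with
  | rel d e h => exact Or.inl ⟨1, h.dWalk⟩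
  | refl d => exact Or.inl ⟨0, rfl⟩
  | symm d e _ ih => exact ih.symm
  | trans d e f _ _ ih ih' =>
    rcases ih with ⟨k, h⟩ | ⟨k, h⟩ <;> rcases ih' with ⟨l, h'⟩ | ⟨l, h'⟩
    · exact Or.inl ⟨_, h.trans h'⟩
    · rcases h.swap.comparable h'.swap with ⟨m, h⟩ | ⟨m, h⟩
      · exact Or.inr ⟨m, h.swap⟩
      · exact Or.inl ⟨m, h.swap⟩
    · exact h.comparable h'
    · exact Or.inr ⟨_, h'.trans h⟩

/-- Otherwise some walk would reverse itself. This is what allows a direction to be chosen for whole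
classes at once. -/
theorem quot_dStep_ne {d : V × V} (hd : G.Adj d.1 d.2) :
    Quot.mk G.DStep d ≠ Quot.mk G.DStep d.swap := by
  intro h
  rcases exists_dWalk_of_eqvGen (Quot.eqvGen_exact h) with ⟨m, h⟩ | ⟨m, h⟩
  · exact not_dWalk_swap hd h
  · exact not_dWalk_swap (d := d.swap) hd.symm (by simpa using h)

/-- The directed edge has to be directed forwards, given the colours of the vertices of degree
three. -/
def MustPos (G : SimpleGraph V) (c : V → ZMod 3) (d : V × V) : Prop :=
  ∃ e₁ x y e₂ i j, G.ndeg e₁ = 3 ∧ G.DWalk i (e₁, x) d ∧ G.DWalk j d (y, e₂) ∧ G.ndeg e₂ ≠ 2 ∧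
    (G.ndeg e₂ = 3 → e₁ ≠ e₂ ∧ c e₂ = c e₁ + (i + j + 1 : ℕ))

/-- The condition concerns the whole maximal walk through `d`; a step only moves one unit from `j`
to `i`. The walk cannot start or end in the middle of a step, because the vertex there has degree
two. -/
theorem mustPos_iff_of_dStep {c : V → ZMod 3} {d d' : V × V} (h : G.DStep d d') :
    G.MustPos c d ↔ G.MustPos c d' := by
  constructor
  · rintro ⟨e₁, x, y, e₂, i, j, h1, h2, h3, h4, h5⟩
    cases j with
    | zero =>
      cases h3
      exact absurd h.ndeg_eq h4
    | succ j =>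
      obtain ⟨d'', h6, h7⟩ := h3
      cases h.unique h6
      refine ⟨e₁, x, y, e₂, i + 1, j, h1, h2.snoc h, h7, h4, fun h8 => ?_⟩
      rw [show i + 1 + j + 1 = i + (j + 1) + 1 by ring]
      exact h5 h8
  · rintro ⟨e₁, x, y, e₂, i, j, h1, h2, h3, h4, h5⟩
    cases i with
    | zero =>
      cases h2
      have := h.ndeg_eq
      rw [← h.1, h1] at this
      omega
    | succ i =>
      obtain ⟨d'', h6, h7⟩ := h2.exists_snoc
      cases h.unique_left h7
      refine ⟨e₁, x, y, e₂, i, j + 1, h1, h6, ⟨_, h, h3⟩, h4, fun h8 => ?_⟩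
      rw [show i + (j + 1) + 1 = i + 1 + j + 1 by ring]
      exact h5 h8

theorem zmod_three_add : ∀ a b m : ZMod 3, b = a + m → a = b + m → a = b := by decide

/-- Both conditions would describe the same walk from its two ends, each of degree three: with `m`
its length, `c e₂ = c e₁ + m` and `c e₁ = c e₂ + m`. Then `2m = 0`, and the linked ends would have
the same colour. -/
theorem not_mustPos_swap {c : V → ZMod 3} (hc : ∀ u w, G.linkGraph.Adj u w → c u ≠ c w)
    {d : V × V} (hd : G.Adj d.1 d.2) (h : G.MustPos c d) : ¬ G.MustPos c d.swap := by
  rintro ⟨e₁', x', y', e₂', i', j', h1', h2', h3', h4', h5'⟩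
  obtain ⟨e₁, x, y, e₂, i, j, h1, h2, h3, h4, h5⟩ := h
  have h6 := h2'.swap
  rw [Prod.swap_swap] at h6
  obtain ⟨rfl, h7⟩ := h3.unique_end h4 h6 (by simp [h1'])
  obtain ⟨rfl, h8⟩ := h3'.unique_end h4' h2.swap (by simp [h1])
  have e1 : e₂ = e₁' := congrArg Prod.snd h7
  have e2 : e₂' = e₁ := congrArg Prod.snd h8
  subst e1 e2
  obtain ⟨h9, h10⟩ := h5 h1'
  obtain ⟨-, h11⟩ := h5' h1
  rw [add_comm j j'] at h11
  have hadj : G.Adj e₂' x := (h2.swap.adj hd.symm).symm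
  exact hc e₂' e₂ ⟨h9, h1, h1', x, y, _, hadj, h2.trans h3⟩ (zmod_three_add _ _ _ h10 h11)

/-- An orientation of the edges that is constant along walks through vertices of degree two. -/
structure IsOrientation (G : SimpleGraph V) (P : V × V → Prop) : Prop where
  step : ∀ d e, G.DStep d e → (P d ↔ P e)
  swap : ∀ u v, G.Adj u v → (P (v, u) ↔ ¬ P (u, v))

/-- The forced directions never conflict. All other walks are directed by comparing the classes of
their two directions in an arbitrary well-order, which makes the choice constant along steps. -/
theorem exists_isOrientation {c : V → ZMod 3} (hc : ∀ u w, G.linkGraph.Adj u w → c u ≠ c w) :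
    ∃ P, G.IsOrientation P ∧ ∀ d, G.MustPos c d → P d := by
  refine ⟨fun d => G.MustPos c d ∨ ¬ G.MustPos c d.swap ∧
    WellOrderingRel (Quot.mk G.DStep d) (Quot.mk G.DStep d.swap), ⟨fun d e h => ?_, fun u v h => ?_⟩,
    fun d hd => Or.inl hd⟩
  · rw [mustPos_iff_of_dStep h, ← mustPos_iff_of_dStep h.swap, Quot.sound h, Quot.sound h.swap]
  · have h1 := not_mustPos_swap hc (d := (u, v)) h
    have h2 := not_mustPos_swap hc (d := (v, u)) h.symm
    have h3 := quot_dStep_ne (d := (u, v)) h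
    simp only [Prod.swap_prod_mk] at h1 h2 h3 ⊢
    have h4 := asymm_of (WellOrderingRel (α := Quot G.DStep)) (a := Quot.mk _ (u, v))
      (b := Quot.mk _ (v, u))
    have h5 := trichotomous_of (WellOrderingRel (α := Quot G.DStep)) (Quot.mk _ (u, v))
      (Quot.mk _ (v, u))
    tauto

/-- The predecessor of a vertex that is not of degree three, if it exists. -/
noncomputable def pred (G : SimpleGraph V) (P : V × V → Prop) (v : V) : V :=
  open Classical in
  if h : G.ndeg v ≠ 3 ∧ ∃ u, G.Adj u v ∧ P (u, v) then h.2.choose else v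

section Orientation

variable {P : V × V → Prop}

theorem pred_of_ndeg_three {v : V} (hv : G.ndeg v = 3) : G.pred P v = v := by
  simp [pred, hv]

theorem pred_spec {v : V} (hv : G.pred P v ≠ v) :
    G.ndeg v ≠ 3 ∧ G.Adj (G.pred P v) v ∧ P (G.pred P v, v) := by
  unfold pred at hv ⊢
  split_ifs at hv ⊢ with h
  · exact ⟨h.1, h.2.choose_spec⟩
  · exact absurd rfl hv

theorem pred_ne_of_pos {u v : V} (hv : G.ndeg v ≠ 3) (huv : G.Adj u v) (hP : P (u, v)) :
    G.pred P v ≠ v := by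
  have h : G.ndeg v ≠ 3 ∧ ∃ u, G.Adj u v ∧ P (u, v) := ⟨hv, u, huv, hP⟩
  rw [pred, dif_pos h]
  exact h.2.choose_spec.1.ne

theorem ndeg_eq_two_of_pair [Finite V] (hG : G.Tame) {v a b : V} (hv : G.ndeg v ≠ 3)
    (ha : G.Adj v a) (hb : G.Adj v b) (hab : a ≠ b) : G.ndeg v = 2 := by
  have h1 := hG.ndeg_le v
  have h2 : ({a, b} : Set V).ncard ≤ G.ndeg v := by
    refine Set.ncard_le_ncard ?_ (Set.toFinite _)
    rintro _ (rfl | rfl)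
    exacts [ha, hb]
  rw [Set.ncard_pair hab] at h2
  omega

namespace IsOrientation

/-- A second edge pointing into `v` would give `v` degree two, and the orientation would then have
to continue from one of the two edges outwards along the other. -/
theorem pred_eq [Finite V] (hP : G.IsOrientation P) (hG : G.Tame) {u v : V} (hv : G.ndeg v ≠ 3)
    (huv : G.Adj u v) (h : P (u, v)) : G.pred P v = u := by
  obtain ⟨-, h2, h3⟩ := pred_spec (pred_ne_of_pos hv huv h)
  by_contra hne
  have h4 := ndeg_eq_two_of_pair hG hv huv.symm h2.symm (Ne.symm hne)
  have h5 : G.DStep (u, v) (v, G.pred P v) := ⟨rfl, huv, h2.symm, hne, h4⟩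
  exact (hP.swap _ _ h2).1 ((hP.step _ _ h5).1 h) h3

theorem out_unique (hP : G.IsOrientation P) {p a b : V} (hp : G.ndeg p = 2) (ha : G.Adj p a)
    (hb : G.Adj p b) (hPa : P (p, a)) (hPb : P (p, b)) : a = b := by
  by_contra hne
  have h5 : G.DStep (a, p) (p, b) := ⟨rfl, ha.symm, hb, Ne.symm hne, hp⟩
  exact (hP.swap _ _ ha).1 ((hP.step _ _ h5).2 hPb) hPa

theorem pred_ne_of_ndeg_two (hP : G.IsOrientation P) {v : V} (hv : G.ndeg v = 2) :
    G.pred P v ≠ v := by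
  obtain ⟨a, ha, -⟩ := exists_other_of_ndeg_two hv v
  obtain ⟨b, hb, hne⟩ := exists_other_of_ndeg_two hv a
  by_cases h : P (a, v)
  · exact pred_ne_of_pos (by omega) ha.symm h
  · have h5 : G.DStep (b, v) (v, a) := ⟨rfl, hb.symm, ha, hne.symm, hv⟩
    exact pred_ne_of_pos (by omega) hb.symm ((hP.step _ _ h5).2 ((hP.swap _ _ ha.symm).2 h))

theorem dStep_pred [Finite V] (hP : G.IsOrientation P) (hG : G.Tame) {u v : V} (huv : G.Adj u v)
    (h : P (u, v)) (hu : G.pred P u ≠ u) : G.DStep (G.pred P u, u) (u, v) := by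
  obtain ⟨h1, h2, h3⟩ := pred_spec hu
  have hne : v ≠ G.pred P u := by
    intro he
    rw [← he] at h3
    exact (hP.swap _ _ huv).1 h3 h
  exact ⟨rfl, h2, huv, hne, ndeg_eq_two_of_pair hG h1 huv h2.symm hne⟩

theorem exists_dWalk_pred [Finite V] (hP : G.IsOrientation P) (hG : G.Tame) :
    ∀ (k : ℕ) {u v : V}, G.Adj u v → P (u, v) →
      (∀ i < k, G.pred P ((G.pred P)^[i] u) ≠ (G.pred P)^[i] u) →
      ∃ x, G.Adj ((G.pred P)^[k] u) x ∧ G.DWalk k ((G.pred P)^[k] u, x) (u, v) := by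
  intro k
  induction k with
  | zero => exact fun huv _ _ => ⟨_, huv, rfl⟩
  | succ k ih =>
    intro u v huv h hk
    have hu : G.pred P u ≠ u := hk 0 (by omega)
    obtain ⟨x, hx, hw⟩ := ih (pred_spec hu).2.1 (pred_spec hu).2.2 (fun i hi => by
      have := hk (i + 1) (by omega)
      rwa [iterate_succ_apply] at this)
    exact ⟨x, hx, hw.snoc (hP.dStep_pred hG huv h hu)⟩

end IsOrientation

/-- The predecessors of the vertex never stop. -/
def Endless (G : SimpleGraph V) (P : V × V → Prop) (v : V) : Prop :=
  ∀ k, G.pred P ((G.pred P)^[k] v) ≠ (G.pred P)^[k] v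

theorem Endless.pred {v : V} (h : G.Endless P v) : G.Endless P (G.pred P v) := fun k => by
  have := h (k + 1)
  rwa [iterate_succ_apply] at this

theorem Endless.iterate {v : V} (h : G.Endless P v) (k : ℕ) : G.Endless P ((G.pred P)^[k] v) :=
  fun i => by
    have := h (i + k)
    rwa [iterate_add_apply] at this

/-- On endless vertices `pred` is injective: a common predecessor has degree two and thus a single
outgoing edge. An injective self-map of a finite set has only periodic points. -/
theorem IsOrientation.periodic [Finite V] (hP : G.IsOrientation P) (hG : G.Tame) {v : V}
    (hv : G.Endless P v) : ∃ m, 0 < m ∧ (G.pred P)^[m] v = v := by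
  have hmaps : Set.MapsTo (G.pred P) {v | G.Endless P v} {v | G.Endless P v} := fun v hv => hv.pred
  have hinj : Injective (hmaps.restrict (G.pred P) _ _) := by
    rintro ⟨a, ha⟩ ⟨b, hb⟩ h
    have h1 : G.pred P a = G.pred P b := congrArg Subtype.val h
    have ha' := pred_spec (ha 0)
    have hb' := pred_spec (hb 0)
    simp only [iterate_zero, id] at ha' hb'
    have h2 := (hP.dStep_pred hG ha'.2.1 ha'.2.2 (ha 1)).ndeg_eq
    rw [← h1] at hb'
    exact Subtype.ext (hP.out_unique h2 ha'.2.1 hb'.2.1 ha'.2.2 hb'.2.2)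
  obtain ⟨m, hm, h⟩ := hinj.mem_periodicPts ⟨v, hv⟩
  refine ⟨m, hm, ?_⟩
  have := congrArg Subtype.val h
  rwa [hmaps.iterate_restrict] at this

/-- The vertices at which the colouring starts. -/
def IsRoot (G : SimpleGraph V) (P : V × V → Prop) (o : V → ℕ) (r : V) : Prop :=
  G.pred P r = r ∨ G.Endless P r ∧ ∀ k, o r ≤ o ((G.pred P)^[k] r)

theorem exists_isRoot (G : SimpleGraph V) (P : V × V → Prop) (o : V → ℕ) (v : V) :
    ∃ k, G.IsRoot P o ((G.pred P)^[k] v) := by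
  by_cases h : G.Endless P v
  -- On a directed cycle, minimising `o` over the backward orbit singles out the root.
  · obtain ⟨k, hk⟩ := Nat.sInf_mem (Set.range_nonempty fun k => o ((G.pred P)^[k] v))
    refine ⟨k, Or.inr ⟨h.iterate k, fun i => ?_⟩⟩
    rw [← iterate_add_apply]
    simp only at hk
    rw [hk]
    exact Nat.sInf_le ⟨_, rfl⟩
  · unfold Endless at h
    push Not at h
    obtain ⟨k, hk⟩ := h
    exact ⟨k, Or.inl hk⟩

open Classical in
/-- The distance to the root. -/
noncomputable def depth (G : SimpleGraph V) (P : V × V → Prop) (o : V → ℕ) (v : V) : ℕ :=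
  Nat.find (exists_isRoot G P o v)

/-- Extend a colouring of the roots. -/
noncomputable def extendColoring (G : SimpleGraph V) (P : V × V → Prop) (o : V → ℕ)
    (c : V → ZMod 3) (v : V) : ZMod 3 :=
  c ((G.pred P)^[G.depth P o v] v) + G.depth P o v

theorem extendColoring_of_isRoot {o : V → ℕ} {c : V → ZMod 3} {v : V} (h : G.IsRoot P o v) :
    G.extendColoring P o c v = c v := by
  classical
  have : G.depth P o v = 0 := (Nat.find_eq_zero _).2 h
  simp [extendColoring, this]

theorem extendColoring_of_not_isRoot {o : V → ℕ} {c : V → ZMod 3} {v : V}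
    (h : ¬ G.IsRoot P o v) :
    G.extendColoring P o c v = G.extendColoring P o c (G.pred P v) + 1 := by
  classical
  have : G.depth P o v = G.depth P o (G.pred P v) + 1 := by
    unfold depth
    rw [Nat.find_eq_iff]
    constructor
    · rw [iterate_succ_apply]
      exact Nat.find_spec (exists_isRoot G P o (G.pred P v))
    · intro n hn
      cases n with
      | zero => exact h
      | succ n =>
        rw [iterate_succ_apply]
        exact Nat.find_min (exists_isRoot G P o (G.pred P v)) (by omega)
  simp only [extendColoring, this, iterate_succ_apply]
  push_cast
  ring

theorem zmod_three_link : ∀ a b m : ZMod 3, a ≠ b → m ≠ 0 → b = a + m ∨ a = b + m := by decide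

/-- Away from roots this is the recursion for the depth. If `v` is itself a root, the way back from
`u` to its root together with the edge to `v` is a walk of length `depth + 1`, and this must match
the colours of the two roots: on a closed walk by `NoBad`, on a link by the choice of orientation.
-/
theorem extendColoring_of_pos [Finite V] (hP : G.IsOrientation P) (hG : G.Tame) (hB : G.NoBad) {o : V → ℕ}
    (ho : Injective o) {c : V → ZMod 3} (hc : ∀ u w, G.linkGraph.Adj u w → c u ≠ c w)
    (hM : ∀ d, G.MustPos c d → P d) {u v : V} (huv : G.Adj u v) (h : P (u, v)) :
    G.extendColoring P o c v = G.extendColoring P o c u + 1 := by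
  classical
  have hmin : ∀ i < G.depth P o u, ¬ G.IsRoot P o ((G.pred P)^[i] u) := fun i hi =>
    Nat.find_min (exists_isRoot G P o u) hi
  have hroot : G.IsRoot P o ((G.pred P)^[G.depth P o u] u) :=
    Nat.find_spec (exists_isRoot G P o u)
  obtain ⟨x, hx, hw⟩ := hP.exists_dWalk_pred hG (G.depth P o u) huv h
    (fun i hi h => hmin i hi (Or.inl h))
  have hu : G.extendColoring P o c u + 1 =
      c ((G.pred P)^[G.depth P o u] u) + (G.depth P o u + 1 : ℕ) := by
    rw [extendColoring]
    push_cast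
    ring
  by_cases hv : G.ndeg v = 3
  · rw [extendColoring_of_isRoot (Or.inl (pred_of_ndeg_three hv)), hu]
    have hnot : ¬ G.MustPos c (v, u) := fun h' => (hP.swap _ _ huv).1 (hM _ h') h
    generalize hk : G.depth P o u = k at *
    generalize hr : (G.pred P)^[k] u = r at *
    rcases hroot with hroot | ⟨hroot, -⟩
    · by_cases hr3 : G.ndeg r = 3
      · by_cases hrv : r = v
        · subst hrv
          have := (ZMod.natCast_eq_zero_iff _ 3).2 (hB _ _ _ _ k hx hw (Or.inl rfl))
          rw [this, add_zero]
        -- The end colours differ and the length is not divisible by three, so the colours differ by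
        -- plus or minus the length; minus would have forced the opposite direction.
        · have h1 := hc r v ⟨hrv, hr3, hv, x, u, k, hx, hw⟩
          have h2 : ((k + 1 : ℕ) : ZMod 3) ≠ 0 := fun h => hG.not_dvd r x u v k hrv hr3 hv hx hw
            ((ZMod.natCast_eq_zero_iff _ 3).1 h)
          rcases zmod_three_link _ _ _ h1 h2 with h3 | h3
          · exact h3
          · refine absurd ⟨v, u, x, r, 0, k, hv, rfl, hw.swap, by omega, fun _ => ⟨Ne.symm hrv, ?_⟩⟩
              hnot
            rwa [Nat.zero_add]
      -- A walk from `v` to an end of degree neither two nor three is forced to lead away from `v`.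
      · have hr2 : G.ndeg r ≠ 2 := fun h => hP.pred_ne_of_ndeg_two h hroot
        exact absurd ⟨v, u, x, r, 0, k, hv, rfl, hw.swap, hr2, fun h => absurd h hr3⟩ hnot
    -- Here `u` lies on a directed cycle of vertices whose degree is not three. Its only outgoing
    -- edge stays on the cycle and so cannot lead to `v`.
    · have hend : G.Endless P u := by
        intro i
        rcases lt_or_ge i k with hi | hi
        · exact fun h => hmin i hi (Or.inl h)
        · obtain ⟨j, rfl⟩ := Nat.exists_eq_add_of_le hi
          rw [add_comm, iterate_add_apply, hr]
          exact hroot j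
      obtain ⟨m, hm, hper⟩ := hP.periodic hG hend
      obtain ⟨m, rfl⟩ : ∃ m', m = m' + 1 := ⟨m - 1, by omega⟩
      rw [iterate_succ_apply'] at hper
      have h1 := pred_spec (hend m)
      rw [hper] at h1
      have h2 := (hP.dStep_pred hG huv h (hend 0)).ndeg_eq
      have h3 := hP.out_unique h2 huv h1.2.1 h h1.2.2
      exact absurd (h3 ▸ hv) h1.1
  · have hpu := hP.pred_eq hG hv huv h
    by_cases hr : G.IsRoot P o v
    · rw [extendColoring_of_isRoot hr, hu]
      rcases hr with hr | ⟨hend, hr⟩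
      · exact absurd (hpu.symm.trans hr) huv.ne
      · generalize hk : G.depth P o u = k at *
        have e1 : (G.pred P)^[k] u = (G.pred P)^[k + 1] v := by rw [iterate_succ_apply, hpu]
        rw [e1] at hroot hx hw ⊢
        -- Both are roots on the same directed cycle, so each minimises `o` there and injectivity
        -- identifies them. A multiple of the period that is at least `k + 1` shows that `v` is in
        -- the backward orbit of the other root.
        have e2 : (G.pred P)^[k + 1] v = v := by
          rcases hroot with hroot | ⟨-, hroot⟩
          · exact absurd hroot (hend _)
          · refine ho (le_antisymm ?_ (hr _))
            obtain ⟨m, hm, hper⟩ := hP.periodic hG hend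
            have h1 : (G.pred P)^[m * (k + 1)] v = v :=
              (show IsPeriodicPt (G.pred P) m v from hper).mul_const (k + 1)
            have h2 : m * (k + 1) = (m - 1) * (k + 1) + (k + 1) := by
              obtain ⟨m, rfl⟩ : ∃ m', m = m' + 1 := ⟨m - 1, by omega⟩
              simp
              ring
            rw [h2, iterate_add_apply] at h1
            have := hroot ((m - 1) * (k + 1))
            rwa [h1] at this
        rw [e2] at hx hw ⊢
        have := (ZMod.natCast_eq_zero_iff _ 3).2 (hB _ _ _ _ k hx hw (Or.inl rfl))
        rw [this, add_zero]
    · rw [extendColoring_of_not_isRoot hr, hpu]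

end Orientation

theorem zmod_three_ne : ∀ a : ZMod 3, a ≠ a + 1 ∧ a ≠ a + 1 + 1 := by decide

/-- The colour rises by one along each oriented edge. At a vertex of degree two one edge comes in
and one goes out, so the two neighbours differ by `2`. -/
theorem Tame.exists_isDyn [Finite V] (hG : G.Tame) (hB : G.NoBad) :
    ∃ c : V → ZMod 3, G.IsDyn c := by
  obtain ⟨c, hc⟩ := (hG.linkGraph_triCubic hB).exists_coloring
  obtain ⟨P, hP, hM⟩ := exists_isOrientation hc
  obtain ⟨o, ho⟩ := Countable.exists_injective_nat V
  have key : ∀ u v, G.Adj u v → P (u, v) →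
      G.extendColoring P o c v = G.extendColoring P o c u + 1 :=
    fun u v huv h => extendColoring_of_pos hP hG hB ho hc hM huv h
  refine ⟨G.extendColoring P o c, fun u v huv => ?_, fun v u w hv hu hw hne => ?_⟩
  · by_cases h : P (u, v)
    · rw [key u v huv h]
      exact (zmod_three_ne _).1
    · rw [key v u huv.symm ((hP.swap _ _ huv).2 h)]
      exact (zmod_three_ne _).1.symm
  · by_cases h : P (u, v)
    · have h1 : P (v, w) := (hP.step _ _ (⟨rfl, hu.symm, hw, hne.symm, hv⟩ : G.DStep (u, v) (v, w))).1 h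
      rw [key v w hw h1, key u v hu.symm h]
      exact (zmod_three_ne _).2
    · have h2 := (hP.swap _ _ hu.symm).2 h
      have h1 : P (w, v) := (hP.step _ _ (⟨rfl, hw.symm, hu, hne, hv⟩ : G.DStep (w, v) (v, u))).2 h2
      rw [key v u hu h2, key w v hw.symm h1]
      exact (zmod_three_ne _).2.symm

theorem InClassC.dynamicChromaticNumber_le_iff_noBad [Fintype V] (h : InClassC G) :
    dynamicChromaticNumber G ≤ 3 ↔ G.NoBad := by
  rw [dynamicChromaticNumber_le_iff (InClassC.tame h).ndeg_le (InClassC.tame h).tri]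
  exact ⟨fun ⟨_, hc⟩ => hc.noBad, fun hB => (InClassC.tame h).exists_isDyn hB⟩

end SimpleGraph

end

/-! ### Bounded search for violations, matrix entries and rules for loops -/

section

open Turing Function

namespace SimpleGraph

variable {V : Type} {G : SimpleGraph V}

/-- Walks through vertices of degree two can be shortened without changing the residue of their
length modulo three. -/
theorem DWalk.exists_lt [Fintype V] {k : ℕ} {d f : V × V} (h : G.DWalk k d f) :
    ∃ k' < 3 * (Fintype.card V * Fintype.card V), G.DWalk k' d f ∧ (k' : ZMod 3) = k := by
  induction k using Nat.strong_induction_on with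
  | _ k ih =>
  by_cases hk : k < 3 * (Fintype.card V * Fintype.card V)
  · exact ⟨k, hk, h, rfl⟩
  have hs : ∀ i : Fin (k + 1), ∃ e, G.DWalk i d e ∧ G.DWalk (k - i) e f := fun i =>
    DWalk.split (by rwa [Nat.add_sub_cancel' (Nat.le_of_lt_succ i.2)])
  choose e he1 he2 using hs
  -- Pigeonhole: the `k + 1` stages outnumber the pairs of a directed edge and a residue modulo
  -- three. The part between two equal stages is cut out.
  obtain ⟨i, j, hij, hne⟩ : ∃ i j : Fin (k + 1), (e i, ((i : ℕ) : ZMod 3)) = (e j, ((j : ℕ) : ZMod 3)) ∧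
      i < j := by
    obtain ⟨i, j, hij, h⟩ := Fintype.exists_ne_map_eq_of_card_lt
      (fun i : Fin (k + 1) => (e i, ((i : ℕ) : ZMod 3))) (by
        simp only [Fintype.card_prod, ZMod.card, Fintype.card_fin]
        omega)
    rcases lt_or_gt_of_ne hij with h' | h'
    · exact ⟨i, j, h, h'⟩
    · exact ⟨j, i, h.symm, h'⟩
  simp only [Prod.mk.injEq] at hij
  have hj := j.2
  have hlt : (i : ℕ) < j := hne
  obtain ⟨k', h1, h2, h3⟩ := ih (i + (k - j)) (by omega) ((he1 i).trans (hij.1 ▸ he2 j))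
  refine ⟨k', h1, h2, h3.trans ?_⟩
  rw [Nat.cast_add, hij.2, ← Nat.cast_add, Nat.add_sub_cancel' (Nat.le_of_lt_succ j.2)]

/-- The directed edge is the start of a walk that violates `NoBad` and has bounded length. -/
def Violates (G : SimpleGraph V) (T : ℕ) (u v : V) : Prop :=
  ∃ k < T, ∃ y w, G.DWalk k (u, v) (y, w) ∧ G.Same u w ∧ ¬ 3 ∣ k + 1

theorem not_noBad_iff [Fintype V] :
    ¬ G.NoBad ↔ ∃ u v, G.Adj u v ∧ G.Violates (3 * (Fintype.card V * Fintype.card V)) u v := by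
  constructor
  · intro h
    unfold NoBad at h
    push Not at h
    obtain ⟨u, x, y, w, k, h1, h2, h3, h4⟩ := h
    obtain ⟨k', h5, h6, h7⟩ := h2.exists_lt
    refine ⟨u, x, h1, k', h5, y, w, h6, h3, fun h8 => h4 ?_⟩
    rw [← ZMod.natCast_eq_zero_iff] at h8 ⊢
    rw [← h8]
    push_cast
    rw [h7]
  · rintro ⟨u, v, h1, k, -, y, w, h2, h3, h4⟩ h
    exact h4 (h _ _ _ _ _ h1 h2 h3)

theorem DWalk.ndeg_eq_two_of_lt {k m : ℕ} {d e f : V × V} (h : G.DWalk k d e) (h' : G.DWalk m d f)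
    (hkm : k < m) : G.ndeg e.2 = 2 := by
  obtain ⟨m, rfl⟩ : ∃ j, m = k + (j + 1) := ⟨m - k - 1, by omega⟩
  obtain ⟨e', h1, e'', h2, -⟩ := h'.split
  rw [h.unique h1]
  exact h2.ndeg_eq

end SimpleGraph

namespace RegState

open GProg

theorem iterate_rowRest_flatMap (r : List (List Bool)) (a : ℕ) :
    rowRest^[a] (r.flatMap fun x => x.map some ++ [none]) =
      (r.drop a).flatMap fun x => x.map some ++ [none] := by
  induction a generalizing r with
  | zero => rfl
  | succ a ih =>
    rw [iterate_succ_apply]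
    cases r with
    | nil => simpa [rowRest] using ih []
    | cons x r =>
      rw [List.flatMap_cons, List.append_assoc, List.singleton_append, rowRest_map_some, ih]
      rfl

theorem lookup_encodeGraph {n : ℕ} (G : SimpleGraph (Fin n)) (i j : Fin n) :
    lookup (encodeGraph ⟨n, G⟩) i j = true ↔ G.Adj i j := by
  classical
  have h : encodeGraph ⟨n, G⟩ = ((List.finRange n).map fun i =>
      (List.finRange n).map fun j => decide (G.Adj i j)).flatMap fun x => x.map some ++ [none] := by
    simp only [encodeGraph, List.flatMap_map, List.map_map, comp_def]
  have ht : ∀ (b : ℕ) (l : List (Option Bool)), List.tail^[b] l = l.drop b := by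
    intro b
    induction b with
    | zero => exact fun _ => rfl
    | succ b ih =>
      intro l
      rw [iterate_succ_apply, ih]
      simp
  rw [lookup, decide_eq_true_iff, h, iterate_rowRest_flatMap, ht,
    List.drop_eq_getElem_cons (i := i) (by simp), List.flatMap_cons, List.head?_drop,
    List.append_assoc, List.getElem?_append_left (by simp)]
  simp

/-- The transformation does not change the register `r`. -/
def Keeps (r : Fin 10) (f : Transf) : Prop := ∀ l h, (f l h).reg r = h.reg r

theorem Keeps.andThen {r : Fin 10} {f g : Transf} (hf : Keeps r f) (hg : Keeps r g) :
    Keeps r (andThen f g) := fun l h => (hg l _).trans (hf l h)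

theorem Keeps.when {r : Fin 10} {f : Transf} (hf : Keeps r f) (b : Flags → Bool) :
    Keeps r (when b f) := fun l h => by
  unfold RegState.when
  split_ifs
  exacts [hf l h, rfl]

theorem keeps_setFlags (r : Fin 10) (φ : Flags → Flags) : Keeps r (setFlags φ) := fun _ _ => rfl

theorem keeps_eqReg (r i j : Fin 10) : Keeps r (eqReg i j) := fun _ _ => rfl

theorem keeps_adjReg (r i j : Fin 10) : Keeps r (adjReg i j) := fun _ _ => rfl

theorem keeps_copyReg {r i : Fin 10} (hr : r ≠ i) (j : Fin 10) : Keeps r (copyReg i j) :=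
  fun _ _ => update_of_ne hr _ _

/-- The rule for loops. -/
theorem forAll_induct {i : Fin 10} {f : Transf} {l : List (Option Bool)} {h : RegState}
    (I : ℕ → RegState → Prop) (h0 : I 0 (eqReg i 0 l ⟨h.fl, update h.reg i 0⟩))
    (hs : ∀ k < h.reg 0, ∀ g, I k g → I (k + 1) (eqReg i 0 l (incReg i l (f l g)))) :
    I (h.reg 0) (forAll i f l h) := by
  unfold forAll
  generalize h.reg 0 = n at hs
  induction n with
  | zero => exact h0
  | succ n ih =>
    rw [iterate_succ_apply']
    exact hs n (by omega) _ (ih fun k hk => hs k (by omega))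

theorem Keeps.forAll {r i : Fin 10} {f : Transf} (hf : Keeps r f) (hr : r ≠ i) :
    Keeps r (forAll i f) := fun l h => by
  refine forAll_induct (fun _ g => g.reg r = h.reg r) ?_ fun k _ g hg => ?_
  · simp [eqReg, hr]
  · simpa [eqReg, incReg, hr, hf l g] using hg

/-- The rule for loops that search for a vertex with the property `Q` and record the result in the
flag `π`, while `A` is invariant. -/
theorem forAll_exists {n : ℕ} {i : Fin 10} {f : Transf} {l : List (Option Bool)} {h : RegState}
    (A : RegState → Prop) (π : Flags → Bool) (Q : Fin n → Prop) (hn : h.reg 0 = n) (h0 : A h)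
    (hπ : ∀ φ b, π {φ with test := b} = π φ)
    (hA : ∀ g b m, A g → A ⟨{g.fl with test := b}, update g.reg i m⟩)
    (hs : ∀ (a : Fin n) g, A g → g.reg i = a → A (f l g) ∧ (f l g).reg i = a ∧
      (π (f l g).fl = true ↔ π g.fl = true ∨ Q a)) :
    A (forAll i f l h) ∧ (π (forAll i f l h).fl = true ↔ π h.fl = true ∨ ∃ a, Q a) := by
  have key := forAll_induct (i := i) (f := f) (l := l) (h := h)
    (fun k g => A g ∧ g.reg i = k ∧
      (π g.fl = true ↔ π h.fl = true ∨ ∃ a : Fin n, a.1 < k ∧ Q a)) ?_ ?_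
  · refine ⟨key.1, key.2.2.trans ?_⟩
    rw [hn]
    simp
  · refine ⟨hA _ _ _ h0, by simp [eqReg], ?_⟩
    simp only [eqReg, hπ]
    simp
  -- Each round ends by overwriting `test` and the counter, which `hA` and `hπ` make harmless.
  · rintro k hk g ⟨h1, h2, h3⟩
    rw [hn] at hk
    obtain ⟨h4, h5, h6⟩ := hs ⟨k, hk⟩ g h1 h2
    refine ⟨hA _ _ _ h4, by simp [eqReg, incReg, h5], ?_⟩
    simp only [eqReg, incReg, hπ]
    rw [h6, h3, or_assoc]
    refine or_congr_right ⟨?_, ?_⟩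
    · rintro (⟨a, ha, hq⟩ | hq)
      exacts [⟨a, by omega, hq⟩, ⟨_, Nat.lt_succ_self k, hq⟩]
    · rintro ⟨a, ha, hq⟩
      rcases Nat.lt_succ_iff_lt_or_eq.1 ha with ha | ha
      · exact Or.inl ⟨a, ha, hq⟩
      · exact Or.inr ((Fin.ext ha : a = ⟨k, hk⟩) ▸ hq)

end RegState

end

/-! ### The decision procedure and its correctness -/

section

open Turing Function

namespace RegState

open GProg

/-- Test an adjacency and add the result to a conjunction. -/
def andAdj (i j : Fin 10) : Transf :=
  andThen (adjReg i j) (setFlags fun φ => {φ with acc := φ.acc && φ.test})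

/-- Test whether registers `6` and `7` are the middle of a diamond with ends `1` and `4`. -/
def diamondTest : Transf :=
  andThen (setFlags fun φ => {φ with acc := true}) <|
  andThen (andAdj 6 7) <| andThen (andAdj 1 6) <| andThen (andAdj 1 7) <|
  andThen (andAdj 4 6) <| andThen (andAdj 4 7) <|
  setFlags fun φ => {φ with same := φ.same || φ.acc}

/-- Test whether registers `1` and `4` are equal or the ends of a diamond. -/
def sameTest : Transf :=
  andThen (eqReg 1 4) <| andThen (setFlags fun φ => {φ with same := φ.test}) <|
  forAll 6 (forAll 7 diamondTest)

/-- Take the neighbour `6` of `4` into account. -/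
def countOne : Transf :=
  andThen (adjReg 4 6) <|
  andThen (setFlags fun φ => {φ with
    acc := φ.test
    cnt := if φ.test then (if φ.cnt = 3 then 3 else φ.cnt + 1) else φ.cnt}) <|
  andThen (eqReg 6 3) <| when (fun φ => φ.acc && !φ.test) (copyReg 5 6)

/-- Count the neighbours of `4` and copy one that differs from `3` to `5`. -/
def countAll : Transf :=
  andThen (setFlags fun φ => {φ with cnt := 0}) (forAll 6 countOne)

/-- Check the current walk from `1` to the directed edge `(3, 4)`. -/
def checkWalk : Transf :=
  andThen sameTest (setFlags fun φ => {φ with bad := φ.bad || (φ.same && decide (φ.len ≠ 0))})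

/-- Continue the walk if `4` has degree two. -/
def extendWalk : Transf :=
  andThen countAll <| when (fun φ => decide (φ.cnt = 2)) <|
    andThen (copyReg 3 4) <| andThen (copyReg 4 5) (setFlags fun φ => {φ with len := φ.len + 1})

/-- Check the current walk and continue it. -/
def stepWalk : Transf := andThen checkWalk extendWalk

/-- Three steps. -/
def threeSteps : Transf := andThen stepWalk (andThen stepWalk stepWalk)

/-- Follow the walk that starts with the directed edge `(1, 2)`. -/
def followWalk : Transf :=
  andThen (copyReg 3 1) <| andThen (copyReg 4 2) <|
  andThen (setFlags fun φ => {φ with len := 1}) <| forAll 8 (forAll 9 threeSteps)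

/-- Follow the walk that starts with `(1, 2)` if these are adjacent. -/
def tryWalk : Transf := andThen (adjReg 1 2) (when Flags.test followWalk)

/-- Follow all walks. -/
def decideBad : Transf := forAll 1 (forAll 2 tryWalk)

theorem keeps_diamondTest (r : Fin 10) : Keeps r diamondTest := fun _ _ => rfl

theorem keeps_sameTest {r : Fin 10} (h6 : r ≠ 6) (h7 : r ≠ 7) : Keeps r sameTest :=
  (keeps_eqReg _ _ _).andThen <| (keeps_setFlags _ _).andThen <|
    ((keeps_diamondTest r).forAll h7).forAll h6

theorem keeps_countOne {r : Fin 10} (h5 : r ≠ 5) : Keeps r countOne :=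
  (keeps_adjReg _ _ _).andThen <| (keeps_setFlags _ _).andThen <| (keeps_eqReg _ _ _).andThen <|
    (keeps_copyReg h5 _).when _

theorem keeps_countAll {r : Fin 10} (h5 : r ≠ 5) (h6 : r ≠ 6) : Keeps r countAll :=
  (keeps_setFlags _ _).andThen ((keeps_countOne h5).forAll h6)

theorem keeps_stepWalk {r : Fin 10} (h3 : r ≠ 3) (h4 : r ≠ 4) (h5 : r ≠ 5) (h6 : r ≠ 6)
    (h7 : r ≠ 7) : Keeps r stepWalk :=
  ((keeps_sameTest h6 h7).andThen (keeps_setFlags _ _)).andThen <|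
    (keeps_countAll h5 h6).andThen <| Keeps.when ((keeps_copyReg h3 _).andThen <|
      (keeps_copyReg h4 _).andThen (keeps_setFlags _ _)) _

theorem keeps_threeSteps {r : Fin 10} (h3 : r ≠ 3) (h4 : r ≠ 4) (h5 : r ≠ 5) (h6 : r ≠ 6)
    (h7 : r ≠ 7) : Keeps r threeSteps :=
  have h := keeps_stepWalk h3 h4 h5 h6 h7
  h.andThen (h.andThen h)

theorem keeps_tryWalk {r : Fin 10} (h3 : r ≠ 3) (h4 : r ≠ 4) (h5 : r ≠ 5) (h6 : r ≠ 6)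
    (h7 : r ≠ 7) (h8 : r ≠ 8) (h9 : r ≠ 9) : Keeps r tryWalk :=
  (keeps_adjReg _ _ _).andThen <| Keeps.when ((keeps_copyReg h3 _).andThen <|
    (keeps_copyReg h4 _).andThen <| (keeps_setFlags _ _).andThen <|
    ((keeps_threeSteps h3 h4 h5 h6 h7).forAll h9).forAll h8) _

theorem impl_andAdj {i j : Fin 10} (hij : i ≠ j) : Impl (andAdj i j) :=
  (impl_adjReg hij).andThen (impl_setFlags _)

theorem impl_diamondTest : Impl diamondTest :=
  (impl_setFlags _).andThen <| (impl_andAdj (by decide)).andThen <|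
  (impl_andAdj (by decide)).andThen <| (impl_andAdj (by decide)).andThen <|
  (impl_andAdj (by decide)).andThen <| (impl_andAdj (by decide)).andThen (impl_setFlags _)

theorem impl_sameTest : Impl sameTest :=
  (impl_eqReg (by decide)).andThen <| (impl_setFlags _).andThen <|
  (impl_diamondTest.forAll (by decide) (keeps_diamondTest 7)).forAll (by decide)
    ((keeps_diamondTest 6).forAll (by decide))

theorem impl_countAll : Impl countAll :=
  (impl_setFlags _).andThen <| Impl.forAll ((impl_adjReg (by decide)).andThen <|
    (impl_setFlags _).andThen <| (impl_eqReg (by decide)).andThen <|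
    (impl_copyReg (by decide) (by decide)).when _) (by decide) (keeps_countOne (by decide))

theorem impl_stepWalk : Impl stepWalk :=
  (impl_sameTest.andThen (impl_setFlags _)).andThen <| impl_countAll.andThen <|
    Impl.when ((impl_copyReg (by decide) (by decide)).andThen <|
      (impl_copyReg (by decide) (by decide)).andThen (impl_setFlags _)) _

theorem impl_threeSteps : Impl threeSteps :=
  impl_stepWalk.andThen (impl_stepWalk.andThen impl_stepWalk)

theorem impl_tryWalk : Impl tryWalk :=
  (impl_adjReg (by decide)).andThen <| Impl.when ((impl_copyReg (by decide) (by decide)).andThen <|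
    (impl_copyReg (by decide) (by decide)).andThen <| (impl_setFlags _).andThen <|
    (impl_threeSteps.forAll (by decide) (keeps_threeSteps (by decide) (by decide) (by decide)
      (by decide) (by decide))).forAll (by decide) ((keeps_threeSteps (by decide) (by decide)
      (by decide) (by decide) (by decide)).forAll (by decide))) _

theorem impl_decideBad : Impl decideBad :=
  (impl_tryWalk.forAll (by decide) (keeps_tryWalk (by decide) (by decide) (by decide) (by decide)
    (by decide) (by decide) (by decide))).forAll (by decide) ((keeps_tryWalk (by decide) (by decide)
      (by decide) (by decide) (by decide) (by decide) (by decide)).forAll (by decide))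

variable {n : ℕ} (G : SimpleGraph (Fin n))

theorem sameTest_spec {h : RegState} {u w : Fin n} (hn : h.reg 0 = n) (hu : h.reg 1 = u)
    (hw : h.reg 4 = w) :
    let g := sameTest (encodeGraph ⟨n, G⟩) h
    g.fl.bad = h.fl.bad ∧ g.fl.len = h.fl.len ∧ (g.fl.same = true ↔ G.Same u w) := by
  intro g
  set l := encodeGraph ⟨n, G⟩ with hl
  set h' : RegState := ⟨{h.fl with
      test := decide (h.reg 1 = h.reg 4)
      same := decide (h.reg 1 = h.reg 4)}, h.reg⟩ with hh'
  let A : RegState → Prop := fun g => g.fl.bad = h.fl.bad ∧ g.fl.len = h.fl.len ∧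
    g.reg 0 = n ∧ g.reg 1 = u ∧ g.reg 4 = w
  have hA6 : ∀ g b m, A g → A ⟨{g.fl with test := b}, update g.reg 6 m⟩ := fun g b m hg => by
    simpa [A] using hg
  have hA7 : ∀ g b m, A g → A ⟨{g.fl with test := b}, update g.reg 7 m⟩ := fun g b m hg => by
    simpa [A] using hg
  have inner : ∀ (a : Fin n) (g : RegState), A g → g.reg 6 = a →
      A (forAll 7 diamondTest l g) ∧ (forAll 7 diamondTest l g).reg 6 = a ∧
      ((forAll 7 diamondTest l g).fl.same = true ↔ g.fl.same = true ∨
        ∃ b, G.Adj a b ∧ G.Adj u a ∧ G.Adj u b ∧ G.Adj w a ∧ G.Adj w b) := by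
    intro a g hg ha
    have hk : (forAll 7 diamondTest l g).reg 6 = a :=
      (((keeps_diamondTest 6).forAll (by decide)) l g).trans ha
    have := forAll_exists (l := l) (h := g) (i := 7) (f := diamondTest)
      (fun g => A g ∧ g.reg 6 = a) Flags.same
      (fun b => G.Adj a b ∧ G.Adj u a ∧ G.Adj u b ∧ G.Adj w a ∧ G.Adj w b) hg.2.2.1 ⟨hg, ha⟩
      (fun _ _ => rfl) (fun g b m hg => ⟨hA7 g b m hg.1, by simpa using hg.2⟩) ?_
    · exact ⟨this.1.1, hk, this.2⟩
    · rintro b g ⟨hg, ha⟩ hb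
      refine ⟨⟨hg, ha⟩, hb, ?_⟩
      have e : (diamondTest l g).fl.same = (g.fl.same || (true && lookup l (g.reg 6) (g.reg 7) &&
        lookup l (g.reg 1) (g.reg 6) && lookup l (g.reg 1) (g.reg 7) &&
        lookup l (g.reg 4) (g.reg 6) && lookup l (g.reg 4) (g.reg 7))) := rfl
      rw [e, ha, hb, hg.2.2.2.1, hg.2.2.2.2]
      simp only [Bool.or_eq_true, Bool.and_eq_true, hl, lookup_encodeGraph]
      tauto
  have := forAll_exists (l := l) (h := h') (i := 6) (f := forAll 7 diamondTest) A Flags.same _ hn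
    ⟨rfl, rfl, hn, hu, hw⟩ (fun _ _ => rfl) hA6 inner
  refine ⟨this.1.1, this.1.2.1, this.2.trans (or_congr_left ?_)⟩
  simp [hh', hu, hw, Fin.ext_iff]

theorem fl_when_copyReg (b : Flags → Bool) (i j : Fin 10) (l : List (Option Bool)) (h : RegState) :
    (when b (copyReg i j) l h).fl = h.fl := by
  unfold RegState.when
  split_ifs <;> rfl

/-- The count is capped at three, which is enough to recognise degree two. Register `5` retains a
neighbour of `q` other than `p`; at degree two this is the next vertex of the walk. -/
theorem countAll_spec {h : RegState} {p q : Fin n} (hn : h.reg 0 = n) (hp : h.reg 3 = p)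
    (hq : h.reg 4 = q) :
    let g := countAll (encodeGraph ⟨n, G⟩) h
    g.fl.bad = h.fl.bad ∧ g.fl.len = h.fl.len ∧ (g.fl.cnt = 2 ↔ G.ndeg q = 2) ∧
      ((∃ a, G.Adj q a ∧ a ≠ p) → ∃ a : Fin n, g.reg 5 = a ∧ G.Adj q a ∧ a ≠ p) := by
  classical
  intro g
  set l := encodeGraph ⟨n, G⟩ with hl
  have key := forAll_induct (i := 6) (f := countOne) (l := l)
    (h := ⟨{h.fl with cnt := 0}, h.reg⟩)
    (fun k g => (g.fl.bad = h.fl.bad ∧ g.fl.len = h.fl.len ∧ g.reg 0 = n ∧ g.reg 3 = p ∧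
      g.reg 4 = q ∧ g.reg 6 = k) ∧
      (g.fl.cnt : ℕ) = min 3 (Finset.univ.filter fun a : Fin n => a.1 < k ∧ G.Adj q a).card ∧
      ((∃ a : Fin n, a.1 < k ∧ G.Adj q a ∧ a ≠ p) →
        ∃ a : Fin n, g.reg 5 = a ∧ G.Adj q a ∧ a ≠ p)) ?_ ?_
  · obtain ⟨⟨h1, h2, -⟩, h3, h4⟩ := key
    refine ⟨h1, h2, ?_, fun ⟨a, ha⟩ => h4 ⟨a, by simp [hn], ha⟩⟩
    have e : G.ndeg q = (Finset.univ.filter fun a : Fin n => a.1 < h.reg 0 ∧ G.Adj q a).card := by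
      rw [SimpleGraph.ndeg, ← Set.ncard_coe_finset]
      congr 1
      ext a
      simp [hn]
    have h3' : (g.fl.cnt : ℕ) = min 3 (G.ndeg q) := e ▸ h3
    rw [Fin.ext_iff, h3']
    change min 3 _ = 2 ↔ _
    omega
  · simp [eqReg, hn, hp, hq]
  · rintro k hk g ⟨⟨h1, h2, h3, h4, h5, h6⟩, h7, h8⟩
    change k < h.reg 0 at hk
    rw [hn] at hk
    have e : ∃ b : Bool, ∃ c : Bool, (countOne l g).fl = ⟨c, b, g.fl.same, g.fl.bad, g.fl.len,
          if b then (if g.fl.cnt = 3 then 3 else g.fl.cnt + 1) else g.fl.cnt⟩ ∧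
        (b = true ↔ G.Adj q ⟨k, hk⟩) ∧ (c = true ↔ (⟨k, hk⟩ : Fin n) = p) ∧
        (countOne l g).reg = if b && !c then update g.reg 5 k else g.reg := by
      refine ⟨lookup l (g.reg 4) (g.reg 6), decide (g.reg 6 = g.reg 3), ?_, ?_, ?_, ?_⟩
      · simp only [countOne, andThen]
        rw [fl_when_copyReg]
        rfl
      · rw [h5, h6]
        exact lookup_encodeGraph G q ⟨k, hk⟩
      · simp [h6, h4, Fin.ext_iff]
      · rw [← h6]
        exact apply_ite RegState.reg _ _ _
    obtain ⟨b, c, e1, e2, e3, e4⟩ := e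
    have hr : ∀ r, r ≠ 5 → (countOne l g).reg r = g.reg r := fun r hr => keeps_countOne hr l g
    refine ⟨?_, ?_, ?_⟩
    · simp [eqReg, incReg, e1, hr, h1, h2, h3, h4, h5, h6]
    · have hc : (Finset.univ.filter fun a : Fin n => a.1 < k + 1 ∧ G.Adj q a).card =
          (Finset.univ.filter fun a : Fin n => a.1 < k ∧ G.Adj q a).card +
            (if b = true then 1 else 0) := by
        split_ifs with hb
        · rw [← Finset.card_insert_of_notMem (a := ⟨k, hk⟩) (by simp)]
          congr 1
          ext a
          have := e2.1 hb
          simp only [Finset.mem_filter, Finset.mem_univ, true_and, Finset.mem_insert, Fin.ext_iff,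
            Nat.lt_succ_iff_lt_or_eq]
          constructor
          · rintro ⟨h | h, h'⟩
            exacts [Or.inr ⟨h, h'⟩, Or.inl h]
          · rintro (h | ⟨h, h'⟩)
            · exact ⟨Or.inr h, (Fin.ext h : a = ⟨k, hk⟩) ▸ this⟩
            · exact ⟨Or.inl h, h'⟩
        · rw [add_zero]
          congr 1
          ext a
          simp only [Finset.mem_filter, Finset.mem_univ, true_and, Nat.lt_succ_iff_lt_or_eq]
          constructor
          · rintro ⟨h | h, h'⟩
            · exact ⟨h, h'⟩
            · exact absurd (e2.2 ((Fin.ext h : a = ⟨k, hk⟩) ▸ h')) hb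
          · exact fun h => ⟨Or.inl h.1, h.2⟩
      rw [hc]
      simp only [eqReg, incReg, e1]
      generalize (Finset.univ.filter fun a : Fin n => a.1 < k ∧ G.Adj q a).card = m at h7
      have hlt := g.fl.cnt.2
      cases b
      · simpa using h7
      · simp only [if_true]
        split_ifs with h3
        · rw [h3] at h7
          change 3 = _ at h7
          change 3 = _
          omega
        -- Below the cap, addition in `Fin 4` does not wrap around.
        · have : (g.fl.cnt : ℕ) ≠ 3 := fun h => h3 (Fin.ext h)
          rw [Fin.val_add_one_of_lt (Fin.lt_def.2 (by change _ < 3; omega))]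
          omega
    · rintro ⟨a, ha, ha1, ha2⟩
      have e5 : (eqReg 6 0 l (incReg 6 l (countOne l g))).reg 5 = (countOne l g).reg 5 := by
        simp [eqReg, incReg]
      rw [e5, e4]
      by_cases hbc : (b && !c) = true
      · refine ⟨⟨k, hk⟩, by simp [hbc], ?_⟩
        simp only [Bool.and_eq_true, Bool.not_eq_true', ← Bool.not_eq_true, e2, e3] at hbc
        exact hbc
      · rw [if_neg hbc]
        refine h8 ⟨a, ?_, ha1, ha2⟩
        rcases Nat.lt_succ_iff_lt_or_eq.1 ha with h | h
        · exact h
        · have : a = ⟨k, hk⟩ := Fin.ext h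
          subst this
          refine absurd ?_ hbc
          simp only [Bool.and_eq_true, Bool.not_eq_true', ← Bool.not_eq_true, e2, e3]
          exact ⟨ha1, ha2⟩

/-- The state of the search along the walk that starts with `(u, v)`, after `T` steps. -/
def Following (b : Bool) (u v : Fin n) (T : ℕ) (g : RegState) : Prop :=
  g.reg 0 = n ∧ g.reg 1 = u ∧
  (∃ (k : ℕ) (p q : Fin n), G.DWalk k (u, v) (p, q) ∧ g.reg 3 = p ∧ g.reg 4 = q ∧
    g.fl.len = (k + 1 : ℕ) ∧ (k = T ∨ k < T ∧ G.ndeg q ≠ 2)) ∧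
  (g.fl.bad = true ↔ b = true ∨ G.Violates T u v)

variable {G}

/-- The current walk is checked before it is extended, so after `T + 1` steps all `k ≤ T` have been
examined. A walk that has reached a vertex not of degree two stays there, and checking it again
changes nothing. -/
theorem Following.stepWalk {b : Bool} {u v : Fin n} (huv : G.Adj u v) {T : ℕ} {g : RegState}
    (h : Following G b u v T g) :
    Following G b u v (T + 1) (stepWalk (encodeGraph ⟨n, G⟩) g) := by
  obtain ⟨h0, h1, ⟨k, p, q, hw, h3, h4, hl, hk⟩, hb⟩ := h
  have hs := sameTest_spec G h0 h1 h4
  set l := encodeGraph ⟨n, G⟩ with hl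
  set g1 := sameTest l g with hg1
  obtain ⟨s1, s2, s3⟩ := hs
  set g2 : RegState := ⟨{g1.fl with bad := g1.fl.bad || (g1.fl.same && decide (g1.fl.len ≠ 0))},
    g1.reg⟩ with hg2
  have hr : ∀ r, r ≠ 6 → r ≠ 7 → g2.reg r = g.reg r := fun r hr hr' => keeps_sameTest hr hr' l g
  have hbad : g2.fl.bad = true ↔ b = true ∨ G.Violates (T + 1) u v := by
    have e : g2.fl.bad = true ↔ g.fl.bad = true ∨ G.Same u q ∧ ¬ 3 ∣ k + 1 := by
      simp only [hg2, Bool.or_eq_true, Bool.and_eq_true, decide_eq_true_iff, s1, s2, s3]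
      rw [‹g.fl.len = _›, Ne, ZMod.natCast_eq_zero_iff]
    rw [e, hb, or_assoc]
    refine or_congr_right ⟨?_, ?_⟩
    · rintro (⟨k', h, h'⟩ | h)
      · exact ⟨k', by omega, h'⟩
      · exact ⟨k, by omega, p, q, hw, h.1, h.2⟩
    · rintro ⟨k', h, y, w, h', h''⟩
      by_cases hk' : k' < T
      · exact Or.inl ⟨k', hk', y, w, h', h''⟩
      obtain rfl : k' = T := by omega
      rcases hk with rfl | ⟨hk, hd⟩
      · cases hw.unique h'
        exact Or.inr h''
      -- A longer walk would have to pass through `q`, where the current one has stopped.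
      · exact absurd (hw.ndeg_eq_two_of_lt h' hk) hd
  have hp3 : g2.reg 3 = p := (hr 3 (by decide) (by decide)).trans h3
  have hp4 : g2.reg 4 = q := (hr 4 (by decide) (by decide)).trans h4
  have hlen : g2.fl.len = (k + 1 : ℕ) := s2.trans ‹_›
  obtain ⟨c1, c2, c3, c4⟩ := countAll_spec G ((hr 0 (by decide) (by decide)).trans h0) hp3 hp4
  set g3 := countAll l g2 with hg3
  have hr' : ∀ r, r ≠ 5 → r ≠ 6 → g3.reg r = g2.reg r := fun r h h' => keeps_countAll h h' l g2
  have hstep : RegState.stepWalk l g = if decide (g3.fl.cnt = 2) then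
    ⟨{g3.fl with len := g3.fl.len + 1}, update (update g3.reg 3 (g3.reg 4)) 4 (g3.reg 5)⟩
    else g3 := by
    simp only [RegState.stepWalk, extendWalk, checkWalk, andThen, RegState.when]
    rfl
  have hk0 := keeps_stepWalk (r := 0) (by decide) (by decide) (by decide) (by decide)
    (by decide) l g
  have hk1 := keeps_stepWalk (r := 1) (by decide) (by decide) (by decide) (by decide)
    (by decide) l g
  refine ⟨hk0.trans h0, hk1.trans h1, ?_, ?_⟩
  · by_cases hd : G.ndeg q = 2
    · obtain rfl : k = T := by
        rcases hk with h | h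
        exacts [h, absurd hd h.2]
      obtain ⟨a, ha, ha1, ha2⟩ := c4 (SimpleGraph.exists_other_of_ndeg_two hd p)
      refine ⟨k + 1, q, a, hw.snoc ⟨rfl, hw.adj huv, ha1, ha2, hd⟩, ?_, ?_, ?_, Or.inl rfl⟩
      · rw [hstep, if_pos (by simp [c3, hd])]
        simp [hr', hp4]
      · rw [hstep, if_pos (by simp [c3, hd])]
        simpa using ha
      · rw [hstep, if_pos (by simp [c3, hd])]
        simp only [c2, hlen]
        push_cast
        rfl
    · refine ⟨k, p, q, hw, ?_, ?_, ?_, Or.inr ⟨by omega, hd⟩⟩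
      · rw [hstep, if_neg (by simp [c3, hd]), hr' _ (by decide) (by decide), hp3]
      · rw [hstep, if_neg (by simp [c3, hd]), hr' _ (by decide) (by decide), hp4]
      · rw [hstep, if_neg (by simp [c3, hd]), c2, hlen]
  · rw [← hbad, ← c1, hstep]
    split_ifs <;> rfl

/-- Registers `8` and `9` merely count rounds, so the loops over them do not disturb the search. -/
theorem Following.change {b : Bool} {u v : Fin n} {T : ℕ} {g : RegState}
    (h : Following G b u v T g) {r : Fin 10} (hr : r = 8 ∨ r = 9) (t : Bool) (m : ℕ) :
    Following G b u v T ⟨{g.fl with test := t}, update g.reg r m⟩ := by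
  rcases hr with rfl | rfl <;> simpa [Following] using h

theorem Following.forAll {b : Bool} {u v : Fin n} {T c : ℕ} {g : RegState} {f : Transf}
    {l : List (Option Bool)} {r : Fin 10} (hr : r = 8 ∨ r = 9)
    (hf : ∀ T g, Following G b u v T g → Following G b u v (T + c) (f l g))
    (h : Following G b u v T g) : Following G b u v (T + n * c) (forAll r f l g) := by
  have := forAll_induct (i := r) (f := f) (l := l) (h := g)
    (fun k g => Following G b u v (T + k * c) g) (by
      rw [Nat.zero_mul, Nat.add_zero]
      exact h.change hr _ _) fun k _ g hg => by
      have := (hf _ _ hg).change hr (decide ((incReg r l (f l g)).reg r = (incReg r l (f l g)).reg 0))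
        ((f l g).reg r + 1)
      rwa [add_assoc, ← Nat.succ_mul] at this
  rwa [h.1] at this

theorem Following.threeSteps {b : Bool} {u v : Fin n} (huv : G.Adj u v) {T : ℕ} {g : RegState}
    (h : Following G b u v T g) :
    Following G b u v (T + 3) (threeSteps (encodeGraph ⟨n, G⟩) g) := by
  have h3 := ((h.stepWalk huv).stepWalk huv).stepWalk huv
  rw [add_assoc, add_assoc] at h3
  simp only [RegState.threeSteps, andThen]
  exact h3

/-- Two nested loops over the vertices with three steps in each round make `3n²` steps, the bound of
`DWalk.exists_lt`. The flag `len` starts at `1` because a walk of `k` steps has `k + 1` edges. -/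
theorem followWalk_spec {h : RegState} {u v : Fin n} (hn : h.reg 0 = n) (hu : h.reg 1 = u)
    (hv : h.reg 2 = v) (huv : G.Adj u v) :
    (followWalk (encodeGraph ⟨n, G⟩) h).fl.bad = true ↔
      h.fl.bad = true ∨ G.Violates (3 * (n * n)) u v := by
  have h0 : Following G h.fl.bad u v 0
      (setFlags (fun φ => {φ with len := 1}) (encodeGraph ⟨n, G⟩)
        (copyReg 4 2 (encodeGraph ⟨n, G⟩) (copyReg 3 1 (encodeGraph ⟨n, G⟩) h))) := by
    refine ⟨by simpa [setFlags, copyReg], by simpa [setFlags, copyReg], ⟨0, u, v, rfl,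
      by simpa [setFlags, copyReg], by simpa [setFlags, copyReg], by simp [setFlags],
      Or.inl rfl⟩, ?_⟩
    simp [SimpleGraph.Violates, setFlags, copyReg]
  have h1 := (h0.forAll (r := 8) (Or.inl rfl) fun T g hg =>
    hg.forAll (r := 9) (Or.inr rfl) fun T g hg => hg.threeSteps huv).2.2.2
  rwa [show 0 + n * (n * 3) = 3 * (n * n) by ring] at h1

theorem tryWalk_spec {h : RegState} {u v : Fin n} (hn : h.reg 0 = n) (hu : h.reg 1 = u)
    (hv : h.reg 2 = v) :
    (tryWalk (encodeGraph ⟨n, G⟩) h).fl.bad = true ↔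
      h.fl.bad = true ∨ (G.Adj u v ∧ G.Violates (3 * (n * n)) u v) := by
  have e : (adjReg 1 2 (encodeGraph ⟨n, G⟩) h).fl.test = true ↔ G.Adj u v := by
    simp only [adjReg, hu, hv]
    exact lookup_encodeGraph G u v
  simp only [tryWalk, andThen, RegState.when]
  by_cases huv : G.Adj u v
  · rw [if_pos (e.2 huv), and_iff_right huv]
    exact followWalk_spec (h := adjReg 1 2 (encodeGraph ⟨n, G⟩) h) hn hu hv huv
  · rw [if_neg (fun h => huv (e.1 h))]
    simp [huv, adjReg]

theorem decideBad_spec :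
    (decideBad (encodeGraph ⟨n, G⟩) (start n)).fl.bad = true ↔ ¬ G.NoBad := by
  have kt : ∀ r : Fin 10, r < 3 → Keeps r tryWalk := fun r hr => by
    refine keeps_tryWalk ?_ ?_ ?_ ?_ ?_ ?_ ?_ <;> rintro rfl <;> revert hr <;> decide
  have hin : ∀ (u : Fin n) (g : RegState), g.reg 0 = n → g.reg 1 = u →
      ((forAll 2 tryWalk (encodeGraph ⟨n, G⟩) g).fl.bad = true ↔ g.fl.bad = true ∨
        ∃ v, G.Adj u v ∧ G.Violates (3 * (n * n)) u v) := fun u g h0 h1 =>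
    (forAll_exists (fun g => g.reg 0 = n ∧ g.reg 1 = u) Flags.bad
      (fun v => G.Adj u v ∧ G.Violates (3 * (n * n)) u v) h0 ⟨h0, h1⟩ (fun _ _ => rfl)
      (fun g b m hg => by simpa using hg) fun v g hg hv =>
      ⟨⟨(kt 0 (by decide) _ _).trans hg.1, (kt 1 (by decide) _ _).trans hg.2⟩,
        (kt 2 (by decide) _ _).trans hv, tryWalk_spec hg.1 hg.2 hv⟩).2
  have hn : (start n).reg 0 = n := rfl
  have := (forAll_exists (l := encodeGraph ⟨n, G⟩) (i := 1) (f := forAll 2 tryWalk)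
    (fun g => g.reg 0 = n) Flags.bad
    (fun u => ∃ v, G.Adj u v ∧ G.Violates (3 * (n * n)) u v) hn hn (fun _ _ => rfl)
      (fun g b m hg => by simpa using hg) fun u g hg hu =>
      ⟨((kt 0 (by decide)).forAll (by decide) _ _).trans hg,
        ((kt 1 (by decide)).forAll (by decide) _ _).trans hu, hin u g hg hu⟩).2
  rw [SimpleGraph.not_noBad_iff, Fintype.card_fin]
  refine this.trans ?_
  simp [start]

end RegState

end

theorem theorem5 :
    PolynomiallySolvableOn (fun G => InClassC G.2) (fun G => dynamicChromaticNumber G.2 ≤ 3) := by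
  classical
  refine ⟨fun G => decide G.1.2.NoBad, fun G => ?_, ?_⟩
  · exact decide_eq_true_iff.trans
      (SimpleGraph.InClassC.dynamicChromaticNumber_le_iff_noBad G.2).symm
  · refine RegState.polynomiallySolvable_of_impl RegState.impl_decideBad _ fun G => ?_
    rw [Bool.eq_iff_iff, RegState.decideBad_spec]
    simp
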